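/- Let $m\ge 3$, let $W$ be the dihedral group of order $2m$ with simple reflections $s,t$ and Coxeter length $\ell$. For $c\in\{s,t\}$ write $\bar c$ for the other simple reflection and ${}_ck:=c\,\bar c\,c\cdots$ ($k$ factors, $0\le k\le m$), so that ${}_s0={}_t0=e$, ${}_sm={}_tm=w_0$ is the longest element, and $W=\{e,{}_sk,{}_tk,w_0\mid 1\le k\le m-1\}$. Put $\zeta=e^{2\pi i/2m}$ and $[n]=\frac{\zeta^n-\zeta^{-n}}{\zeta-\zeta^{-1}}\in\mathbb R$. Let $Q_m$ be the quiver with vertex set $W$ and exactly one arrow $w\to w'$ whenever $|\ell(w)-\ell(w')|=1$. Write $(x,y,z)$ for the path $x\to y\to z$; in the path algebra $\mathbb RQ_m$ paths are composed from right to left. Let $\mathbf P_m$ be the quotient of $\mathbb RQ_m$ by the two-sided ideal generated by the following relations, for $(c,d)\in\{(s,t),(t,s)\}$, $2\le i\le m-1$, $0\le j\le m-2$: $$\begin{aligned} (e,c,e)&=0,\qquad ({}_c1,{}_c2,{}_c1)=0,\qquad ({}_c1,{}_d2,{}_c1)=-[2]\,({}_c1,e,{}_c1),\\ ({}_ci,{}_c(i+1),{}_ci)&=\tfrac{[i-1]}{[i]}({}_ci,{}_c(i-1),{}_ci),\\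 ({}_ci,{}_d(i+1),{}_ci)&=([i-1]-[i+1])({}_ci,{}_c(i-1),{}_ci)-\tfrac{[i+1]}{[i]}({}_ci,{}_d(i-1),{}_ci),\\ ({}_c1,{}_c2,{}_d1)&=({}_c1,e,{}_d1),\qquad ({}_c1,{}_d2,{}_d1)=({}_c1,e,{}_d1),\\ ({}_ci,{}_c(i+1),{}_di)&=\tfrac1{[i]}({}_ci,{}_c(i-1),{}_di)+({}_ci,{}_d(i-1),{}_di),\\ ({}_ci,{}_d(i+1),{}_di)&=({}_ci,{}_c(i-1),{}_di)+\tfrac1{[i]}({}_ci,{}_d(i-1),{}_di),\\ ({}_cj,{}_c(j+1),{}_c(j+2))&=({}_cj,{}_d(j+1),{}_c(j+2)),\\ ({}_cj,{}_c(j+1),{}_d(j+2))&=({}_cj,{}_d(j+1),{}_d(j+2)),\\ ({}_c(j+2),{}_c(j+1),{}_cj)&=({}_c(j+2),{}_d(j+1),{}_cj),\\ ({}_c(j+2),{}_c(j+1),{}_dj)&=({}_c(j+2),{}_d(j+1),{}_dj). \end{aligned}$$ The algebra $\mathbf P_m=A=\bigoplus_{n\ge0}A_n$ is graded by path length. Then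 $\mathbf P_m$ is Koszul: the ring $A_0$ is semisimple, and the graded left $A$-module $A_0=A/\bigoplus_{n>0}A_n$ admits a linear resolution, that is, an exact sequence $\cdots\to P^2\to P^1\to P^0\to A_0\to0$ of graded left $A$-modules and grading-preserving $A$-linear maps in which every $P^i$ is projective and generated over $A$ by its part $(P^i)_i$ of degree $i$. -/

import Mathlib

open scoped DirectSum

universe u v w

/-! ## Path algebras -/

section PathAlgebra

variable (k : Type u) [CommRing k] (V : Type v) [Quiver.{w} V]

/-- A path of a quiver together with its source and target; trivial paths are included. -/
structure QuiverPath : Type (max v w) where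
  src : V
  tgt : V
  path : Quiver.Path src tgt

/-- The path algebra `k V` of a quiver: the free `k`-module on the set of all paths. -/
def PathAlgebra : Type (max u v w) := QuiverPath V →₀ k

noncomputable instance : AddCommGroup (PathAlgebra k V) :=
  inferInstanceAs (AddCommGroup (QuiverPath V →₀ k))

noncomputable instance : Module k (PathAlgebra k V) :=
  inferInstanceAs (Module k (QuiverPath V →₀ k))

variable {V}

/-- The number of arrows in a path. -/
def QuiverPath.length (p : QuiverPath V) : ℕ := p.path.length

/-- A path as a basis element of the path algebra. -/
noncomputable def PathAlgebra.of (p : QuiverPath V) : PathAlgebra k V := Finsupp.single p 1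

variable {k} in
/-- The linear map with given values on the paths. -/
noncomputable def PathAlgebra.lift {M : Type*} [AddCommGroup M] [Module k M]
    (f : QuiverPath V → M) : PathAlgebra k V →ₗ[k] M :=
  Finsupp.linearCombination k f

theorem PathAlgebra.lift_of {M : Type*} [AddCommGroup M] [Module k M]
    (f : QuiverPath V → M) (p : QuiverPath V) : PathAlgebra.lift f (PathAlgebra.of k p) = f p :=
  (Finsupp.linearCombination_single k (1 : k) p).trans (one_smul k _)

open Classical in
/-- The product of two paths. Paths are composed from right to left, like maps: `p * q` is
"first `q`, then `p`" if `q` ends where `p` starts, and `0` otherwise. -/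
noncomputable def PathAlgebra.pathMul (p q : QuiverPath V) : PathAlgebra k V :=
  if h : q.tgt = p.src then
    PathAlgebra.of k ⟨q.src, p.tgt, q.path.comp (p.path.cast h.symm rfl)⟩
  else 0

variable (V) in
/-- The bilinear extension of the product of paths. -/
noncomputable def PathAlgebra.mulLin :
    PathAlgebra k V →ₗ[k] PathAlgebra k V →ₗ[k] PathAlgebra k V :=
  PathAlgebra.lift fun p => PathAlgebra.lift fun q => PathAlgebra.pathMul k p q

namespace PathAlgebra

noncomputable instance : Mul (PathAlgebra k V) := ⟨fun a b => mulLin k V a b⟩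

/-- The unit is the sum of all trivial paths. -/
noncomputable instance [Fintype V] : One (PathAlgebra k V) :=
  ⟨∑ x : V, of k ⟨x, x, Quiver.Path.nil⟩⟩

theorem mul_def (a b : PathAlgebra k V) : a * b = mulLin k V a b := rfl

theorem one_def [Fintype V] :
    (1 : PathAlgebra k V) = ∑ x : V, of k ⟨x, x, Quiver.Path.nil⟩ := rfl

theorem of_mul_of (p q : QuiverPath V) : of k p * of k q = pathMul k p q := by
  rw [mul_def, mulLin, lift_of, lift_of]

theorem of_mul_of_comp {x y z : V} (p : Quiver.Path y z) (q : Quiver.Path x y) :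
    of k ⟨y, z, p⟩ * of k ⟨x, y, q⟩ = of k ⟨x, z, q.comp p⟩ := by
  rw [of_mul_of]; simp [pathMul]

theorem of_mul_of_ne {p q : QuiverPath V} (h : q.tgt ≠ p.src) : of k p * of k q = 0 := by
  rw [of_mul_of]; simp [pathMul, h]

variable {k} in
@[elab_as_elim]
theorem induction {motive : PathAlgebra k V → Prop} (a : PathAlgebra k V) (zero : motive 0)
    (add : ∀ a b, motive a → motive b → motive (a + b))
    (smul : ∀ (c : k) (p : QuiverPath V), motive (c • of k p)) : motive a := by
  refine Finsupp.induction_linear a zero add fun p c => ?_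
  have h : (Finsupp.single p c : QuiverPath V →₀ k) = c • Finsupp.single p 1 := by simp
  rw [h]
  exact smul c p

theorem smul_mul' (c : k) (a b : PathAlgebra k V) : c • a * b = c • (a * b) := by
  simp [mul_def]

theorem mul_smul' (c : k) (a b : PathAlgebra k V) : a * c • b = c • (a * b) := by
  simp [mul_def]

theorem add_mul' (a b c : PathAlgebra k V) : (a + b) * c = a * c + b * c := by
  simp [mul_def]

theorem mul_add' (a b c : PathAlgebra k V) : a * (b + c) = a * b + a * c := by
  simp [mul_def]

theorem zero_mul' (a : PathAlgebra k V) : 0 * a = 0 := by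
  simp [mul_def]

theorem mul_zero' (a : PathAlgebra k V) : a * 0 = 0 := by
  simp [mul_def]

theorem mul_assoc_of (p q r : QuiverPath V) :
    of k p * of k q * of k r = of k p * (of k q * of k r) := by
  obtain ⟨a, b, p⟩ := p
  obtain ⟨c, d, q⟩ := q
  obtain ⟨e, f, r⟩ := r
  by_cases h₁ : d = a
  · subst h₁
    by_cases h₂ : f = c
    · subst h₂
      simp only [of_mul_of_comp, Quiver.Path.comp_assoc]
    · rw [of_mul_of_comp, of_mul_of_ne k (by exact h₂), of_mul_of_ne k (by exact h₂), mul_zero']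
  · rw [of_mul_of_ne k (by exact h₁), zero_mul']
    by_cases h₂ : f = c
    · subst h₂
      rw [of_mul_of_comp, of_mul_of_ne k (by exact h₁)]
    · rw [of_mul_of_ne k (by exact h₂), mul_zero']

protected theorem mul_assoc (a b c : PathAlgebra k V) : a * b * c = a * (b * c) := by
  induction a using induction with
  | zero => simp only [zero_mul']
  | add a a' ha ha' => simp only [add_mul', ha, ha']
  | smul s p =>
    induction b using induction with
    | zero => simp only [zero_mul', mul_zero']
    | add b b' hb hb' => simp only [add_mul', mul_add', hb, hb']
    | smul t q =>
      induction c using induction with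
      | zero => simp only [mul_zero']
      | add c c' hc hc' => simp only [mul_add', hc, hc']
      | smul r q' => simp only [smul_mul', mul_smul', mul_assoc_of]

variable [Fintype V]

theorem one_mul_of (p : QuiverPath V) : 1 * of k p = of k p := by
  obtain ⟨a, b, p⟩ := p
  have h : (1 : PathAlgebra k V) * of k ⟨a, b, p⟩
      = ∑ x : V, of k ⟨x, x, Quiver.Path.nil⟩ * of k ⟨a, b, p⟩ := by
    simp only [one_def, mul_def, map_sum, LinearMap.sum_apply]
  rw [h, Finset.sum_eq_single b]
  · rw [of_mul_of_comp, Quiver.Path.comp_nil]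
  · intro x _ hx
    exact of_mul_of_ne k (by exact hx.symm)
  · simp

theorem of_mul_one (p : QuiverPath V) : of k p * 1 = of k p := by
  obtain ⟨a, b, p⟩ := p
  have h : of k ⟨a, b, p⟩ * (1 : PathAlgebra k V)
      = ∑ x : V, of k ⟨a, b, p⟩ * of k ⟨x, x, Quiver.Path.nil⟩ := by
    simp only [one_def, mul_def, map_sum]
  rw [h, Finset.sum_eq_single a]
  · rw [of_mul_of_comp, Quiver.Path.nil_comp]
  · intro x _ hx
    exact of_mul_of_ne k (by exact hx)
  · simp

noncomputable instance : Ring (PathAlgebra k V) :=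
  { (inferInstance : AddCommGroup (PathAlgebra k V)),
    (inferInstance : Mul (PathAlgebra k V)),
    (inferInstance : One (PathAlgebra k V)) with
    left_distrib := mul_add' k
    right_distrib := add_mul' k
    zero_mul := zero_mul' k
    mul_zero := mul_zero' k
    mul_assoc := PathAlgebra.mul_assoc k
    one_mul := fun a => by
      induction a using induction with
      | zero => exact mul_zero' k _
      | add a b ha hb => rw [mul_add', ha, hb]
      | smul c p => rw [mul_smul', one_mul_of]
    mul_one := fun a => by
      induction a using induction with
      | zero => exact zero_mul' k _
      | add a b ha hb => rw [add_mul', ha, hb]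
      | smul c p => rw [smul_mul', of_mul_one] }

noncomputable instance : Algebra k (PathAlgebra k V) :=
  Algebra.ofModule (smul_mul' k) (mul_smul' k)

variable (V) in
/-- The part of degree `n` of the path algebra: the span of the paths of length `n`. -/
noncomputable def degreePart (n : ℕ) : Submodule k (PathAlgebra k V) :=
  Submodule.span k {a | ∃ p : QuiverPath V, p.length = n ∧ a = of k p}

theorem of_mem (p : QuiverPath V) : of k p ∈ degreePart k V p.length :=
  Submodule.subset_span ⟨p, rfl, rfl⟩

instance : SetLike.GradedMonoid (degreePart k V) where
  one_mem := by
    rw [one_def]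
    exact Submodule.sum_mem _ fun x _ => of_mem k ⟨x, x, Quiver.Path.nil⟩
  mul_mem := by
    intro i j a b ha hb
    have hle : degreePart k V i * degreePart k V j ≤ degreePart k V (i + j) := by
      rw [degreePart, degreePart, Submodule.span_mul_span, Submodule.span_le]
      rintro _ ⟨_, ⟨⟨x, y, p⟩, hp, rfl⟩, _, ⟨⟨z, t, q⟩, hq, rfl⟩, rfl⟩
      by_cases h : t = x
      · subst h
        have hl : (⟨z, y, q.comp p⟩ : QuiverPath V).length = i + j := by
          subst hp hq
          simp [QuiverPath.length, Quiver.Path.length_comp, add_comm]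
        have := of_mem k (⟨z, y, q.comp p⟩ : QuiverPath V)
        rw [hl] at this
        simpa only [of_mul_of_comp, SetLike.mem_coe] using this
      · simp only [of_mul_of_ne k (p := ⟨x, y, p⟩) (q := ⟨z, t, q⟩) h, SetLike.mem_coe,
          Submodule.zero_mem]
    exact hle (Submodule.mul_mem_mul ha hb)

variable (V) in
/-- The decomposition of an element of the path algebra into homogeneous parts. -/
noncomputable def decomposeLin : PathAlgebra k V →ₗ[k] ⨁ n, degreePart k V n :=
  lift fun p =>
    DirectSum.lof k ℕ (fun n => degreePart k V n) p.length ⟨of k p, of_mem k p⟩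

theorem decomposeLin_of (p : QuiverPath V) : decomposeLin k V (of k p) =
    DirectSum.lof k ℕ (fun n => degreePart k V n) p.length ⟨of k p, of_mem k p⟩ := by
  rw [decomposeLin, lift_of]

/-- The grading of the path algebra by path length. -/
noncomputable instance gradedAlgebra : GradedAlgebra (degreePart k V) where
  toDecomposition := DirectSum.Decomposition.ofLinearMap _ (decomposeLin k V)
    (by
      ext a
      rw [LinearMap.comp_apply, LinearMap.id_apply]
      induction a using induction with
      | zero => simp
      | add a b ha hb => rw [map_add, map_add, ha, hb]
      | smul c p =>
        rw [map_smul, map_smul, decomposeLin_of]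
        simp)
    (by
      ext n ⟨a, ha⟩ : 2
      simp only [LinearMap.comp_apply, LinearMap.id_apply, DirectSum.coeLinearMap_lof]
      induction ha using Submodule.span_induction with
      | mem x hx =>
        obtain ⟨p, rfl, rfl⟩ := hx
        exact decomposeLin_of k p
      | zero => rw [map_zero]; exact (map_zero _).symm
      | add x y hx hy h₁ h₂ => rw [map_add, h₁, h₂, ← map_add]; rfl
      | smul c x hx h => rw [map_smul, h, ← map_smul]; rfl)

end PathAlgebra

end PathAlgebra

/-! ## Quotients of graded algebras by homogeneous relations -/

section Quotient

variable {k : Type u} [CommRing k] {B : Type v} [Ring B] [Algebra k B]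

/-- The image in the quotient by the two-sided ideal generated by relations of a family of
submodules. -/
noncomputable def quotientGrading (r : B → B → Prop) (ℬ : ℕ → Submodule k B) (n : ℕ) :
    Submodule k (RingQuot r) :=
  (ℬ n).map (RingQuot.mkAlgHom k r).toLinearMap

instance (r : B → B → Prop) (ℬ : ℕ → Submodule k B) [SetLike.GradedMonoid ℬ] :
    SetLike.GradedMonoid (quotientGrading r ℬ) where
  one_mem := ⟨1, SetLike.GradedOne.one_mem, map_one (RingQuot.mkAlgHom k r)⟩
  mul_mem := by
    rintro i j _ _ ⟨a, ha, rfl⟩ ⟨b, hb, rfl⟩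
    exact ⟨a * b, SetLike.GradedMul.mul_mem ha hb, map_mul (RingQuot.mkAlgHom k r) a b⟩

/-- The map from the homogeneous parts to those of the quotient. -/
noncomputable def quotientGradingMap (r : B → B → Prop) (ℬ : ℕ → Submodule k B) (n : ℕ) :
    ℬ n →ₗ[k] quotientGrading r ℬ n :=
  (RingQuot.mkAlgHom k r).toLinearMap.restrict fun a ha => ⟨a, ha, rfl⟩

/-- The decomposition of an element, mapped to the quotient. -/
noncomputable def quotientDecompose (r : B → B → Prop) (ℬ : ℕ → Submodule k B)
    [GradedAlgebra ℬ] : B →ₐ[k] ⨁ n, quotientGrading r ℬ n :=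
  (DirectSum.toAlgebra k (fun n => ℬ n)
    (fun n => (DirectSum.lof k ℕ (fun n => quotientGrading r ℬ n) n).comp
      (quotientGradingMap r ℬ n))
    (by
      rw [LinearMap.comp_apply, DirectSum.lof_eq_of]
      refine congrArg (DirectSum.of (fun n => quotientGrading r ℬ n) 0) ?_
      exact Subtype.ext (map_one (RingQuot.mkAlgHom k r)))
    (fun {i j} a b => by
      simp only [LinearMap.comp_apply, DirectSum.lof_eq_of]
      rw [DirectSum.of_mul_of]
      congr 1
      exact Subtype.ext (map_mul (RingQuot.mkAlgHom k r) (a : B) (b : B)))).comp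
    (DirectSum.decomposeAlgEquiv ℬ).toAlgHom

theorem quotientDecompose_mem (r : B → B → Prop) (ℬ : ℕ → Submodule k B) [GradedAlgebra ℬ]
    {n : ℕ} {a : B} (ha : a ∈ ℬ n) : quotientDecompose r ℬ a =
      DirectSum.lof k ℕ (fun n => quotientGrading r ℬ n) n
        ⟨RingQuot.mkAlgHom k r a, a, ha, rfl⟩ := by
  have h : DirectSum.decomposeAlgEquiv ℬ a = DirectSum.of (fun n => ℬ n) n ⟨a, ha⟩ :=
    DirectSum.decompose_of_mem ℬ ha
  rw [quotientDecompose, AlgHom.comp_apply]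
  erw [h, DirectSum.toAlgebra_apply, DirectSum.toSemiring_of]
  rfl

/-- If the relations are homogeneous, the quotient inherits the grading. -/
noncomputable abbrev quotientGradedAlgebra (r : B → B → Prop) (ℬ : ℕ → Submodule k B)
    [GradedAlgebra ℬ] (hr : ∀ a b, r a b → ∃ n, a ∈ ℬ n ∧ b ∈ ℬ n) :
    GradedAlgebra (quotientGrading r ℬ) :=
  GradedAlgebra.ofAlgHom (quotientGrading r ℬ)
    (RingQuot.liftAlgHom k ⟨quotientDecompose r ℬ, fun {a b} hab => by
      obtain ⟨n, ha, hb⟩ := hr a b hab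
      rw [quotientDecompose_mem r ℬ ha, quotientDecompose_mem r ℬ hb]
      congr 1
      exact Subtype.ext (RingQuot.mkAlgHom_rel k hab)⟩)
    (by
      refine RingQuot.ringQuot_ext' k _ _ ?_
      refine AlgHom.ext fun a => ?_
      simp only [AlgHom.comp_apply, RingQuot.liftAlgHom_mkAlgHom_apply, AlgHom.id_apply]
      induction a using DirectSum.Decomposition.inductionOn ℬ with
      | zero => simp
      | homogeneous a =>
        rw [quotientDecompose_mem r ℬ a.2, DirectSum.lof_eq_of, DirectSum.coeAlgHom_of]
      | add a b ha hb => rw [map_add, map_add, ha, hb, map_add])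
    (by
      rintro n ⟨_, a, ha, rfl⟩
      exact (RingQuot.liftAlgHom_mkAlgHom_apply k _ _ a).trans (quotientDecompose_mem r ℬ ha))

end Quotient

/-! ## Koszul algebras -/

section Koszul

variable {k : Type u} [CommRing k] {A : Type v} [Ring A] [Algebra k A]

/-- A linear resolution of a graded left `A`-module `M = ⨁ₙ ℳ n`: an exact sequence
`⋯ → P 2 → P 1 → P 0 → M → 0` of graded left modules and maps that preserve the grading, where
`P i` is projective and generated over `A` by its part of degree `i`. (Since `A` lives in degrees
`≥ 0`, a graded module generated in degree `i ≥ 0` lives in degrees `≥ 0`, too.) -/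
structure LinearResolution (𝒜 : ℕ → Submodule k A) (M : Type v) [AddCommGroup M] [Module A M]
    (ℳ : ℕ → AddSubgroup M) where
  P : ℕ → Type v
  [addCommGroup : ∀ i, AddCommGroup (P i)]
  [module : ∀ i, Module A (P i)]
  /-- `grading i n` is the part of degree `n` of `P i`. -/
  grading : ∀ i, ℕ → AddSubgroup (P i)
  isInternal : ∀ i, DirectSum.IsInternal (grading i)
  smul_mem : ∀ i j n, ∀ a ∈ 𝒜 j, ∀ x ∈ grading i n, a • x ∈ grading i (j + n)
  projective : ∀ i, Module.Projective A (P i)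
  generated : ∀ i, Submodule.span A (grading i i : Set (P i)) = ⊤
  d : ∀ i, P (i + 1) →ₗ[A] P i
  d_mem : ∀ i n, ∀ x ∈ grading (i + 1) n, d i x ∈ grading i n
  augmentation : P 0 →ₗ[A] M
  augmentation_mem : ∀ n, ∀ x ∈ grading 0 n, augmentation x ∈ ℳ n
  augmentation_surjective : Function.Surjective augmentation
  exact_zero : Function.Exact (d 0) augmentation
  exact_succ : ∀ i, Function.Exact (d (i + 1)) (d i)

/-- The part `A₀` of degree `0` of a graded algebra, as a left `A`-module: `a • x = a₀ x`, where
`a₀` is the component of degree `0` of `a`. -/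
def DegreeZero (𝒜 : ℕ → Submodule k A) : Type v := 𝒜 0

instance (𝒜 : ℕ → Submodule k A) : AddCommGroup (DegreeZero 𝒜) :=
  inferInstanceAs (AddCommGroup (𝒜 0))

noncomputable instance (𝒜 : ℕ → Submodule k A) [GradedAlgebra 𝒜] : Module A (DegreeZero 𝒜) :=
  Module.compHom (𝒜 0) (GradedRing.projZeroRingHom' 𝒜)

/-- `A₀` is concentrated in degree `0`. -/
def DegreeZero.grading (𝒜 : ℕ → Submodule k A) (n : ℕ) : AddSubgroup (DegreeZero 𝒜) :=
  if n = 0 then ⊤ else ⊥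

/-- A graded algebra `A = ⨁_{i ≥ 0} A_i` is Koszul if `A₀` is a semisimple ring and `A₀` has a
linear resolution as a graded left `A`-module. -/
def IsKoszul (𝒜 : ℕ → Submodule k A) [GradedAlgebra 𝒜] : Prop :=
  IsSemisimpleRing (𝒜 0) ∧
    Nonempty (LinearResolution 𝒜 (DegreeZero 𝒜) (DegreeZero.grading 𝒜))

end Koszul

/-! ## The algebra `P_m` -/

namespace Dihedral

/-- The two simple reflections (colours). -/
inductive Colour
  | s
  | t
  deriving DecidableEq

instance : Fintype Colour := ⟨{.s, .t}, fun x => by cases x <;> decide⟩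

/-- The other colour. -/
def Colour.swap : Colour → Colour
  | .s => .t
  | .t => .s

/-- The elements of the dihedral group `W` of order `2 m`: the identity `e`, the alternating
products `c c' c ⋯` of `k` factors for a colour `c` and `1 ≤ k ≤ m - 1` (here `mid c i` has
`i + 1` factors), and the longest element `w₀`. -/
inductive W (m : ℕ)
  | e
  | mid (c : Colour) (i : Fin (m - 1))
  | w₀
  deriving DecidableEq, Fintype

variable {m : ℕ}

/-- The Coxeter length. -/
def W.length : W m → ℕ
  | .e => 0
  | .mid _ i => i + 1
  | .w₀ => m

variable (m) in
/-- The alternating product `c c' c ⋯` of `k` factors, for `0 ≤ k ≤ m`. -/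
def word (c : Colour) (k : ℕ) : W m :=
  if k = 0 then .e else if h : k - 1 < m - 1 then .mid c ⟨k - 1, h⟩ else .w₀

theorem length_word (c : Colour) {k : ℕ} (hk : k ≤ m) : (word m c k).length = k := by
  unfold word
  split_ifs with h₁ h₂ <;> simp only [W.length] <;> omega

/-- The quiver `Q_m`: there is one arrow from `x` to `y` if the lengths of `x` and `y` differ
by `1`, and no arrow otherwise. -/
instance : Quiver (W m) :=
  ⟨fun x y => PLift (x.length = y.length + 1 ∨ y.length = x.length + 1)⟩

/-- The path `(x, y, z) = (x → y → z)` of length two in the path algebra `ℝ Q_m`; it is only used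
where the two arrows exist. -/
noncomputable def path (x y z : W m) : PathAlgebra ℝ (W m) :=
  if h : (x.length = y.length + 1 ∨ y.length = x.length + 1) ∧
      (y.length = z.length + 1 ∨ z.length = y.length + 1) then
    PathAlgebra.of ℝ ⟨x, z, (Quiver.Path.nil.cons (⟨h.1⟩ : x ⟶ y)).cons (⟨h.2⟩ : y ⟶ z)⟩
  else 0

variable (m) in
/-- The root of unity `ζ = e^{2 π i / 2 m}`. -/
noncomputable def zeta : ℂ := Complex.exp (2 * Real.pi * Complex.I / (2 * m))

variable (m) in
/-- The quantum number `[n]_ζ = (ζⁿ - ζ⁻ⁿ) / (ζ - ζ⁻¹)`, a real number. -/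
noncomputable def qnum (n : ℕ) : ℝ :=
  ((zeta m ^ n - (zeta m)⁻¹ ^ n) / (zeta m - (zeta m)⁻¹)).re

theorem qnum_eq_sin (n : ℕ) :
    qnum m n = Real.sin (n * (Real.pi / m)) / Real.sin (Real.pi / m) := by
  have hz : zeta m = Complex.exp ((Real.pi / m : ℝ) * Complex.I) := by
    rw [zeta]
    congr 1
    push_cast
    rw [mul_assoc, mul_div_mul_left _ _ two_ne_zero]
    ring
  have hk : ∀ j : ℕ, zeta m ^ j - (zeta m)⁻¹ ^ j
      = ((2 * Real.sin (j * (Real.pi / m)) : ℝ) : ℂ) * Complex.I := by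
    intro j
    rw [hz, ← Complex.exp_neg, ← Complex.exp_nat_mul, ← Complex.exp_nat_mul]
    have h₁ : (j : ℂ) * ((Real.pi / m : ℝ) * Complex.I)
        = ((j * (Real.pi / m) : ℝ) : ℂ) * Complex.I := by push_cast; ring
    have h₂ : (j : ℂ) * -((Real.pi / m : ℝ) * Complex.I)
        = (-(j * (Real.pi / m) : ℝ) : ℂ) * Complex.I := by push_cast; ring
    rw [h₁, h₂, Complex.exp_mul_I, Complex.exp_mul_I, Complex.cos_neg, Complex.sin_neg]
    push_cast
    ring
  have h1 := hk 1
  simp only [pow_one, Nat.cast_one, one_mul] at h1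
  rw [qnum, hk, h1, mul_div_mul_right _ _ Complex.I_ne_zero, ← Complex.ofReal_div,
    Complex.ofReal_re, mul_div_mul_left _ _ two_ne_zero]

/-- The dihedral relations (left side = right side), for both colours `c`. -/
inductive Rel (m : ℕ) : PathAlgebra ℝ (W m) → PathAlgebra ℝ (W m) → Prop
  | r1 (c : Colour) : Rel m (path .e (word m c 1) .e) 0
  | r2 (c : Colour) : Rel m (path (word m c 1) (word m c 2) (word m c 1)) 0
  | r3 (c : Colour) (i : ℕ) (h : 2 ≤ i) (h' : i ≤ m - 1) :
      Rel m (path (word m c i) (word m c (i + 1)) (word m c i))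
        ((qnum m (i - 1) / qnum m i) • path (word m c i) (word m c (i - 1)) (word m c i))
  | r4 (c : Colour) :
      Rel m (path (word m c 1) (word m c.swap 2) (word m c 1))
        (-qnum m 2 • path (word m c 1) .e (word m c 1))
  | r5 (c : Colour) (i : ℕ) (h : 2 ≤ i) (h' : i ≤ m - 1) :
      Rel m (path (word m c i) (word m c.swap (i + 1)) (word m c i))
        ((qnum m (i - 1) - qnum m (i + 1)) •
            path (word m c i) (word m c (i - 1)) (word m c i)
          - (qnum m (i + 1) / qnum m i) •
            path (word m c i) (word m c.swap (i - 1)) (word m c i))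
  | r6 (c : Colour) :
      Rel m (path (word m c 1) (word m c 2) (word m c.swap 1))
        (path (word m c 1) .e (word m c.swap 1))
  | r7 (c : Colour) :
      Rel m (path (word m c 1) (word m c.swap 2) (word m c.swap 1))
        (path (word m c 1) .e (word m c.swap 1))
  | r8 (c : Colour) (i : ℕ) (h : 2 ≤ i) (h' : i ≤ m - 1) :
      Rel m (path (word m c i) (word m c (i + 1)) (word m c.swap i))
        ((1 / qnum m i) • path (word m c i) (word m c (i - 1)) (word m c.swap i)
          + path (word m c i) (word m c.swap (i - 1)) (word m c.swap i))
  | r9 (c : Colour) (i : ℕ) (h : 2 ≤ i) (h' : i ≤ m - 1) :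
      Rel m (path (word m c i) (word m c.swap (i + 1)) (word m c.swap i))
        (path (word m c i) (word m c (i - 1)) (word m c.swap i)
          + (1 / qnum m i) • path (word m c i) (word m c.swap (i - 1)) (word m c.swap i))
  | r10 (c : Colour) (j : ℕ) (h : j ≤ m - 2) :
      Rel m (path (word m c j) (word m c (j + 1)) (word m c (j + 2)))
        (path (word m c j) (word m c.swap (j + 1)) (word m c (j + 2)))
  | r11 (c : Colour) (j : ℕ) (h : j ≤ m - 2) :
      Rel m (path (word m c j) (word m c (j + 1)) (word m c.swap (j + 2)))
        (path (word m c j) (word m c.swap (j + 1)) (word m c.swap (j + 2)))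
  | r12 (c : Colour) (j : ℕ) (h : j ≤ m - 2) :
      Rel m (path (word m c (j + 2)) (word m c (j + 1)) (word m c j))
        (path (word m c (j + 2)) (word m c.swap (j + 1)) (word m c j))
  | r13 (c : Colour) (j : ℕ) (h : j ≤ m - 2) :
      Rel m (path (word m c (j + 2)) (word m c (j + 1)) (word m c.swap j))
        (path (word m c (j + 2)) (word m c.swap (j + 1)) (word m c.swap j))

/-- The `ℝ`-algebra `P_m`: the path algebra of `Q_m` modulo the two-sided ideal generated by the
dihedral relations. -/
abbrev P (m : ℕ) : Type := RingQuot (Rel m)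

/-- The grading of `P_m` by path length. -/
noncomputable abbrev P.grading (m : ℕ) : ℕ → Submodule ℝ (P m) :=
  quotientGrading (Rel m) (PathAlgebra.degreePart ℝ (W m))

theorem path_mem (x y z : W m) : path x y z ∈ PathAlgebra.degreePart ℝ (W m) 2 := by
  unfold path
  split_ifs with h
  · have := PathAlgebra.of_mem ℝ
      (⟨x, z, (Quiver.Path.nil.cons (⟨h.1⟩ : x ⟶ y)).cons (⟨h.2⟩ : y ⟶ z)⟩ : QuiverPath (W m))
    simpa only [QuiverPath.length, Quiver.Path.length_cons, Quiver.Path.length_nil] using this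
  · exact Submodule.zero_mem _

theorem Rel.homogeneous (a b : PathAlgebra ℝ (W m)) (h : Rel m a b) :
    ∃ n, a ∈ PathAlgebra.degreePart ℝ (W m) n ∧ b ∈ PathAlgebra.degreePart ℝ (W m) n := by
  refine ⟨2, ?_⟩
  have h₀ := path_mem (m := m)
  have hs := fun (c : ℝ) x y z => Submodule.smul_mem _ c (h₀ x y z)
  cases h with
  | r1 => exact ⟨h₀ _ _ _, Submodule.zero_mem _⟩
  | r2 => exact ⟨h₀ _ _ _, Submodule.zero_mem _⟩
  | r3 => exact ⟨h₀ _ _ _, hs _ _ _ _⟩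
  | r4 => exact ⟨h₀ _ _ _, hs _ _ _ _⟩
  | r5 => exact ⟨h₀ _ _ _, Submodule.sub_mem _ (hs _ _ _ _) (hs _ _ _ _)⟩
  | r6 => exact ⟨h₀ _ _ _, h₀ _ _ _⟩
  | r7 => exact ⟨h₀ _ _ _, h₀ _ _ _⟩
  | r8 => exact ⟨h₀ _ _ _, Submodule.add_mem _ (hs _ _ _ _) (h₀ _ _ _)⟩
  | r9 => exact ⟨h₀ _ _ _, Submodule.add_mem _ (h₀ _ _ _) (hs _ _ _ _)⟩
  | r10 => exact ⟨h₀ _ _ _, h₀ _ _ _⟩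
  | r11 => exact ⟨h₀ _ _ _, h₀ _ _ _⟩
  | r12 => exact ⟨h₀ _ _ _, h₀ _ _ _⟩
  | r13 => exact ⟨h₀ _ _ _, h₀ _ _ _⟩

noncomputable instance (m : ℕ) : GradedAlgebra (P.grading m) :=
  quotientGradedAlgebra (Rel m) (PathAlgebra.degreePart ℝ (W m)) Rel.homogeneous

end Dihedral

/-! The proof is a Koszul filtration whose colon ideals are computed with an explicit
representation. Write A for the algebra, R_x = `radIdeal x` for the left ideal generated by all
arrows out of x, and L_x = `lowerIdeal x` for the one generated by the descending arrows. The
degree-zero part is a quotient of ℝ^W, hence semisimple, and the positive part of A is the direct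
sum of the R_x. It therefore suffices to resolve each R_x linearly.

Adjoin the generators of L_x and R_x one at a time. If J has been reached and a : x → y is the next
arrow, then (J + Aa)/J is the shift by one of A e_y / C with C = {b ∈ A e_y | ba ∈ J}. A mapping
cone argument (`Ideal.IsLinear.step`) turns linear resolutions of J and C into one of J + Aa. The
ideals C that occur stay within the family 0, L_y, R_y. For two descending arrows to y₁ ≠ y₂ they
are 0 (`mul_arr_eq_zero`) and L_{y₂} (`mul_arr_mem_span`). For two ascending arrows, adjoined to
L_x, they are L_{y₁} (`mul_arr_mem_lowerIdeal`) and R_{y₂} (`mul_arr_mem_sup`). The recursion for L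
descends in length, the one for R ascends, and both stop, so all resolutions are finite.

That C contains the stated ideal follows from the relations: "up, then down" can be rewritten
through paths that descend first (`up_down_mem`), and squares of ascending or of descending arrows
commute (`up_up`, `down_down`). The converse says that A has not collapsed, and is proved by letting
A act on `BigProj`. The relevant basis vectors there are pairs (y, z), thought of as "descend from
w₀ to y, then ascend to z". An ascending arrow moves z; a descending arrow sends (z, z) to (z', z');
on (y, z) with y shorter than z it moves z and acts on y through two commuting operators X, Y with
X² + Y² = [2]YX. These two identities, with the identities for quantum numbers, are what the
relations need (`pathRep_rel`).

Modulo L_y the space A e_y is spanned by ascending paths, one for each endpoint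
(`exists_sum_upElt`). Applied to (y, y), the path to z gives (y, z), whereas L_y only yields pairs
with first entry shorter than y. So the action reads off coefficients modulo L_y, and by induction
on the length of y it is faithful on A e_y (`eq_zero_of_bigRep`). -/

/-! ## Graded modules with finite linear resolutions -/

section GradedModules

variable {k : Type u} [CommRing k] {A : Type v} [Ring A] [Algebra k A]

/-- A graded left module over a graded algebra, given by the projections to the homogeneous
components. -/
structure GrMod (𝒜 : ℕ → Submodule k A) where
  carrier : Type v
  [addCommGroup : AddCommGroup carrier]
  [module : Module A carrier]
  comp : ℕ → carrier →+ carrier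
  exists_sum : ∀ x, ∃ N, ∑ n ∈ Finset.range N, comp n x = x
  comp_comp : ∀ i j x, comp i (comp j x) = if i = j then comp j x else 0
  comp_smul : ∀ {j a}, a ∈ 𝒜 j → ∀ n x, comp (j + n) (a • comp n x) = a • comp n x

namespace GrMod

variable {𝒜 : ℕ → Submodule k A}

instance : CoeSort (GrMod 𝒜) (Type v) := ⟨carrier⟩

instance (X : GrMod 𝒜) : AddCommGroup X := X.addCommGroup

instance (X : GrMod 𝒜) : Module A X := X.module

/-- The homogeneous part of degree `n`. -/
def part (X : GrMod 𝒜) (n : ℕ) : AddSubgroup X where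
  carrier := {x | X.comp n x = x}
  add_mem' := fun {x y} hx hy => by
    simp only [Set.mem_ofPred_eq] at *
    rw [map_add, hx, hy]
  zero_mem' := map_zero _
  neg_mem' := fun {x} hx => by
    simp only [Set.mem_ofPred_eq] at *
    rw [map_neg, hx]

theorem mem_part {X : GrMod 𝒜} {n : ℕ} {x : X} : x ∈ X.part n ↔ X.comp n x = x := Iff.rfl

theorem comp_mem_part (X : GrMod 𝒜) (n : ℕ) (x : X) : X.comp n x ∈ X.part n := by
  rw [mem_part, comp_comp, if_pos rfl]

theorem comp_of_mem_part {X : GrMod 𝒜} {n : ℕ} {x : X} (hx : x ∈ X.part n) (i : ℕ) :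
    X.comp i x = if i = n then x else 0 := by
  have := X.comp_comp i n x
  rwa [mem_part.1 hx] at this

theorem smul_mem_part {X : GrMod 𝒜} {j n : ℕ} {a : A} (ha : a ∈ 𝒜 j) {x : X}
    (hx : x ∈ X.part n) : a • x ∈ X.part (j + n) := by
  have := X.comp_smul ha n x
  rwa [mem_part.1 hx] at this

theorem isInternal (X : GrMod 𝒜) : DirectSum.IsInternal X.part := by
  have key : ∀ (z : ⨁ n, X.part n) (j : ℕ),
      X.comp j (DirectSum.coeAddMonoidHom X.part z) = z j := by
    intro z j
    induction z using DirectSum.induction_on with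
    | zero => simp
    | of i x =>
      rw [DirectSum.coeAddMonoidHom_of, comp_of_mem_part x.2, DirectSum.of_apply]
      by_cases h : j = i
      · subst h; simp
      · rw [if_neg h, dif_neg (Ne.symm h)]; rfl
    | add x y hx hy =>
      rw [map_add, map_add, hx, hy, DirectSum.add_apply]; rfl
  constructor
  · intro z w h
    refine DFinsupp.ext fun j => Subtype.ext ?_
    rw [← key, ← key, h]
  · intro x
    obtain ⟨N, hN⟩ := X.exists_sum x
    refine ⟨∑ n ∈ Finset.range N, DirectSum.of (fun n => X.part n) n ⟨_, X.comp_mem_part n x⟩, ?_⟩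
    rw [map_sum]
    simp only [DirectSum.coeAddMonoidHom_of]
    exact hN

/-- A linear map that preserves the grading. -/
def IsGraded {X Y : GrMod 𝒜} (f : X →ₗ[A] Y) : Prop := ∀ n x, f (X.comp n x) = Y.comp n (f x)

theorem IsGraded.mem_part {X Y : GrMod 𝒜} {f : X →ₗ[A] Y} (hf : IsGraded f) {n : ℕ} {x : X}
    (hx : x ∈ X.part n) : f x ∈ Y.part n := by
  rw [GrMod.mem_part, ← hf, GrMod.mem_part.1 hx]

/-- A graded submodule. -/
def sub (X : GrMod 𝒜) (S : Submodule A X) (hS : ∀ n, ∀ x ∈ S, X.comp n x ∈ S) : GrMod 𝒜 where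
  carrier := S
  comp := fun n =>
    { toFun := fun x => ⟨X.comp n x, hS n x x.2⟩
      map_zero' := Subtype.ext (map_zero _)
      map_add' := fun x y => Subtype.ext (map_add _ _ _) }
  exists_sum := fun x => by
    obtain ⟨N, hN⟩ := X.exists_sum x
    refine ⟨N, Subtype.ext ?_⟩
    rw [AddSubmonoidClass.coe_finsetSum]
    exact hN
  comp_comp := fun i j x => by
    refine Subtype.ext ((X.comp_comp i j x).trans ?_)
    split_ifs <;> rfl
  comp_smul := fun ha n x => Subtype.ext (X.comp_smul ha n x)

/-- The kernel of a graded map. -/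
def ker {X Y : GrMod 𝒜} (f : X →ₗ[A] Y) (hf : IsGraded f) : GrMod 𝒜 :=
  X.sub (LinearMap.ker f) fun n x hx => by
    rw [LinearMap.mem_ker] at *
    rw [hf, hx, map_zero]

/-- The direct sum of two graded modules. -/
def prod (X Y : GrMod 𝒜) : GrMod 𝒜 where
  carrier := X × Y
  comp := fun n => (X.comp n).prodMap (Y.comp n)
  exists_sum := fun x => by
    -- Components beyond a bound N that works vanish, so the bounds of the two summands can be
    -- replaced by their maximum.
    have stab : ∀ (Z : GrMod 𝒜) (z : Z) (N : ℕ), ∑ n ∈ Finset.range N, Z.comp n z = z →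
        ∀ N' ≥ N, ∑ n ∈ Finset.range N', Z.comp n z = z := by
      intro Z z N hN N' hNN'
      rw [← Finset.sum_range_add_sum_Ico _ hNN', hN, Finset.sum_eq_zero, add_zero]
      intro i hi
      rw [← hN, map_sum]
      refine Finset.sum_eq_zero fun j hj => ?_
      rw [comp_comp, if_neg]
      have := Finset.mem_range.1 hj
      have := (Finset.mem_Ico.1 hi).1
      omega
    obtain ⟨N, hN⟩ := X.exists_sum x.1
    obtain ⟨N', hN'⟩ := Y.exists_sum x.2
    refine ⟨max N N', Prod.ext ?_ ?_⟩
    · rw [Prod.fst_sum]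
      exact stab X x.1 N hN _ (le_max_left _ _)
    · rw [Prod.snd_sum]
      exact stab Y x.2 N' hN' _ (le_max_right _ _)
  comp_comp := fun i j x => by
    refine Prod.ext ((X.comp_comp i j x.1).trans ?_) ((Y.comp_comp i j x.2).trans ?_) <;>
      split_ifs <;> rfl
  comp_smul := fun ha n x => Prod.ext (X.comp_smul ha n x.1) (Y.comp_smul ha n x.2)

/-! ### Graded projectives, finite linear resolutions and their splicing -/

/-- A graded module that is projective and generated in degree `n`, and projective for
grading-preserving maps. -/
structure LinProj (n : ℕ) (P : GrMod 𝒜) : Prop where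
  projective : Module.Projective A P
  generated : Submodule.span A (P.part n : Set P) = ⊤
  lift : ∀ (X N : GrMod 𝒜) (p : X →ₗ[A] N) (f : P →ₗ[A] N), IsGraded p → IsGraded f →
    Function.Surjective p → ∃ h : P →ₗ[A] X, IsGraded h ∧ p ∘ₗ h = f

theorem LinProj.of_subsingleton (n : ℕ) (P : GrMod 𝒜) [Subsingleton P] : LinProj n P where
  projective := inferInstance
  generated := Subsingleton.elim _ _
  lift := fun _ _ _ _ _ _ _ => ⟨0, fun _ _ => by simp, LinearMap.ext fun x => by
    rw [Subsingleton.elim x 0, map_zero, map_zero]⟩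

theorem LinProj.prod {n : ℕ} {P Q : GrMod 𝒜} (hP : LinProj n P) (hQ : LinProj n Q) :
    LinProj n (P.prod Q) where
  projective := by
    have := hP.projective
    have := hQ.projective
    exact inferInstanceAs (Module.Projective A (P × Q))
  generated := by
    rw [eq_top_iff]
    have h1 : Submodule.map (LinearMap.inl A P Q) ⊤ ≤
        (Submodule.span A ((P.prod Q).part n : Set (P.prod Q)) : Submodule A (P × Q)) := by
      rw [← hP.generated, Submodule.map_span, Submodule.span_le]
      rintro _ ⟨x, hx, rfl⟩
      refine Submodule.subset_span ?_
      exact Prod.ext hx (map_zero (Q.comp n))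
    have h2 : Submodule.map (LinearMap.inr A P Q) ⊤ ≤
        (Submodule.span A ((P.prod Q).part n : Set (P.prod Q)) : Submodule A (P × Q)) := by
      rw [← hQ.generated, Submodule.map_span, Submodule.span_le]
      rintro _ ⟨x, hx, rfl⟩
      refine Submodule.subset_span ?_
      exact Prod.ext (map_zero (P.comp n)) hx
    rintro ⟨x, y⟩ -
    have := Submodule.add_mem _ (h1 ⟨x, trivial, rfl⟩) (h2 ⟨y, trivial, rfl⟩)
    rwa [LinearMap.inl_apply, LinearMap.inr_apply, Prod.mk_add_mk, add_zero, zero_add] at this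
  lift := fun X N p f hp hf hs => by
    obtain ⟨h1, hg1, he1⟩ := hP.lift X N p (f ∘ₗ LinearMap.inl A P Q) hp (fun n x => by
      have := hf n (x, 0)
      refine Eq.trans ?_ this
      exact congrArg f (Prod.ext rfl (map_zero (Q.comp n)).symm)) hs
    obtain ⟨h2, hg2, he2⟩ := hQ.lift X N p (f ∘ₗ LinearMap.inr A P Q) hp (fun n x => by
      have := hf n (0, x)
      refine Eq.trans ?_ this
      exact congrArg f (Prod.ext (map_zero (P.comp n)).symm rfl)) hs
    refine ⟨(LinearMap.coprod h1 h2 : P × Q →ₗ[A] X), ?_, ?_⟩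
    · rintro n ⟨x, y⟩
      change h1 (P.comp n x) + h2 (Q.comp n y) = X.comp n (h1 x + h2 y)
      rw [hg1, hg2, map_add]
    · refine LinearMap.ext fun z => ?_
      obtain ⟨x, y⟩ := z
      have e1 := LinearMap.congr_fun he1 x
      have e2 := LinearMap.congr_fun he2 y
      change p (h1 x + h2 y) = f (x, y)
      rw [map_add]
      refine (congrArg₂ (· + ·) e1 e2).trans ?_
      change f (x, 0) + f (0, y) = f (x, y)
      refine (map_add f _ _).symm.trans (congrArg f ?_)
      exact Prod.ext (add_zero x) (zero_add y)

/-- `X` has a linear resolution of length less than `d` whose `i`-th term is generated in degree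
`n + i`. -/
def HasLin : ℕ → ℕ → GrMod 𝒜 → Prop
  | 0, _, X => Subsingleton X
  | d + 1, n, X => ∃ (P : GrMod 𝒜) (f : P →ₗ[A] X) (hf : IsGraded f),
      Function.Surjective f ∧ LinProj n P ∧ HasLin d (n + 1) (ker f hf)

theorem HasLin.of_subsingleton (d : ℕ) : ∀ (n : ℕ) (X : GrMod 𝒜), Subsingleton X →
    HasLin d n X := by
  induction d with
  | zero => exact fun n X h => h
  | succ d ih =>
    intro n X h
    refine ⟨X, LinearMap.id, fun _ _ => rfl, Function.surjective_id,
      LinProj.of_subsingleton n X, ih _ _ ?_⟩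
    exact inferInstanceAs (Subsingleton (LinearMap.ker (LinearMap.id : X →ₗ[A] X)))

theorem HasLin.succ {d : ℕ} : ∀ {n : ℕ} {X : GrMod 𝒜}, HasLin d n X → HasLin (d + 1) n X := by
  induction d with
  | zero => exact fun {n X} h => HasLin.of_subsingleton 1 n X h
  | succ d ih =>
    rintro n X ⟨P, f, hf, hs, hP, h⟩
    exact ⟨P, f, hf, hs, hP, ih h⟩

/-- Zero modules pad a resolution, so that two resolutions can be given a common length bound. -/
theorem HasLin.mono {d d' n : ℕ} (hd : d ≤ d') {X : GrMod 𝒜} (h : HasLin d n X) :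
    HasLin d' n X := by
  induction hd with
  | refl => exact h
  | step _ ih => exact ih.succ

/-- The horseshoe lemma. -/
theorem HasLin.extension {d : ℕ} : ∀ {n : ℕ} {K X N : GrMod 𝒜} (i : K →ₗ[A] X) (p : X →ₗ[A] N),
    IsGraded i → IsGraded p → Function.Injective i → Function.Exact i p →
    Function.Surjective p → HasLin d n K → HasLin d n N → HasLin d n X := by
  induction d with
  | zero =>
    intro n K X N i p _ _ _ he _ hK hN
    have hK : Subsingleton K := hK
    have hN : Subsingleton N := hN
    refine ⟨fun x y => ?_⟩
    have h0 : ∀ x : X, x = 0 := fun x => by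
      obtain ⟨z, rfl⟩ := (he x).1 (Subsingleton.elim _ _)
      rw [Subsingleton.elim z 0, map_zero]
    rw [h0 x, h0 y]
  | succ d ih =>
    rintro n K X N i p hi hp hinj he hs ⟨P, f, hf, hfs, hP, hfK⟩ ⟨Q, g, hg, hgs, hQ, hgK⟩
    -- Projectivity of the underlying module would give some lift; the field `lift` gives one that
    -- respects degrees.
    obtain ⟨h, hh, hph⟩ := hQ.lift X N p g hp hg hs
    have hph' : ∀ q, p (h q) = g q := fun q => LinearMap.congr_fun hph q
    have hpi : ∀ x, p (i x) = 0 := fun x => (he _).2 ⟨x, rfl⟩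
    let F : P.prod Q →ₗ[A] X := (LinearMap.coprod (i ∘ₗ f) h : P × Q →ₗ[A] X)
    have hF : ∀ x y, F (x, y) = i (f x) + h y := fun x y => rfl
    have hFg : IsGraded F := by
      rintro n ⟨x, y⟩
      change i (f (P.comp n x)) + h (Q.comp n y) = X.comp n (i (f x) + h y)
      rw [hf, hi, hh, map_add]
    refine ⟨P.prod Q, F, hFg, ?_, hP.prod hQ, ?_⟩
    · intro x
      obtain ⟨q, hq⟩ := hgs (p x)
      obtain ⟨z, hz⟩ := (he (x - h q)).1 (by rw [map_sub, hph', hq, sub_self])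
      obtain ⟨y, rfl⟩ := hfs z
      exact ⟨(y, q), by rw [hF, hz, sub_add_cancel]⟩
    -- The kernels form a short exact sequence ker f → ker F → ker g, to which the induction
    -- hypothesis applies one degree higher.
    · refine ih (K := ker f hf) (N := ker g hg)
        (LinearMap.codRestrict (LinearMap.ker F)
          ((LinearMap.inl A P Q) ∘ₗ (LinearMap.ker f).subtype) ?_)
        (LinearMap.codRestrict (LinearMap.ker g)
          ((LinearMap.snd A P Q) ∘ₗ (LinearMap.ker F).subtype) ?_) ?_ ?_ ?_ ?_ ?_ hfK hgK
      · rintro ⟨x, hx⟩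
        rw [LinearMap.mem_ker] at *
        refine (hF x 0).trans ?_
        rw [hx, map_zero, map_zero, add_zero]
      · rintro ⟨⟨x, y⟩, hx⟩
        rw [LinearMap.mem_ker] at *
        have hx' : i (f x) + h y = 0 := hx
        have := congrArg p hx'
        rw [map_add, hpi, zero_add, hph', map_zero] at this
        exact this
      · rintro n ⟨x, hx⟩
        exact Subtype.ext (Prod.ext rfl (map_zero (Q.comp n)).symm)
      · rintro n ⟨⟨x, y⟩, hx⟩
        rfl
      · rintro ⟨x, hx⟩ ⟨y, hy⟩ hxy
        have := congrArg (fun z => (Subtype.val z).1) hxy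
        exact Subtype.ext this
      · rintro ⟨⟨x, y⟩, hx⟩
        constructor
        · intro h0
          have hy : y = 0 := congrArg Subtype.val h0
          subst hy
          have hx' : i (f x) + h 0 = 0 := hx
          rw [map_zero, add_zero] at hx'
          exact ⟨⟨x, hinj (hx'.trans (map_zero i).symm)⟩, rfl⟩
        · rintro ⟨⟨x', hx'⟩, hxx⟩
          refine Subtype.ext ?_
          have : (0 : Q) = y := congrArg (fun z => (Subtype.val z).2) hxx
          exact this.symm
      · rintro ⟨y, hy⟩
        have hy' : g y = 0 := hy
        obtain ⟨z, hz⟩ := (he (h y)).1 (by rw [hph', hy'])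
        obtain ⟨x, rfl⟩ := hfs z
        refine ⟨⟨(-x, y), ?_⟩, rfl⟩
        refine (hF (-x) y).trans ?_
        rw [map_neg, map_neg, hz, neg_add_cancel]

/-- An isomorphism is an extension with zero kernel, so the horseshoe lemma already transports
resolutions. -/
theorem HasLin.of_bijective {d n : ℕ} {X Y : GrMod 𝒜} (f : X →ₗ[A] Y) (hf : IsGraded f)
    (hb : Function.Bijective f) (h : HasLin d n Y) : HasLin d n X := by
  let Z : GrMod 𝒜 := X.sub ⊥ (fun n x hx => by
    rw [Submodule.mem_bot] at *
    rw [hx, map_zero])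
  refine HasLin.extension (K := Z) ((⊥ : Submodule A X).subtype) f (fun _ _ => rfl) hf
    Subtype.val_injective ?_ hb.2
    (HasLin.of_subsingleton _ _ _ (inferInstanceAs (Subsingleton (⊥ : Submodule A X)))) h
  intro x
  constructor
  · intro hx
    exact ⟨0, (map_zero _).trans (hb.1 (hx.trans (map_zero f).symm)).symm⟩
  · rintro ⟨z, rfl⟩
    rw [Subsingleton.elim (α := (⊥ : Submodule A X)) z 0]
    exact map_zero f

/-- If `X` is generated by a graded submodule `J` and the image of `f : P → X` with `P` projective,
then a linear resolution of `X` results from those of `J` and of `f⁻¹ J`. -/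
theorem HasLin.step {d n : ℕ} {J P C X : GrMod 𝒜} (i : J →ₗ[A] X) (f : P →ₗ[A] X) (j : C →ₗ[A] P)
    (hi : IsGraded i) (hf : IsGraded f) (hj : IsGraded j) (hiinj : Function.Injective i)
    (hjinj : Function.Injective j) (hgen : ∀ x, ∃ y z, i y + f z = x)
    (hC : ∀ z, (∃ y, i y = f z) ↔ ∃ c, j c = z) (hP : LinProj n P)
    (hJ : HasLin (d + 1) n J) (hCl : HasLin d (n + 1) C) : HasLin (d + 1) n X := by
  obtain ⟨Q, g, hg, hgs, hQ, hgK⟩ := hJ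
  let F : Q.prod P →ₗ[A] X := (LinearMap.coprod (i ∘ₗ g) f : Q × P →ₗ[A] X)
  have hF : ∀ x y, F (x, y) = i (g x) + f y := fun x y => rfl
  have hFg : IsGraded F := by
    rintro n ⟨x, y⟩
    change i (g (Q.comp n x)) + f (P.comp n y) = X.comp n (i (g x) + f y)
    rw [hg, hi, hf, map_add]
  refine ⟨Q.prod P, F, hFg, ?_, hQ.prod hP, ?_⟩
  · intro x
    obtain ⟨y, z, rfl⟩ := hgen x
    obtain ⟨y, rfl⟩ := hgs y
    exact ⟨(y, z), rfl⟩
  -- The kernel of F : Q ⊕ P → X is an extension of f⁻¹(J), realised as the range of j, by ker g;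
  -- the second projection has this range because `hC` identifies it with the z for which f z lies
  -- in J.
  let R : GrMod 𝒜 := P.sub (LinearMap.range j) (by
    rintro n _ ⟨c, rfl⟩
    exact ⟨C.comp n c, hj n c⟩)
  have hR : HasLin d (n + 1) R := by
    let e := LinearEquiv.ofInjective j hjinj
    refine HasLin.of_bijective (X := R) (Y := C) e.symm.toLinearMap ?_ e.symm.bijective hCl
    intro n x
    obtain ⟨c, rfl⟩ := e.surjective x
    apply e.injective
    refine (e.apply_symm_apply _).trans (Eq.trans
      (show R.comp n (e c) = e (C.comp n c) from Subtype.ext (hj n c).symm) ?_)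
    exact congrArg (fun z => e (C.comp n z)) (e.symm_apply_apply c).symm
  refine HasLin.extension (K := ker g hg) (N := R)
    (LinearMap.codRestrict (LinearMap.ker F)
      ((LinearMap.inl A Q P) ∘ₗ (LinearMap.ker g).subtype) ?_)
    (LinearMap.codRestrict (LinearMap.range j)
      ((LinearMap.snd A Q P) ∘ₗ (LinearMap.ker F).subtype) ?_) ?_ ?_ ?_ ?_ ?_ hgK hR
  · rintro ⟨x, hx⟩
    rw [LinearMap.mem_ker] at *
    refine (hF x 0).trans ?_
    rw [hx, map_zero, map_zero, add_zero]
  · rintro ⟨⟨x, y⟩, hx⟩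
    have hx' : i (g x) + f y = 0 := hx
    exact (hC y).1 ⟨-g x, by rw [map_neg, neg_eq_iff_add_eq_zero, hx']⟩
  · rintro n ⟨x, hx⟩
    exact Subtype.ext (Prod.ext rfl (map_zero (P.comp n)).symm)
  · rintro n ⟨⟨x, y⟩, hx⟩
    rfl
  · rintro ⟨x, hx⟩ ⟨y, hy⟩ hxy
    have := congrArg (fun z => (Subtype.val z).1) hxy
    exact Subtype.ext this
  · rintro ⟨⟨x, y⟩, hx⟩
    constructor
    · intro h0
      have hy : y = 0 := congrArg Subtype.val h0
      subst hy
      have hx' : i (g x) + f 0 = 0 := hx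
      rw [map_zero, add_zero] at hx'
      exact ⟨⟨x, hiinj (hx'.trans (map_zero i).symm)⟩, rfl⟩
    · rintro ⟨⟨x', hx'⟩, hxx⟩
      refine Subtype.ext ?_
      have : (0 : P) = y := congrArg (fun z => (Subtype.val z).2) hxx
      exact this.symm
  · rintro ⟨y, hy⟩
    obtain ⟨z, hz⟩ := (hC y).2 hy
    obtain ⟨x, rfl⟩ := hgs z
    refine ⟨⟨(-x, y), ?_⟩, rfl⟩
    refine (hF (-x) y).trans ?_
    rw [map_neg, map_neg, hz, neg_add_cancel]

/-- A linear resolution of a graded module with terms starting in degree `n`. -/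
structure LinRes (n : ℕ) (X : GrMod 𝒜) where
  P : ℕ → GrMod 𝒜
  linProj : ∀ i, LinProj (n + i) (P i)
  d : ∀ i, P (i + 1) →ₗ[A] P i
  d_graded : ∀ i, IsGraded (d i)
  aug : P 0 →ₗ[A] X
  aug_graded : IsGraded aug
  aug_surjective : Function.Surjective aug
  exact_zero : Function.Exact (d 0) aug
  exact_succ : ∀ i, Function.Exact (d (i + 1)) (d i)

/-- Each syzygy is covered by the next projective; composing the cover with the inclusion of the
kernel gives the differential. Past the end, the sequence continues with a zero module and identity
maps. -/
theorem HasLin.nonempty_linRes {d : ℕ} : ∀ {n : ℕ} {X : GrMod 𝒜}, HasLin d n X →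
    Nonempty (LinRes n X) := by
  induction d with
  | zero =>
    intro n X hX
    have hX : Subsingleton X := hX
    have h0 : ∀ x : X, x = 0 := fun x => Subsingleton.elim _ _
    exact ⟨⟨fun _ => X, fun i => LinProj.of_subsingleton _ X, fun _ => LinearMap.id,
      fun _ _ _ => rfl, LinearMap.id, fun _ _ => rfl, Function.surjective_id,
      fun x => ⟨fun _ => ⟨x, rfl⟩, fun _ => h0 _⟩, fun i x => ⟨fun _ => ⟨x, rfl⟩, fun _ => h0 _⟩⟩⟩
  | succ d ih =>
    rintro n X ⟨Q, f, hf, hs, hQ, hK⟩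
    obtain ⟨R⟩ := ih hK
    refine ⟨{
      P := fun i => Nat.casesOn i Q R.P
      linProj := fun i => ?_
      d := fun i => Nat.casesOn i ((LinearMap.ker f).subtype ∘ₗ R.aug) R.d
      d_graded := fun i => ?_
      aug := f
      aug_graded := hf
      aug_surjective := hs
      exact_zero := ?_
      exact_succ := fun i => ?_ }⟩
    · cases i with
      | zero => exact hQ
      | succ i =>
        have := R.linProj i
        rwa [Nat.add_right_comm] at this
    · cases i with
      | zero => exact fun n x => congrArg Subtype.val (R.aug_graded n x)
      | succ i => exact R.d_graded i
    · intro x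
      constructor
      · intro hx
        obtain ⟨y, hy⟩ := R.aug_surjective ⟨x, hx⟩
        exact ⟨y, congrArg Subtype.val hy⟩
      · rintro ⟨y, rfl⟩
        exact (R.aug y).2
    · cases i with
      | zero =>
        intro x
        refine Iff.trans ?_ (R.exact_zero x)
        exact ⟨fun h => Subtype.ext h, fun h => congrArg Subtype.val h⟩
      | succ i => exact R.exact_succ i

end GrMod

end GradedModules

/-! ## Left ideals with linear resolutions -/

section LeftIdeals

variable {k : Type u} [CommRing k] {A : Type v} [Ring A] [Algebra k A]
variable {𝒜 : ℕ → Submodule k A}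

namespace GrMod

variable [GradedAlgebra 𝒜]

variable (𝒜) in
theorem exists_sum_decompose (a : A) :
    ∃ N, ∑ n ∈ Finset.range N, (DirectSum.decompose 𝒜 a n : A) = a := by
  classical
  obtain ⟨N, hN⟩ := (DFinsupp.support (DirectSum.decompose 𝒜 a)).exists_nat_subset_range
  refine ⟨N, ?_⟩
  conv_rhs => rw [← DirectSum.sum_support_decompose 𝒜 a]
  refine (Finset.sum_subset hN fun i _ hi => ?_).symm
  rw [DFinsupp.notMem_support_iff] at hi
  rw [hi]
  rfl

variable (𝒜) in
theorem decompose_decompose (a : A) (i j : ℕ) :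
    (DirectSum.decompose 𝒜 (DirectSum.decompose 𝒜 a j : A) i : A)
      = if i = j then (DirectSum.decompose 𝒜 a j : A) else 0 := by
  split_ifs with h
  · subst h
    exact DirectSum.decompose_of_mem_same 𝒜 (SetLike.coe_mem _)
  · exact DirectSum.decompose_of_mem_ne 𝒜 (SetLike.coe_mem _) (Ne.symm h)

variable (𝒜) in
/-- The component of degree `n` of an element of the algebra whose grading is shifted by `s`. -/
def shiftedComp (s n : ℕ) : A →+ A where
  toFun a := if s ≤ n then (DirectSum.decompose 𝒜 a (n - s) : A) else 0
  map_zero' := by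
    rw [DirectSum.decompose_zero]
    exact ite_self _
  map_add' a b := by
    rw [DirectSum.decompose_add]
    split_ifs
    · rfl
    · exact (add_zero 0).symm

variable (𝒜) in
theorem shiftedComp_apply (s n : ℕ) (a : A) : shiftedComp 𝒜 s n a
    = if s ≤ n then (DirectSum.decompose 𝒜 a (n - s) : A) else 0 := rfl

/-- A homogeneous left ideal, with the grading shifted by `s`, as a graded module. -/
def ofIdeal (I : Ideal A) (hI : I.IsHomogeneous 𝒜) (s : ℕ) : GrMod 𝒜 where
  carrier := I
  comp := fun n =>
    { toFun := fun x => ⟨shiftedComp 𝒜 s n x, by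
        rw [shiftedComp_apply]
        split_ifs
        · exact hI _ x.2
        · exact I.zero_mem⟩
      map_zero' := Subtype.ext (map_zero _)
      map_add' := fun x y => Subtype.ext (map_add _ _ _) }
  exists_sum := fun x => by
    obtain ⟨N, hN⟩ := exists_sum_decompose 𝒜 (x : A)
    refine ⟨s + N, Subtype.ext ?_⟩
    rw [AddSubmonoidClass.coe_finsetSum]
    refine Eq.trans (Finset.sum_congr rfl fun n _ => shiftedComp_apply 𝒜 s n x) ?_
    rw [Finset.sum_range_add, Finset.sum_eq_zero, zero_add]
    · conv_rhs => rw [← hN]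
      refine Finset.sum_congr rfl fun n _ => ?_
      rw [if_pos (Nat.le_add_right s n), Nat.add_sub_cancel_left]
    · intro n hn
      rw [if_neg (by have := Finset.mem_range.1 hn; omega)]
  comp_comp := fun i j x => by
    refine Subtype.ext ?_
    change shiftedComp 𝒜 s i (shiftedComp 𝒜 s j x) = _
    by_cases hj : s ≤ j
    · rw [shiftedComp_apply, shiftedComp_apply, if_pos hj, decompose_decompose]
      by_cases hij : i = j
      · subst hij
        rw [if_pos hj, if_pos rfl, if_pos rfl]
        exact (if_pos hj).symm
      · rw [if_neg hij]
        by_cases hi : s ≤ i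
        · rw [if_pos hi, if_neg (by omega)]; rfl
        · rw [if_neg hi]; rfl
    · have h0 : shiftedComp 𝒜 s j (x : A) = 0 := if_neg hj
      rw [h0, map_zero]
      split_ifs
      · exact h0.symm
      · rfl
  comp_smul := fun {j a} ha n x => by
    refine Subtype.ext ?_
    change shiftedComp 𝒜 s (j + n) (a * shiftedComp 𝒜 s n x) = a * shiftedComp 𝒜 s n x
    by_cases hn : s ≤ n
    · rw [shiftedComp_apply, shiftedComp_apply, if_pos hn, if_pos (by omega), Nat.add_sub_assoc hn]
      exact DirectSum.decompose_of_mem_same 𝒜 (SetLike.GradedMul.mul_mem ha (SetLike.coe_mem _))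
    · have h0 : shiftedComp 𝒜 s n (x : A) = 0 := if_neg hn
      rw [h0, mul_zero, map_zero]

/-- The inclusion of a left ideal into the algebra. -/
def ofIdealVal (I : Ideal A) (hI : I.IsHomogeneous 𝒜) (s : ℕ) : ofIdeal I hI s →ₗ[A] A :=
  I.subtype

theorem ofIdealVal_mem {I : Ideal A} {hI : I.IsHomogeneous 𝒜} {s : ℕ} (x : ofIdeal I hI s) :
    ofIdealVal I hI s x ∈ I := (show I from x).2

theorem ofIdealVal_injective {I : Ideal A} {hI : I.IsHomogeneous 𝒜} {s : ℕ} :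
    Function.Injective (ofIdealVal I hI s) := Subtype.val_injective

theorem exists_ofIdealVal {I : Ideal A} {hI : I.IsHomogeneous 𝒜} {s : ℕ} {a : A} (ha : a ∈ I) :
    ∃ x, ofIdealVal I hI s x = a := ⟨(⟨a, ha⟩ : I), rfl⟩

theorem ofIdealVal_comp {I : Ideal A} {hI : I.IsHomogeneous 𝒜} {s : ℕ} (n : ℕ)
    (x : ofIdeal I hI s) : ofIdealVal I hI s ((ofIdeal I hI s).comp n x)
      = shiftedComp 𝒜 s n (ofIdealVal I hI s x) := rfl

/-- Lift a map into the algebra to a map into a left ideal. -/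
def ofIdealLift {X : Type*} [AddCommGroup X] [Module A X] {I : Ideal A} (hI : I.IsHomogeneous 𝒜)
    (s : ℕ) (f : X →ₗ[A] A) (h : ∀ x, f x ∈ I) : X →ₗ[A] ofIdeal I hI s :=
  LinearMap.codRestrict I f h

theorem ofIdealVal_lift {X : Type*} [AddCommGroup X] [Module A X] {I : Ideal A}
    (hI : I.IsHomogeneous 𝒜) (s : ℕ) (f : X →ₗ[A] A) (h : ∀ x, f x ∈ I) (x : X) :
    ofIdealVal I hI s (ofIdealLift hI s f h x) = f x := rfl

theorem isGraded_ofIdealLift {X : GrMod 𝒜} {I : Ideal A} (hI : I.IsHomogeneous 𝒜)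
    (s : ℕ) (f : X →ₗ[A] A) (h : ∀ x, f x ∈ I)
    (hf : ∀ n x, f (X.comp n x) = shiftedComp 𝒜 s n (f x)) : IsGraded (ofIdealLift hI s f h) := by
  intro n x
  apply ofIdealVal_injective
  rw [ofIdealVal_comp, ofIdealVal_lift, ofIdealVal_lift, hf]

/-- Here the ideal is A e, a retract of A through right multiplication by e, and e generates it in
degree s. A graded map out of A e is determined by an element of e X of degree s. -/
theorem linProj_ofIdeal {e : A} (he : e * e = e) (he0 : e ∈ 𝒜 0) {I : Ideal A}
    (hI : I.IsHomogeneous 𝒜) (hIe : ∀ a, a ∈ I ↔ a * e = a) (s : ℕ) :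
    LinProj s (ofIdeal I hI s) := by
  obtain ⟨ε, hε⟩ := exists_ofIdealVal (hI := hI) (s := s) ((hIe e).2 he)
  have hsmul : ∀ a : ofIdeal I hI s, ofIdealVal I hI s a • ε = a := fun a => by
    apply ofIdealVal_injective
    rw [map_smul, hε]
    exact (hIe _).1 (ofIdealVal_mem a)
  have hcomp : (ofIdeal I hI s).comp s ε = ε := by
    apply ofIdealVal_injective
    rw [ofIdealVal_comp, shiftedComp_apply, hε, if_pos le_rfl, Nat.sub_self]
    exact DirectSum.decompose_of_mem_same 𝒜 he0
  refine ⟨?_, ?_, ?_⟩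
  · refine Module.Projective.of_split (M := A) (ofIdealVal I hI s)
      (LinearMap.toSpanSingleton A _ ε) ?_
    exact LinearMap.ext hsmul
  · rw [eq_top_iff]
    intro a _
    rw [← hsmul a]
    exact Submodule.smul_mem _ _ (Submodule.subset_span hcomp)
  · intro X N p f hp hf hs
    obtain ⟨x, hx⟩ := hs (f ε)
    -- An arbitrary preimage x of the image of ε need not be homogeneous or fixed by e; its
    -- component of degree s, multiplied by e, is still a preimage.
    have hy : e • X.comp s x ∈ X.part s := by
      have := smul_mem_part he0 (X.comp_mem_part s x)
      rwa [zero_add] at this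
    refine ⟨(LinearMap.toSpanSingleton A X (e • X.comp s x)) ∘ₗ ofIdealVal I hI s, ?_, ?_⟩
    · intro n a
      rw [LinearMap.comp_apply, LinearMap.comp_apply, LinearMap.toSpanSingleton_apply,
        LinearMap.toSpanSingleton_apply, ofIdealVal_comp, shiftedComp_apply]
      generalize ofIdealVal I hI s a = b
      obtain ⟨M, hM⟩ := exists_sum_decompose 𝒜 b
      conv_rhs => rw [← hM, Finset.sum_smul, map_sum]
      have h1 : ∀ i, X.comp n ((DirectSum.decompose 𝒜 b i : A) • e • X.comp s x)
          = if n = i + s then (DirectSum.decompose 𝒜 b i : A) • e • X.comp s x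
            else 0 := fun i =>
        comp_of_mem_part (smul_mem_part (SetLike.coe_mem _) hy) n
      simp only [h1]
      split_ifs with h
      · by_cases h' : n - s < M
        · rw [Finset.sum_eq_single (n - s)]
          · rw [if_pos (by omega)]
          · intro i _ hi
            rw [if_neg (by omega)]
          · intro h3
            exact absurd (Finset.mem_range.2 h') h3
        · have h2 : (DirectSum.decompose 𝒜 b (n - s) : A) = 0 := by
            conv_lhs => rw [← hM]
            change GradedRing.proj 𝒜 (n - s) _ = 0
            rw [map_sum]
            refine Finset.sum_eq_zero fun i hi => ?_
            rw [GradedRing.proj_apply, decompose_decompose, if_neg]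
            have := Finset.mem_range.1 hi
            omega
          rw [h2, zero_smul, Finset.sum_eq_zero]
          intro i hi
          rw [if_neg]
          have := Finset.mem_range.1 hi
          omega
      · rw [zero_smul, Finset.sum_eq_zero]
        intro i _
        rw [if_neg (by omega)]
    · refine LinearMap.ext fun a => ?_
      rw [LinearMap.comp_apply, LinearMap.comp_apply, LinearMap.toSpanSingleton_apply,
        map_smul, map_smul, hp, hx, ← hf, hcomp, ← map_smul, ← map_smul]
      refine congrArg f ?_
      apply ofIdealVal_injective
      rw [map_smul, map_smul, hε, smul_eq_mul, smul_eq_mul, he]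
      exact (hIe _).1 (ofIdealVal_mem a)

end GrMod

open GrMod

variable [GradedAlgebra 𝒜]

/-! ### Koszul filtrations: adjoining one generator to a linear ideal -/

variable (𝒜) in
/-- A homogeneous left ideal has a finite linear resolution, starting in degree `1`. -/
def Ideal.IsLinear (I : Ideal A) : Prop :=
  ∃ (hI : I.IsHomogeneous 𝒜) (d : ℕ), ∀ s, HasLin d (s + 1) (ofIdeal I hI s)

namespace Ideal.IsLinear

theorem bot : (⊥ : Ideal A).IsLinear 𝒜 :=
  ⟨IsHomogeneous.bot 𝒜, 0, fun _ => inferInstanceAs (Subsingleton (⊥ : Ideal A))⟩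

/-- The ideal `J + A a` is linear if `J` and the left ideal `(J : a)` in `A e` are, for `a = e a`
of degree `1`. -/
theorem step {I J C : Ideal A} (hJ : J.IsLinear 𝒜) (hC : C.IsLinear 𝒜) {e a : A}
    (he : e * e = e) (he0 : e ∈ 𝒜 0) (ha : a ∈ 𝒜 1) (hea : e * a = a)
    (hI : I = J ⊔ Ideal.span {a}) (hCe : ∀ c ∈ C, c * e = c)
    (hCJ : ∀ b, b * e = b → (b * a ∈ J ↔ b ∈ C)) : I.IsLinear 𝒜 := by
  obtain ⟨hJh, d, hJd⟩ := hJ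
  obtain ⟨hCh, d', hCd⟩ := hC
  have hIh : I.IsHomogeneous 𝒜 := by
    rw [hI]
    refine Ideal.IsHomogeneous.sup hJh (Ideal.homogeneous_span _ _ ?_)
    rintro _ rfl
    exact ⟨1, ha⟩
  have hJI : J ≤ I := hI ▸ le_sup_left
  have haI : a ∈ I := hI ▸ (le_sup_right : Ideal.span {a} ≤ _) (Ideal.mem_span_singleton_self a)
  let E : Ideal A := Ideal.span {e}
  have hE : ∀ b, b ∈ E ↔ b * e = b := fun b => by
    rw [Ideal.mem_span_singleton']
    constructor
    · rintro ⟨c, rfl⟩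
      rw [mul_assoc, he]
    · exact fun h => ⟨b, h⟩
  have hEh : E.IsHomogeneous 𝒜 := by
    refine Ideal.homogeneous_span _ _ ?_
    rintro _ rfl
    exact ⟨0, he0⟩
  have hCE : C ≤ E := fun c hc => (hE c).2 (hCe c hc)
  refine ⟨hIh, max d d' + 1, fun s => ?_⟩
  -- Right multiplication by a raises degrees by one, so A e and C carry the shift s + 1 where J and
  -- I carry s. Hence the resolution of C is needed for another shift, which is why `Ideal.IsLinear`
  -- asks for all shifts with one bound.
  refine HasLin.step (J := ofIdeal J hJh s) (P := ofIdeal E hEh (s + 1))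
    (C := ofIdeal C hCh (s + 1)) (X := ofIdeal I hIh s)
    (ofIdealLift hIh s (ofIdealVal J hJh s) fun x => hJI (ofIdealVal_mem x))
    (ofIdealLift hIh s ((LinearMap.toSpanSingleton A A a) ∘ₗ ofIdealVal E hEh (s + 1))
      fun b => I.mul_mem_left _ haI)
    (ofIdealLift hEh (s + 1) (ofIdealVal C hCh (s + 1)) fun x => hCE (ofIdealVal_mem x))
    (isGraded_ofIdealLift _ _ _ _ fun _ _ => ofIdealVal_comp _ _)
    (isGraded_ofIdealLift _ _ _ _ fun n x => ?_)
    (isGraded_ofIdealLift _ _ _ _ fun _ _ => ofIdealVal_comp _ _)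
    (fun x y h => ofIdealVal_injective (congrArg (ofIdealVal I hIh s) h))
    (fun x y h => ofIdealVal_injective (congrArg (ofIdealVal E hEh (s + 1)) h))
    (fun x => ?_) (fun b => ?_) (linProj_ofIdeal he he0 hEh hE _)
    ((hJd s).mono (by omega)) ((hCd (s + 1)).mono (by omega))
  · rw [LinearMap.comp_apply, LinearMap.comp_apply, LinearMap.toSpanSingleton_apply,
      LinearMap.toSpanSingleton_apply, ofIdealVal_comp, shiftedComp_apply, shiftedComp_apply,
      smul_eq_mul, smul_eq_mul, DirectSum.coe_decompose_mul_of_right_mem 𝒜 (n - s) ha]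
    by_cases h1 : s + 1 ≤ n
    · rw [if_pos h1, if_pos (by omega), if_pos (by omega), Nat.sub_sub]
    · rw [if_neg h1, zero_mul]
      split_ifs <;> first | rfl | omega
  · obtain ⟨y, hy, z, hz, hyz⟩ := Submodule.mem_sup.1 (hI.le (ofIdealVal_mem x))
    obtain ⟨b, rfl⟩ := Ideal.mem_span_singleton'.1 hz
    obtain ⟨y, rfl⟩ := exists_ofIdealVal (hI := hJh) (s := s) hy
    -- Since a = ea, the coefficient b may be replaced by be, which lies in A e.
    obtain ⟨b', hb'⟩ := exists_ofIdealVal (hI := hEh) (s := s + 1) (a := b * e)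
      ((hE _).2 (by rw [mul_assoc, he]))
    refine ⟨y, b', ofIdealVal_injective ?_⟩
    rw [map_add]
    change ofIdealVal J hJh s y + ofIdealVal E hEh (s + 1) b' * a = _
    rw [hb', mul_assoc, hea, hyz]
  · have := hCJ _ ((hE _).1 (ofIdealVal_mem b))
    constructor
    · rintro ⟨y, hyb⟩
      have h1 := congrArg (ofIdealVal I hIh s) hyb
      obtain ⟨c, hc⟩ := exists_ofIdealVal (hI := hCh) (s := s + 1) (this.1 (by
        have h2 := ofIdealVal_mem y
        rwa [show ofIdealVal J hJh s y = ofIdealVal E hEh (s + 1) b * a from h1] at h2))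
      exact ⟨c, ofIdealVal_injective hc⟩
    · rintro ⟨c, hcb⟩
      have h1 := congrArg (ofIdealVal E hEh (s + 1)) hcb
      obtain ⟨y, hy⟩ := exists_ofIdealVal (hI := hJh) (s := s) (this.2 (by
        rw [← h1]
        exact ofIdealVal_mem c))
      exact ⟨y, ofIdealVal_injective hy⟩

/-- The sum of two linear ideals separated by an idempotent of degree `0`. -/
theorem sup_of_idempotent {J I : Ideal A} (hJ : J.IsLinear 𝒜) (hI : I.IsLinear 𝒜) {e : A}
    (he0 : e ∈ 𝒜 0) (hJe : ∀ x ∈ J, x * e = 0) (hIe : ∀ x ∈ I, x * e = x) :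
    (J ⊔ I).IsLinear 𝒜 := by
  obtain ⟨hJh, d, hJd⟩ := hJ
  obtain ⟨hIh, d', hId⟩ := hI
  have hS := Ideal.IsHomogeneous.sup hJh hIh
  have hmul : ∀ x ∈ J ⊔ I, ∃ y ∈ J, ∃ z ∈ I, y + z = x ∧ x * e = z := by
    intro x hx
    obtain ⟨y, hy, z, hz, rfl⟩ := Submodule.mem_sup.1 hx
    exact ⟨y, hy, z, hz, rfl, by rw [add_mul, hJe y hy, hIe z hz, zero_add]⟩
  refine ⟨hS, max d d', fun s => ?_⟩
  refine HasLin.extension (K := ofIdeal J hJh s) (N := ofIdeal I hIh s) (X := ofIdeal (J ⊔ I) hS s)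
    (ofIdealLift hS s (ofIdealVal J hJh s) fun x =>
      (le_sup_left : J ≤ J ⊔ I) (ofIdealVal_mem x))
    (ofIdealLift hIh s ((LinearMap.toSpanSingleton A A e) ∘ₗ ofIdealVal (J ⊔ I) hS s) fun x => ?_)
    (isGraded_ofIdealLift _ _ _ _ fun _ _ => ofIdealVal_comp _ _)
    (isGraded_ofIdealLift _ _ _ _ fun n x => ?_)
    (fun x y h => ofIdealVal_injective (congrArg (ofIdealVal (J ⊔ I) hS s) h))
    (fun x => ?_) (fun z => ?_)
    ((hJd s).mono (le_max_left _ _)) ((hId s).mono (le_max_right _ _))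
  · obtain ⟨y, hy, z, hz, -, h⟩ := hmul _ (ofIdealVal_mem x)
    rw [LinearMap.comp_apply, LinearMap.toSpanSingleton_apply, smul_eq_mul, h]
    exact hz
  · rw [LinearMap.comp_apply, LinearMap.comp_apply, LinearMap.toSpanSingleton_apply,
      LinearMap.toSpanSingleton_apply, ofIdealVal_comp, shiftedComp_apply, shiftedComp_apply,
      smul_eq_mul, smul_eq_mul, DirectSum.coe_decompose_mul_of_right_mem_zero 𝒜 he0]
    split_ifs
    · rfl
    · exact zero_mul e
  · constructor
    · intro h
      have h1 : ofIdealVal (J ⊔ I) hS s x * e = 0 := congrArg (ofIdealVal I hIh s) h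
      obtain ⟨y, hy, z, hz, hyz, h2⟩ := hmul _ (ofIdealVal_mem x)
      rw [← h2, h1, add_zero] at hyz
      obtain ⟨y, rfl⟩ := exists_ofIdealVal (hI := hJh) (s := s) hy
      exact ⟨y, ofIdealVal_injective hyz⟩
    · rintro ⟨y, rfl⟩
      exact ofIdealVal_injective ((hJe _ (ofIdealVal_mem y)).trans (map_zero _).symm)
  · obtain ⟨x, hx⟩ := exists_ofIdealVal (hI := hS) (s := s)
      ((le_sup_right : I ≤ J ⊔ I) (ofIdealVal_mem z))
    refine ⟨x, ofIdealVal_injective ?_⟩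
    rw [ofIdealVal_lift, LinearMap.comp_apply, hx]
    exact hIe _ (ofIdealVal_mem z)

end Ideal.IsLinear

/-! ### From the ideal of positive degree to the degree-zero part -/

variable (𝒜) in
/-- The part of degree `0` as a graded module. -/
noncomputable def GrMod.degreeZero : GrMod 𝒜 where
  carrier := DegreeZero 𝒜
  comp := fun n => if n = 0 then AddMonoidHom.id _ else 0
  exists_sum := fun x => ⟨1, by rw [Finset.sum_range_one, if_pos rfl]; rfl⟩
  comp_comp := fun i j x => by
    by_cases hj : j = 0
    · subst hj
      split_ifs <;> rfl
    · rw [if_neg hj, AddMonoidHom.zero_apply, map_zero, ite_self]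
  comp_smul := fun {j a} ha n x => by
    by_cases hn : n = 0
    · subst hn
      rw [if_pos rfl, AddMonoidHom.id_apply]
      by_cases hj : j = 0
      · subst hj
        rw [if_pos rfl]; rfl
      · have h0 : GradedRing.projZeroRingHom' 𝒜 a = 0 :=
          Subtype.ext (DirectSum.decompose_of_mem_ne 𝒜 ha hj)
        have h1 : a • x = 0 := by
          change GradedRing.projZeroRingHom' 𝒜 a • (show 𝒜 0 from x) = 0
          rw [h0, zero_smul]
        rw [h1, map_zero]
    · rw [if_neg hn, AddMonoidHom.zero_apply, smul_zero, map_zero]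

theorem GrMod.degreeZero_comp (n : ℕ) (z : degreeZero 𝒜) :
    (degreeZero 𝒜).comp n z = if n = 0 then z else 0 := by
  change (if n = 0 then AddMonoidHom.id _ else 0 : DegreeZero 𝒜 →+ DegreeZero 𝒜) z = _
  split_ifs <;> rfl

variable (𝒜) in
/-- The projection to the part of degree `0`. -/
noncomputable def toDegreeZero : A →ₗ[A] degreeZero 𝒜 where
  toFun a := GradedRing.projZeroRingHom' 𝒜 a
  map_add' _ _ := map_add (GradedRing.projZeroRingHom' 𝒜) _ _
  map_smul' _ _ := map_mul (GradedRing.projZeroRingHom' 𝒜) _ _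

theorem toDegreeZero_eq_zero {a : A} :
    toDegreeZero 𝒜 a = 0 ↔ (DirectSum.decompose 𝒜 a 0 : A) = 0 :=
  ⟨fun h => congrArg (fun z => (show 𝒜 0 from z : A)) h, fun h => Subtype.ext h⟩

/-- If the ideal `⨁_{n > 0} Aₙ` has a finite linear resolution, so does `A₀`. -/
theorem nonempty_linearResolution {I : Ideal A} (hI : I.IsLinear 𝒜)
    (hI0 : ∀ a, a ∈ I ↔ (DirectSum.decompose 𝒜 a 0 : A) = 0) :
    Nonempty (LinearResolution 𝒜 (DegreeZero 𝒜) (DegreeZero.grading 𝒜)) := by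
  obtain ⟨hIh, d, hId⟩ := hI
  let hT := Ideal.IsHomogeneous.top 𝒜
  let ε : ofIdeal ⊤ hT 0 →ₗ[A] degreeZero 𝒜 := toDegreeZero 𝒜 ∘ₗ ofIdealVal ⊤ hT 0
  have hε : IsGraded ε := by
    intro n a
    rw [degreeZero_comp]
    change toDegreeZero 𝒜 (ofIdealVal ⊤ hT 0 ((ofIdeal ⊤ hT 0).comp n a)) =
      if n = 0 then toDegreeZero 𝒜 (ofIdealVal ⊤ hT 0 a) else 0
    rw [ofIdealVal_comp, shiftedComp_apply, if_pos (Nat.zero_le n), Nat.sub_zero]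
    by_cases hn : n = 0
    · subst hn
      rw [if_pos rfl, ← sub_eq_zero, ← map_sub, toDegreeZero_eq_zero, DirectSum.decompose_sub,
        DirectSum.sub_apply, Submodule.coe_sub, decompose_decompose, if_pos rfl, sub_self]
    · rw [if_neg hn, toDegreeZero_eq_zero, decompose_decompose, if_neg (Ne.symm hn)]
  have hlin : HasLin (d + 1) 0 (degreeZero 𝒜) := by
    -- The zeroth term is A itself, generated by the idempotent 1; the kernel of its projection to
    -- degree zero is I, whose resolution starts in degree 1.
    refine ⟨ofIdeal ⊤ hT 0, ε, hε, ?_, linProj_ofIdeal (mul_one 1) SetLike.GradedOne.one_mem _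
      (fun a => by simp) 0, ?_⟩
    · intro z
      obtain ⟨a, ha⟩ := GradedRing.projZeroRingHom'_surjective 𝒜 (show 𝒜 0 from z)
      obtain ⟨x, hx⟩ := exists_ofIdealVal (hI := hT) (s := 0) (Submodule.mem_top (x := a))
      refine ⟨x, Eq.trans ?_ ha⟩
      change toDegreeZero 𝒜 (ofIdealVal ⊤ hT 0 x) = _
      rw [hx]
      rfl
    · refine HasLin.of_bijective (X := ker ε hε) (Y := ofIdeal I hIh 0)
        (ofIdealLift hIh 0 (ofIdealVal ⊤ hT 0 ∘ₗ (LinearMap.ker ε).subtype) fun x =>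
          (hI0 _).2 (toDegreeZero_eq_zero.1 x.2))
        (isGraded_ofIdealLift _ _ _ _ fun n x =>
          ofIdealVal_comp (hI := hT) (s := 0) n (show LinearMap.ker ε from x).1) ?_ (hId 0)
      constructor
      · intro x y h
        exact Subtype.ext (ofIdealVal_injective (congrArg (ofIdealVal I hIh 0) h))
      · intro y
        obtain ⟨x, hx⟩ := exists_ofIdealVal (hI := hT) (s := 0)
          (Submodule.mem_top (x := ofIdealVal I hIh 0 y))
        have hx' : ε x = 0 := by
          change toDegreeZero 𝒜 (ofIdealVal ⊤ hT 0 x) = 0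
          rw [toDegreeZero_eq_zero, hx, ← hI0]
          exact ofIdealVal_mem y
        exact ⟨(⟨x, hx'⟩ : LinearMap.ker ε), ofIdealVal_injective hx⟩
  obtain ⟨S⟩ := hlin.nonempty_linRes
  refine ⟨{
    P := fun i => S.P i
    grading := fun i => (S.P i).part
    isInternal := fun i => (S.P i).isInternal
    smul_mem := fun i j n a ha x hx => smul_mem_part ha hx
    projective := fun i => (S.linProj i).projective
    generated := fun i => by
      have := (S.linProj i).generated
      rwa [zero_add] at this
    d := S.d
    d_mem := fun i n x hx => (S.d_graded i).mem_part hx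
    augmentation := S.aug
    augmentation_mem := fun n x hx => ?_
    augmentation_surjective := S.aug_surjective
    exact_zero := S.exact_zero
    exact_succ := S.exact_succ }⟩
  have h1 := S.aug_graded.mem_part hx
  rw [GrMod.mem_part, degreeZero_comp] at h1
  rw [DegreeZero.grading]
  by_cases hn : n = 0
  · rw [if_pos hn]
    exact AddSubgroup.mem_top _
  · rw [if_neg hn] at h1 ⊢
    exact AddSubgroup.mem_bot.2 h1.symm

end LeftIdeals

/-! ## Homomorphisms from path algebras -/

namespace PathAlgebra

section Lift

variable {k : Type u} [CommRing k] {V : Type v} [Quiver.{w} V]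
variable {R : Type*} [Ring R] [Algebra k R]

/-- The value of a path under given values of the trivial paths and the arrows. -/
def pathVal (e : V → R) (t : ∀ {x y : V}, (x ⟶ y) → R) {x : V} : ∀ {y : V}, Quiver.Path x y → R
  | _, .nil => e x
  | _, .cons p a => t a * pathVal e t p

/-- With its companions this makes `pathVal` multiplicative: only the idempotents at the ends of a
path matter when two paths are multiplied. -/
theorem pathVal_mul_src {e : V → R} {t : ∀ {x y : V}, (x ⟶ y) → R} (hee : ∀ x, e x * e x = e x)
    {x y : V} (p : Quiver.Path x y) : pathVal e t p * e x = pathVal e t p := by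
  induction p with
  | nil => exact hee x
  | cons p a ih => rw [pathVal, mul_assoc, ih]

theorem tgt_mul_pathVal {e : V → R} {t : ∀ {x y : V}, (x ⟶ y) → R} (hee : ∀ x, e x * e x = e x)
    (het : ∀ {x y : V} (a : x ⟶ y), e y * t a = t a)
    {x y : V} (p : Quiver.Path x y) : e y * pathVal e t p = pathVal e t p := by
  cases p with
  | nil => exact hee x
  | cons p a => rw [pathVal, ← mul_assoc, het]

theorem pathVal_comp {e : V → R} {t : ∀ {x y : V}, (x ⟶ y) → R} (hee : ∀ x, e x * e x = e x)
    (het : ∀ {x y : V} (a : x ⟶ y), e y * t a = t a)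
    {x y z : V} (p : Quiver.Path x y) (q : Quiver.Path y z) :
    pathVal e t (p.comp q) = pathVal e t q * pathVal e t p := by
  induction q with
  | nil => exact (tgt_mul_pathVal hee het p).symm
  | cons q a ih => rw [Quiver.Path.comp_cons, pathVal, ih, pathVal, mul_assoc]

/-- The homomorphism from the path algebra with given values on the trivial paths and the
arrows. -/
noncomputable def liftAlgHom [Fintype V] (e : V → R) (t : ∀ {x y : V}, (x ⟶ y) → R)
    (hee : ∀ x, e x * e x = e x) (hne : ∀ x y, x ≠ y → e x * e y = 0) (hsum : ∑ x, e x = 1)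
    (het : ∀ {x y : V} (a : x ⟶ y), e y * t a = t a) : PathAlgebra k V →ₐ[k] R :=
  AlgHom.ofLinearMap (lift fun p => pathVal e t p.path)
    (by
      rw [one_def, map_sum, ← hsum]
      exact Finset.sum_congr rfl fun x _ => lift_of _ _ _)
    (fun a b => by
      induction a using induction with
      | zero => rw [zero_mul, map_zero, zero_mul]
      | add a a' ha ha' => rw [add_mul, map_add, ha, ha', map_add, add_mul]
      | smul c p =>
        induction b using induction with
        | zero => rw [mul_zero, map_zero, mul_zero]
        | add b b' hb hb' => rw [mul_add, map_add, hb, hb', map_add, mul_add]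
        | smul c' q =>
          rw [smul_mul_smul_comm, map_smul, map_smul, map_smul, smul_mul_smul_comm, lift_of,
            lift_of]
          congr 1
          obtain ⟨x, y, p⟩ := p
          obtain ⟨z, w, q⟩ := q
          by_cases h : w = x
          · subst h
            rw [of_mul_of_comp, lift_of]
            exact pathVal_comp hee het q p
          · rw [of_mul_of_ne k (by exact h), map_zero]
            change 0 = pathVal e t p * pathVal e t q
            rw [← pathVal_mul_src hee p, ← tgt_mul_pathVal hee het q, mul_assoc, ← mul_assoc (e x),
              hne x w (Ne.symm h), zero_mul, mul_zero])

end Lift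

/-! ### Representations of quivers -/

section Rep

variable {k : Type u} [CommRing k] {V : Type v} [DecidableEq V]
variable {E : Type*} [AddCommGroup E] [Module k E]

/-- The endomorphism of `⨁ E` that maps the summand at `x` to that at `y` by `f`. -/
noncomputable def elementary (x y : V) (f : E →ₗ[k] E) : Module.End k (V → E) :=
  LinearMap.single k (fun _ : V => E) y ∘ₗ f ∘ₗ LinearMap.proj x

theorem elementary_apply (x y : V) (f : E →ₗ[k] E) (v : V → E) :
    elementary x y f v = Pi.single y (f (v x)) := rfl

theorem elementary_mul (x y z : V) (f g : E →ₗ[k] E) :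
    elementary y z g * elementary x y f = elementary x z (g ∘ₗ f) := by
  refine LinearMap.ext fun v => ?_
  rw [Module.End.mul_apply, elementary_apply, elementary_apply, elementary_apply, Pi.single_eq_same]
  rfl

theorem elementary_mul_of_ne {x y y' z : V} (h : y ≠ y') (f g : E →ₗ[k] E) :
    elementary y' z g * elementary x y f = 0 := by
  refine LinearMap.ext fun v => ?_
  rw [Module.End.mul_apply, elementary_apply, elementary_apply, Pi.single_eq_of_ne (Ne.symm h),
    map_zero, Pi.single_zero]
  rfl

theorem sum_elementary_id [Fintype V] : ∑ x : V, elementary x x (LinearMap.id : E →ₗ[k] E) = 1 := by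
  refine LinearMap.ext fun v => ?_
  rw [LinearMap.sum_apply]
  simp only [elementary_apply, LinearMap.id_apply]
  exact Finset.univ_sum_single v

variable [Fintype V] [Quiver.{w} V]

/-- The action of the path algebra on `⨁ E`, where the arrows `x ⟶ y` act by `f x y`. -/
noncomputable def rep (f : V → V → E →ₗ[k] E) : PathAlgebra k V →ₐ[k] Module.End k (V → E) :=
  liftAlgHom (fun x => elementary x x LinearMap.id) (fun {x y} _ => elementary x y (f x y))
    (fun x => elementary_mul x x x _ _) (fun _ _ h => elementary_mul_of_ne (Ne.symm h) _ _)
    sum_elementary_id (fun {_ _} _ => elementary_mul _ _ _ _ _)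

theorem rep_nil (f : V → V → E →ₗ[k] E) (x : V) :
    rep f (of k ⟨x, x, .nil⟩) = elementary x x LinearMap.id :=
  lift_of k _ _

theorem rep_arrow (f : V → V → E →ₗ[k] E) {x y : V} (a : x ⟶ y) :
    rep f (of k ⟨x, y, Quiver.Path.nil.cons a⟩) = elementary x y (f x y) :=
  (lift_of k _ _).trans (elementary_mul x x y LinearMap.id (f x y))

end Rep

end PathAlgebra

namespace Dihedral

variable {m : ℕ}

/-! ## Quantum numbers -/

theorem sin_pi_div_pos (hm : 2 ≤ m) : 0 < Real.sin (Real.pi / m) := by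
  have h : (2 : ℝ) ≤ m := by exact_mod_cast hm
  apply Real.sin_pos_of_pos_of_lt_pi
  · exact div_pos Real.pi_pos (by linarith)
  · rw [div_lt_iff₀ (by linarith)]
    nlinarith [Real.pi_pos]

theorem qnum_zero : qnum m 0 = 0 := by
  rw [qnum_eq_sin]
  simp

theorem qnum_one (hm : 2 ≤ m) : qnum m 1 = 1 := by
  rw [qnum_eq_sin, Nat.cast_one, one_mul]
  exact div_self (sin_pi_div_pos hm).ne'

theorem qnum_self (hm : 2 ≤ m) : qnum m m = 0 := by
  have h : (m : ℝ) ≠ 0 := by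
    have : m ≠ 0 := by omega
    exact_mod_cast this
  rw [qnum_eq_sin, mul_div_cancel₀ _ h, Real.sin_pi, zero_div]

theorem qnum_sub_one (hm : 2 ≤ m) : qnum m (m - 1) = 1 := by
  have h : (m : ℝ) ≠ 0 := by
    have : m ≠ 0 := by omega
    exact_mod_cast this
  have h1 : ((m - 1 : ℕ) : ℝ) * (Real.pi / m) = Real.pi - Real.pi / m := by
    rw [Nat.cast_sub (by omega), Nat.cast_one, sub_mul, mul_div_cancel₀ _ h, one_mul]
  rw [qnum_eq_sin, h1, Real.sin_pi_sub]
  exact div_self (sin_pi_div_pos hm).ne'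

theorem qnum_ne_zero {n : ℕ} (hn : 1 ≤ n) (hnm : n < m) : qnum m n ≠ 0 := by
  have hm : (0 : ℝ) < m := by exact_mod_cast (show 0 < m by omega)
  rw [qnum_eq_sin]
  refine div_ne_zero (ne_of_gt ?_) (sin_pi_div_pos (by omega)).ne'
  have h1 : (1 : ℝ) ≤ n := by exact_mod_cast hn
  have h2 : (n : ℝ) < m := by exact_mod_cast hnm
  apply Real.sin_pos_of_pos_of_lt_pi
  · exact mul_pos (by linarith) (div_pos Real.pi_pos hm)
  · rw [← mul_div_assoc, div_lt_iff₀ hm, mul_comm]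
    exact mul_lt_mul_of_pos_left h2 Real.pi_pos

/-- This is sin(α − θ) sin(α + θ) = sin² α − sin² θ, divided by sin² θ. -/
theorem qnum_mul (hm : 2 ≤ m) (n : ℕ) :
    qnum m n * qnum m (n + 2) = qnum m (n + 1) ^ 2 - 1 := by
  have hs := (sin_pi_div_pos hm).ne'
  simp only [qnum_eq_sin]
  set θ := Real.pi / m
  have h0 : (n : ℝ) * θ = ((n + 1 : ℕ) : ℝ) * θ - θ := by push_cast; ring
  have h2 : ((n + 2 : ℕ) : ℝ) * θ = ((n + 1 : ℕ) : ℝ) * θ + θ := by push_cast; ring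
  rw [h0, h2, Real.sin_sub, Real.sin_add]
  set α := ((n + 1 : ℕ) : ℝ) * θ
  field_simp
  have h3 := Real.sin_sq_add_cos_sq α
  have h4 := Real.sin_sq_add_cos_sq θ
  linear_combination Real.sin α ^ 2 * h4 - Real.sin θ ^ 2 * h3

/-- The addition formula for sin(α ± θ), with [2] = 2 cos θ: the three-term recursion of quantum
numbers. -/
theorem qnum_add (hm : 2 ≤ m) (n : ℕ) :
    qnum m n + qnum m (n + 2) = qnum m 2 * qnum m (n + 1) := by
  have hs := (sin_pi_div_pos hm).ne'
  simp only [qnum_eq_sin]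
  set θ := Real.pi / m
  have h0 : (n : ℝ) * θ = ((n + 1 : ℕ) : ℝ) * θ - θ := by push_cast; ring
  have h2 : ((n + 2 : ℕ) : ℝ) * θ = ((n + 1 : ℕ) : ℝ) * θ + θ := by push_cast; ring
  rw [h0, h2, Real.sin_sub, Real.sin_add, Nat.cast_ofNat, Real.sin_two_mul]
  field_simp
  ring

/-! ## The words -/

theorem Colour.swap_swap (c : Colour) : c.swap.swap = c := by cases c <;> rfl

theorem Colour.swap_ne (c : Colour) : c.swap ≠ c := by cases c <;> exact Colour.noConfusion

theorem Colour.eq_or_eq_swap (a c : Colour) : a = c ∨ a = c.swap := by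
  cases a <;> cases c <;> simp [Colour.swap]

theorem word_zero (c : Colour) : word m c 0 = .e := rfl

theorem word_succ (c : Colour) {i : ℕ} (hi : i < m - 1) : word m c (i + 1) = .mid c ⟨i, hi⟩ := by
  rw [word, if_neg (Nat.succ_ne_zero i)]
  exact dif_pos hi

theorem word_self (hm : 2 ≤ m) (c : Colour) : word m c m = .w₀ := by
  rw [word, if_neg (by omega), dif_neg (by omega)]

theorem W.length_le (x : W m) : x.length ≤ m := by
  cases x with
  | e => exact Nat.zero_le m
  | mid c i =>
    have := i.2
    simp only [W.length]
    omega
  | w₀ => exact le_rfl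

theorem W.exists_word (hm : 2 ≤ m) (x : W m) : ∃ c, x = word m c x.length := by
  cases x with
  | e => exact ⟨.s, rfl⟩
  | mid c i => exact ⟨c, (word_succ c i.2).symm⟩
  | w₀ => exact ⟨.s, (word_self hm _).symm⟩

theorem W.eq_word (hm : 2 ≤ m) (x : W m) {n : ℕ} (h : x.length = n) (c : Colour) :
    x = word m c n ∨ x = word m c.swap n := by
  subst h
  obtain ⟨a, ha⟩ := x.exists_word hm
  rcases a.eq_or_eq_swap c with rfl | rfl
  · exact Or.inl ha
  · exact Or.inr ha

theorem word_ne_word_swap (c : Colour) {n : ℕ} (hn : 1 ≤ n) (hnm : n < m) :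
    word m c.swap n ≠ word m c n := by
  obtain ⟨i, rfl⟩ : ∃ i, n = i + 1 := ⟨n - 1, by omega⟩
  rw [word_succ _ (by omega), word_succ _ (by omega)]
  intro h
  exact c.swap_ne (W.mid.inj h).1

/-! ## The polynomial action -/

variable (m) in
/-- The free vector space on `W`, with the elements as formal weights. -/
abbrev Wt : Type := W m →₀ ℝ

/-- The action of the two linear forms of degree one on the weights. -/
noncomputable def lowerVec (a : Colour) : W m → Wt m
  | .e => 0
  -- This value never enters the action of arrows: the weight w₀ is admissible only at the vertex
  -- w₀, where a descending arrow moves it directly. Zero lets the operator identities below hold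
  -- without exception.
  | .w₀ => 0
  | .mid c i =>
    if a = c then qnum m i • Finsupp.single (word m c i) 1
    else qnum m (i + 1) • Finsupp.single (word m c i) 1
      -- Both words of length zero are e, and the relations for length one require e with
      -- coefficient [1] = 1, not the sum of two terms.
      + if (i : ℕ) = 0 then 0 else Finsupp.single (word m c.swap i) 1

/-- The linear extension of `lowerVec`. -/
noncomputable def lower (a : Colour) : Module.End ℝ (Wt m) :=
  Finsupp.linearCombination ℝ (lowerVec a)

theorem lower_single (a : Colour) (w : W m) :
    lower a (Finsupp.single w 1) = lowerVec a w := by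
  rw [lower, Finsupp.linearCombination_single, one_smul]

theorem lower_e (a : Colour) : lower a (Finsupp.single (W.e : W m) 1) = 0 := lower_single a _

theorem lower_same (c : Colour) {i : ℕ} (hi : i < m - 1) :
    lower c (Finsupp.single (word m c (i + 1)) 1) = qnum m i • Finsupp.single (word m c i) 1 := by
  rw [lower_single, word_succ c hi]
  exact if_pos rfl

theorem lower_swap_one (hm : 2 ≤ m) (c : Colour) :
    lower c.swap (Finsupp.single (word m c 1) 1) = Finsupp.single .e 1 := by
  rw [lower_single, word_succ c (by omega)]
  refine (if_neg c.swap_ne).trans ?_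
  rw [if_pos rfl, add_zero]
  change qnum m 1 • _ = _
  rw [qnum_one hm, one_smul]
  rfl

theorem lower_swap (c : Colour) {i : ℕ} (hi0 : i ≠ 0) (hi : i < m - 1) :
    lower c.swap (Finsupp.single (word m c (i + 1)) 1)
      = qnum m (i + 1) • Finsupp.single (word m c i) 1 + Finsupp.single (word m c.swap i) 1 := by
  rw [lower_single, word_succ c hi]
  refine (if_neg c.swap_ne).trans ?_
  rw [if_neg hi0]

theorem lower_swap' (c : Colour) {i : ℕ} (hi0 : i ≠ 0) (hi : i < m - 1) :
    lower c (Finsupp.single (word m c.swap (i + 1)) 1)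
      = qnum m (i + 1) • Finsupp.single (word m c.swap i) 1 + Finsupp.single (word m c i) 1 := by
  have := lower_swap c.swap hi0 hi
  rwa [c.swap_swap] at this

theorem lower_swap_one' (hm : 2 ≤ m) (c : Colour) :
    lower c (Finsupp.single (word m c.swap 1) 1) = Finsupp.single .e 1 := by
  have := lower_swap_one hm c.swap
  rwa [c.swap_swap] at this

variable (m) in
/-- The weights of length less than `n`. -/
noncomputable def below (n : ℕ) : Submodule ℝ (Wt m) := Finsupp.supported ℝ ℝ {w | w.length < n}

theorem single_mem_below {w : W m} {n : ℕ} (h : w.length < n) :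
    (Finsupp.single w 1 : Wt m) ∈ below m n := Finsupp.single_mem_supported ℝ 1 h

theorem below_mono {n n' : ℕ} (h : n ≤ n') : below m n ≤ below m n' :=
  Finsupp.supported_mono fun _ hw => lt_of_lt_of_le hw h

theorem below_zero : below m 0 = ⊥ := by
  rw [below]
  convert Finsupp.supported_empty (R := ℝ) (M := ℝ) (α := W m) using 2
  ext w
  simp

theorem apply_mem_of_below {n : ℕ} {F : Type*} [AddCommGroup F] [Module ℝ F] (f : Wt m →ₗ[ℝ] F)
    (S : Submodule ℝ F) (h : ∀ w : W m, w.length < n → f (Finsupp.single w 1) ∈ S) {v : Wt m}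
    (hv : v ∈ below m n) : f v ∈ S := by
  have : below m n ≤ S.comap f := by
    rw [below, Finsupp.supported_eq_span_single, Submodule.span_le]
    rintro _ ⟨w, hw, rfl⟩
    exact h w hw
  exact this hv

theorem eq_of_below {n : ℕ} {F : Type*} [AddCommGroup F] [Module ℝ F] (f g : Wt m →ₗ[ℝ] F)
    (h : ∀ w : W m, w.length < n → f (Finsupp.single w 1) = g (Finsupp.single w 1)) {v : Wt m}
    (hv : v ∈ below m n) : f v = g v := by
  have := apply_mem_of_below (f - g) ⊥ (fun w hw => by
    rw [Submodule.mem_bot, LinearMap.sub_apply, h w hw, sub_self]) hv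
  rwa [Submodule.mem_bot, LinearMap.sub_apply, sub_eq_zero] at this

theorem lower_single_mem (a : Colour) (w : W m) :
    lower a (Finsupp.single w 1) ∈ below m w.length := by
  rw [lower_single]
  cases w with
  | e => exact Submodule.zero_mem _
  | w₀ => exact Submodule.zero_mem _
  | mid c i =>
    have h : ∀ b, (Finsupp.single (word m b i) 1 : Wt m) ∈ below m (i + 1) := fun b =>
      single_mem_below (by
        rw [length_word b (by have := i.2; omega)]
        exact Nat.lt_succ_self _)
    simp only [lowerVec, W.length]
    split_ifs
    · exact Submodule.smul_mem _ _ (h _)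
    · exact Submodule.add_mem _ (Submodule.smul_mem _ _ (h _)) (Submodule.zero_mem _)
    · exact Submodule.add_mem _ (Submodule.smul_mem _ _ (h _)) (h _)

theorem lower_mem_below (a : Colour) {n : ℕ} {v : Wt m} (hv : v ∈ below m (n + 1)) :
    lower a v ∈ below m n :=
  apply_mem_of_below _ _ (fun w hw => below_mono (by omega) (lower_single_mem a w)) hv

theorem lower_comm_single (hm : 2 ≤ m) (c : Colour) {n : ℕ} (hn : n < m) :
    lower c (lower c.swap (Finsupp.single (word m c n) 1))
      = lower c.swap (lower c (Finsupp.single (word m c n) 1)) := by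
  -- Small lengths are separated because the second summand of `lowerVec` is missing at length one;
  -- in general the commutation is [n][n+2] + 1 = [n+1]².
  obtain _ | _ | n := n
  · rw [word_zero, lower_e, lower_e, map_zero, map_zero]
  · rw [zero_add, lower_swap_one hm, lower_e, lower_same c (by omega), map_smul, word_zero, lower_e,
      smul_zero]
  · rw [lower_swap c (by omega) (by omega), lower_same c (by omega), map_add, map_smul, map_smul,
      lower_same c (by omega)]
    obtain _ | n := n
    · rw [zero_add, lower_swap_one hm, lower_swap_one' hm, qnum_zero, zero_smul, smul_zero,
        zero_add, qnum_one hm, one_smul]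
    · rw [lower_swap c (by omega) (by omega), lower_swap' c (by omega) (by omega)]
      have := qnum_mul hm (n + 1)
      match_scalars <;> first | linear_combination this | ring

theorem lower_sq_single (hm : 2 ≤ m) (c : Colour) {n : ℕ} (hn : n < m) :
    lower c (lower c (Finsupp.single (word m c n) 1))
      + lower c.swap (lower c.swap (Finsupp.single (word m c n) 1))
      = qnum m 2 • lower c.swap (lower c (Finsupp.single (word m c n) 1)) := by
  obtain _ | _ | n := n
  · rw [word_zero, lower_e, lower_e, map_zero, map_zero, add_zero, smul_zero]
  · rw [zero_add, lower_swap_one hm, lower_e, lower_same c (by omega), map_smul, word_zero, lower_e,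
      map_smul, lower_e, smul_zero, smul_zero, add_zero]
  · rw [lower_swap c (by omega) (by omega), lower_same c (by omega), map_add, map_smul, map_smul,
      map_smul, lower_same c (by omega)]
    obtain _ | n := n
    · have h1 : lower c.swap (Finsupp.single (word m c.swap (0 + 1)) 1) = (0 : Wt m) := by
        rw [lower_same c.swap (by omega), qnum_zero, zero_smul]
      rw [h1, zero_add, lower_swap_one hm, qnum_zero, zero_smul, smul_zero, qnum_one hm, one_smul,
        add_zero, zero_add]
    · rw [lower_swap c (by omega) (by omega), lower_same c.swap (by omega)]
      have := qnum_add hm (n + 1)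
      match_scalars <;> first | linear_combination this | linear_combination qnum m (n + 1 + 1) * this

/-- The two operators define an action of a polynomial ring in two variables on the weights; this
makes composites of descending arrows computable as polynomials in X and Y. -/
theorem lower_comm (hm : 2 ≤ m) (c : Colour) :
    (lower c * lower c.swap : Module.End ℝ (Wt m)) = lower c.swap * lower c := by
  refine Finsupp.lhom_ext' fun w => LinearMap.ext_ring ?_
  change lower c (lower c.swap (Finsupp.single w 1)) = lower c.swap (lower c (Finsupp.single w 1))
  rcases (W.length_le w).lt_or_eq with h | h
  · rcases w.eq_word hm rfl c with h' | h'
    · rw [h', lower_comm_single hm c h]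
    · have := lower_comm_single hm c.swap h
      rw [c.swap_swap] at this
      rw [h', this]
  · have hw : w = .w₀ := by
      rcases w.eq_word hm h c with h' | h' <;> rw [h', word_self hm]
    rw [hw, lower_single, lower_single]
    exact (map_zero _).trans (map_zero _).symm

/-- As [2] = 2 cos(π/m), the quadratic form X² − [2]XY + Y², which acts as zero, is the invariant
form of the dihedral group written in simple roots. -/
theorem lower_sq (hm : 2 ≤ m) (c : Colour) :
    (lower c * lower c + lower c.swap * lower c.swap : Module.End ℝ (Wt m))
      = qnum m 2 • (lower c.swap * lower c) := by
  refine Finsupp.lhom_ext' fun w => LinearMap.ext_ring ?_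
  change lower c (lower c (Finsupp.single w 1)) + lower c.swap (lower c.swap (Finsupp.single w 1))
    = qnum m 2 • lower c.swap (lower c (Finsupp.single w 1))
  rcases (W.length_le w).lt_or_eq with h | h
  · rcases w.eq_word hm rfl c with h' | h'
    · rw [h', lower_sq_single hm c h]
    · have := lower_sq_single hm c.swap h
      rw [c.swap_swap] at this
      rw [h', add_comm, this]
      have h2 := LinearMap.congr_fun (lower_comm hm c) (Finsupp.single (word m c.swap w.length) 1)
      exact congrArg (fun z => qnum m 2 • z) h2
  · have hw : w = .w₀ := by
      rcases w.eq_word hm h c with h' | h' <;> rw [h', word_self hm]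
    have h0 : ∀ a, lower a (Finsupp.single (W.w₀ : W m) 1) = 0 := fun a => lower_single a _
    rw [hw, h0, h0, map_zero, map_zero, add_zero, smul_zero]

/-- Descending square with ends of the same colour. Eliminating Y² leaves X² and YX: the coefficient
of X² matches by ac = b² − 1 and that of YX cancels by a + c = qb. It is applied with a, b, c three
consecutive quantum numbers and q = [2]. -/
theorem down_down_same {R : Type*} [Ring R] [Algebra ℝ R] {X Y : R} {a b c q : ℝ} (ha : a ≠ 0)
    (hb : b ≠ 0) (hXY : X * Y = Y * X) (hq : X * X + Y * Y = q • (Y * X)) (h1 : a * c = b ^ 2 - 1)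
    (h2 : a + c = q * b) :
    ((1 / a) • X) * ((1 / b) • X) = (X - (b / a) • Y) * (Y - (c / b) • X) := by
  have hYY : Y * Y = q • (Y * X) - X * X := by rw [← hq, add_sub_cancel_left]
  simp only [sub_mul, mul_sub, smul_mul_assoc, mul_smul_comm, hXY, hYY, smul_smul, smul_sub]
  match_scalars
  · field_simp
    linear_combination h1
  · field_simp
    linear_combination -h2

/-- The same for ends of different colours. After eliminating Y², the terms in X² agree and those in
YX reduce to a + c = qb. -/
theorem down_down_swap {R : Type*} [Ring R] [Algebra ℝ R] {X Y : R} {a b c q : ℝ} (ha : a ≠ 0)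
    (hb : b ≠ 0) (hq : X * X + Y * Y = q • (Y * X)) (h2 : a + c = q * b) :
    (Y - (b / a) • X) * ((1 / b) • X) = ((1 / a) • Y) * (Y - (c / b) • X) := by
  have hYY : Y * Y = q • (Y * X) - X * X := by rw [← hq, add_sub_cancel_left]
  simp only [sub_mul, mul_sub, smul_mul_assoc, mul_smul_comm, hYY, smul_smul, smul_sub]
  match_scalars
  · field_simp
    linear_combination h2
  · field_simp

/-! ## The big projective representation -/

/-- The colour of a word, chosen arbitrarily for `e` and `w₀`. -/
def W.colour : W m → Colour
  | .e => .s
  | .w₀ => .s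
  | .mid c _ => c

theorem colour_word (c : Colour) {n : ℕ} (hn : 1 ≤ n) (hnm : n < m) : (word m c n).colour = c := by
  obtain ⟨i, rfl⟩ : ∃ i, n = i + 1 := ⟨n - 1, by omega⟩
  rw [word_succ _ (by omega)]
  rfl

/-- The action of a descending arrow on the weights below its source. -/
noncomputable def downOp (x y : W m) : Module.End ℝ (Wt m) :=
  if x = word m y.colour x.length then
    (1 / qnum m (x.length - 1)) • lower y.colour
  else lower y.colour - (qnum m x.length / qnum m (x.length - 1)) • lower y.colour.swap

theorem downOp_same (c : Colour) {j : ℕ} (hj : 1 ≤ j) (hjm : j < m) :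
    downOp (word m c (j + 1)) (word m c j) = (1 / qnum m j) • lower c := by
  rw [downOp, length_word c (by omega), colour_word c hj hjm, if_pos rfl, Nat.add_sub_cancel]

theorem downOp_swap (hm : 2 ≤ m) (c : Colour) {j : ℕ} (hj : 1 ≤ j) (hjm : j < m) :
    downOp (word m c.swap (j + 1)) (word m c j)
      = lower c - (qnum m (j + 1) / qnum m j) • lower c.swap := by
  rw [downOp, length_word c.swap (by omega), colour_word c hj hjm, Nat.add_sub_cancel]
  -- At w₀ the case distinction in `downOp` always takes the first branch, since w₀ starts with
  -- either colour. The two formulas agree there because [m] = 0 and [m − 1] = 1.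
  by_cases h : j + 1 = m
  · obtain rfl : j = m - 1 := by omega
    rw [h, if_pos (by rw [word_self hm, word_self hm]), qnum_self hm, qnum_sub_one hm,
      div_one, zero_div, one_smul, zero_smul]
    exact (sub_zero (lower c)).symm
  · rw [if_neg (word_ne_word_swap c (by omega) (by omega))]

theorem downOp_swap' (hm : 2 ≤ m) (c : Colour) {j : ℕ} (hj : 1 ≤ j) (hjm : j < m) :
    downOp (word m c (j + 1)) (word m c.swap j)
      = lower c.swap - (qnum m (j + 1) / qnum m j) • lower c := by
  have := downOp_swap hm c.swap hj hjm
  rwa [c.swap_swap] at this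

theorem downOp_mem_below (x y : W m) {n : ℕ} {v : Wt m} (hv : v ∈ below m (n + 1)) :
    downOp x y v ∈ below m n := by
  rw [downOp]
  split_ifs
  · exact Submodule.smul_mem _ _ (lower_mem_below _ hv)
  · exact Submodule.sub_mem _ (lower_mem_below _ hv)
      (Submodule.smul_mem _ _ (lower_mem_below _ hv))

/-- For an arrow into e the colour is arbitrary and the denominator [0] vanishes. This is harmless:
the only weight shorter than its source is e, which is killed. -/
theorem downOp_e (x y : W m) : downOp x y (Finsupp.single .e 1) = 0 := by
  have := downOp_mem_below x y (single_mem_below (w := (W.e : W m)) (n := 1) Nat.zero_lt_one)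
  rwa [below_zero, Submodule.mem_bot] at this

/-- The action of an arrow on the weights. -/
noncomputable def arrowOp (x y : W m) : Module.End ℝ (Wt m) :=
  Finsupp.linearCombination ℝ fun w =>
    if w = x ∨ w.length < x.length then
      if x.length < y.length then Finsupp.single w 1
      else if w = x then Finsupp.single y 1 else downOp x y (Finsupp.single w 1)
    -- Weights that are neither x nor shorter than x do not belong to the vertex x; killing them
    -- keeps one weight space for all vertices.
    else 0

theorem arrowOp_single (x y w : W m) : arrowOp x y (Finsupp.single w 1) =
    if w = x ∨ w.length < x.length then
      if x.length < y.length then Finsupp.single w 1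
      else if w = x then Finsupp.single y 1 else downOp x y (Finsupp.single w 1)
    else 0 := by
  rw [arrowOp, Finsupp.linearCombination_single, one_smul]

theorem arrowOp_up {x y w : W m} (hxy : x.length < y.length) (hw : w = x ∨ w.length < x.length) :
    arrowOp x y (Finsupp.single w 1) = Finsupp.single w 1 := by
  rw [arrowOp_single, if_pos hw, if_pos hxy]

theorem arrowOp_self {x y : W m} (hxy : ¬ x.length < y.length) :
    arrowOp x y (Finsupp.single x 1) = Finsupp.single y 1 := by
  rw [arrowOp_single, if_pos (Or.inl rfl), if_neg hxy, if_pos rfl]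

theorem arrowOp_down {x y w : W m} (hxy : ¬ x.length < y.length) (hw : w.length < x.length) :
    arrowOp x y (Finsupp.single w 1) = downOp x y (Finsupp.single w 1) := by
  have h : w ≠ x := by
    rintro rfl
    exact lt_irrefl _ hw
  rw [arrowOp_single, if_pos (Or.inr hw), if_neg hxy, if_neg h]

theorem arrowOp_of_not {x y w : W m} (hw : ¬ (w = x ∨ w.length < x.length)) :
    arrowOp x y (Finsupp.single w 1) = 0 := by
  rw [arrowOp_single, if_neg hw]

theorem arrowOp_up_below {x y : W m} (hxy : x.length < y.length) {v : Wt m}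
    (hv : v ∈ below m x.length) : arrowOp x y v = v :=
  eq_of_below (arrowOp x y) LinearMap.id (fun _ hw => arrowOp_up hxy (Or.inr hw)) hv

theorem arrowOp_down_below {x y : W m} (hxy : ¬ x.length < y.length) {v : Wt m}
    (hv : v ∈ below m x.length) : arrowOp x y v = downOp x y v :=
  eq_of_below (arrowOp x y) (downOp x y) (fun _ hw => arrowOp_down hxy hw) hv

/-- The three cases of the definition of `arrowOp`: the diagonal weight x, the shorter weights, and
the inadmissible ones. -/
theorem end_ext {f g : Module.End ℝ (Wt m)} (x : W m)
    (hx : f (Finsupp.single x 1) = g (Finsupp.single x 1))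
    (hlt : ∀ w : W m, w.length < x.length → f (Finsupp.single w 1) = g (Finsupp.single w 1))
    (hn : ∀ w : W m, ¬ (w = x ∨ w.length < x.length) →
      f (Finsupp.single w 1) = g (Finsupp.single w 1)) : f = g := by
  refine Finsupp.lhom_ext' fun w => LinearMap.ext_ring ?_
  change f (Finsupp.single w 1) = g (Finsupp.single w 1)
  by_cases h : w = x ∨ w.length < x.length
  · rcases h with rfl | h
    · exact hx
    · exact hlt w h
  · exact hn w h

theorem arrowOp_up_down_eq_zero {x y z : W m} (hxy : x.length < y.length)
    (hyz : ¬ y.length < z.length) (hx : downOp y z (Finsupp.single x 1) = 0)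
    (hw : ∀ w : W m, w.length < x.length → downOp y z (Finsupp.single w 1) = 0) :
    arrowOp y z * arrowOp x y = 0 := by
  refine end_ext x ?_ (fun w hwx => ?_) (fun w hwx => ?_) <;>
    rw [Module.End.mul_apply, LinearMap.zero_apply]
  · rw [arrowOp_up hxy (Or.inl rfl), arrowOp_down hyz hxy, hx]
  · rw [arrowOp_up hxy (Or.inr hwx), arrowOp_down hyz (hwx.trans hxy), hw w hwx]
  · rw [arrowOp_of_not hwx, map_zero]

/-- An "up, then down" relation becomes two conditions on `downOp`. At the weight x the right side
moves the weight itself to y₁ and y₂; at shorter weights both sides apply `downOp`, because the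
subsequent ascent is the identity there. -/
theorem arrowOp_up_down {x y z y₁ y₂ : W m} {a₁ a₂ : ℝ} (hxy : x.length < y.length)
    (hyz : ¬ y.length < z.length) (h₁ : x.length = y₁.length + 1) (h₂ : x.length = y₂.length + 1)
    (hxz : x.length = z.length)
    (hx : downOp y z (Finsupp.single x 1)
      = a₁ • Finsupp.single y₁ 1 + a₂ • Finsupp.single y₂ 1)
    (hw : ∀ w : W m, w.length < x.length → downOp y z (Finsupp.single w 1)
      = a₁ • downOp x y₁ (Finsupp.single w 1) + a₂ • downOp x y₂ (Finsupp.single w 1)) :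
    arrowOp y z * arrowOp x y
      = a₁ • (arrowOp y₁ z * arrowOp x y₁) + a₂ • (arrowOp y₂ z * arrowOp x y₂) := by
  have hmem : ∀ {w : W m} {y' : W m}, x.length = y'.length + 1 → w.length < x.length →
      downOp x y' (Finsupp.single w 1) ∈ below m y'.length := fun h h' =>
    downOp_mem_below _ _ (single_mem_below (by omega))
  refine end_ext x ?_ (fun w hwx => ?_) (fun w hwx => ?_) <;>
    simp only [Module.End.mul_apply, LinearMap.add_apply, LinearMap.smul_apply]
  · rw [arrowOp_up hxy (Or.inl rfl), arrowOp_down hyz hxy, hx,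
      arrowOp_self (y := y₁) (by omega), arrowOp_self (y := y₂) (by omega),
      arrowOp_up (x := y₁) (by omega) (Or.inl rfl), arrowOp_up (x := y₂) (by omega) (Or.inl rfl)]
  · rw [arrowOp_up hxy (Or.inr hwx), arrowOp_down hyz (hwx.trans hxy), hw w hwx,
      arrowOp_down (by omega) hwx, arrowOp_down (by omega) hwx,
      arrowOp_up_below (by omega) (hmem h₁ hwx), arrowOp_up_below (by omega) (hmem h₂ hwx)]
  · rw [arrowOp_of_not hwx, arrowOp_of_not hwx, arrowOp_of_not hwx, map_zero, map_zero, map_zero,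
      smul_zero, smul_zero, add_zero]

theorem arrowOp_up_up {x y y' z : W m} (hxy : x.length < y.length) (hyz : y.length < z.length)
    (hxy' : x.length < y'.length) (hyz' : y'.length < z.length) :
    arrowOp y z * arrowOp x y = arrowOp y' z * arrowOp x y' := by
  refine end_ext x ?_ (fun w hwx => ?_) (fun w hwx => ?_) <;>
    rw [Module.End.mul_apply, Module.End.mul_apply]
  · rw [arrowOp_up hxy (Or.inl rfl), arrowOp_up hxy' (Or.inl rfl), arrowOp_up hyz (Or.inr hxy),
      arrowOp_up hyz' (Or.inr hxy')]
  · rw [arrowOp_up hxy (Or.inr hwx), arrowOp_up hxy' (Or.inr hwx),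
      arrowOp_up hyz (Or.inr (hwx.trans hxy)), arrowOp_up hyz' (Or.inr (hwx.trans hxy'))]
  · rw [arrowOp_of_not hwx, arrowOp_of_not hwx, map_zero, map_zero]

theorem arrowOp_down_down {x y y' z : W m} {n : ℕ} (hx : x.length = n + 2) (hy : y.length = n + 1)
    (hy' : y'.length = n + 1) (hz : z.length = n)
    (h : ∀ v ∈ below m (n + 2), downOp y z (downOp x y v) = downOp y' z (downOp x y' v)) :
    arrowOp y z * arrowOp x y = arrowOp y' z * arrowOp x y' := by
  have hmem : ∀ {w : W m} (y : W m), w.length < x.length →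
      downOp x y (Finsupp.single w 1) ∈ below m (n + 1) := fun y h' =>
    downOp_mem_below _ _ (single_mem_below (by omega))
  refine end_ext x ?_ (fun w hwx => ?_) (fun w hwx => ?_) <;>
    rw [Module.End.mul_apply, Module.End.mul_apply]
  · rw [arrowOp_self (by omega), arrowOp_self (by omega), arrowOp_self (by omega),
      arrowOp_self (by omega)]
  · rw [arrowOp_down (by omega) hwx, arrowOp_down (by omega) hwx,
      arrowOp_down_below (by omega) (by rw [hy]; exact hmem y hwx),
      arrowOp_down_below (by omega) (by rw [hy']; exact hmem y' hwx),
      h _ (single_mem_below (by omega))]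
  · rw [arrowOp_of_not hwx, arrowOp_of_not hwx, map_zero, map_zero]

/-! ### The relations hold -/

variable (m) in
/-- The space on which the algebra acts; the vector `Pi.single z (Finsupp.single y 1)` stands for
the path that descends from `w₀` to `y` and ascends to `z`. -/
abbrev BigProj : Type := W m → Wt m

variable (m) in
/-- The action of the path algebra. -/
noncomputable def pathRep : PathAlgebra ℝ (W m) →ₐ[ℝ] Module.End ℝ (BigProj m) :=
  PathAlgebra.rep arrowOp

theorem path_eq_mul {x y z : W m} (h₁ : x.length = y.length + 1 ∨ y.length = x.length + 1)
    (h₂ : y.length = z.length + 1 ∨ z.length = y.length + 1) :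
    path x y z = PathAlgebra.of ℝ ⟨y, z, Quiver.Path.nil.cons (⟨h₂⟩ : y ⟶ z)⟩
      * PathAlgebra.of ℝ ⟨x, y, Quiver.Path.nil.cons (⟨h₁⟩ : x ⟶ y)⟩ := by
  rw [PathAlgebra.of_mul_of_comp, path, dif_pos ⟨h₁, h₂⟩]
  rfl

theorem pathRep_path {x y z : W m} (h₁ : x.length = y.length + 1 ∨ y.length = x.length + 1)
    (h₂ : y.length = z.length + 1 ∨ z.length = y.length + 1) :
    pathRep m (path x y z) = PathAlgebra.elementary x z (arrowOp y z * arrowOp x y) := by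
  rw [path_eq_mul h₁ h₂, map_mul, pathRep, PathAlgebra.rep_arrow, PathAlgebra.rep_arrow,
    PathAlgebra.elementary_mul]
  rfl

theorem elementary_combination (x z : W m) (a b : ℝ) (f g : Module.End ℝ (Wt m)) :
    PathAlgebra.elementary x z (a • f + b • g)
      = a • PathAlgebra.elementary x z f + b • PathAlgebra.elementary x z g := by
  refine LinearMap.ext fun v => ?_
  simp only [LinearMap.add_apply, LinearMap.smul_apply, PathAlgebra.elementary_apply,
    Pi.single_add, Pi.single_smul]

theorem pathRep_up_down {x y z y₁ y₂ : W m} {a₁ a₂ : ℝ} (hxy : y.length = x.length + 1)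
    (h₁ : x.length = y₁.length + 1) (h₂ : x.length = y₂.length + 1)
    (hxz : x.length = z.length)
    (hx : downOp y z (Finsupp.single x 1)
      = a₁ • Finsupp.single y₁ 1 + a₂ • Finsupp.single y₂ 1)
    (hw : ∀ w : W m, w.length < x.length → downOp y z (Finsupp.single w 1)
      = a₁ • downOp x y₁ (Finsupp.single w 1) + a₂ • downOp x y₂ (Finsupp.single w 1)) :
    pathRep m (path x y z) = pathRep m (a₁ • path x y₁ z + a₂ • path x y₂ z) := by
  rw [map_add, map_smul, map_smul, pathRep_path (by omega) (by omega),
    pathRep_path (by omega) (by omega), pathRep_path (by omega) (by omega),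
    arrowOp_up_down (by omega) (by omega) h₁ h₂ hxz hx hw, elementary_combination]

theorem pathRep_up_down_eq_zero {x y z : W m} (hxy : y.length = x.length + 1)
    (hxz : x.length = z.length) (hx : downOp y z (Finsupp.single x 1) = 0)
    (hw : ∀ w : W m, w.length < x.length → downOp y z (Finsupp.single w 1) = 0) :
    pathRep m (path x y z) = 0 := by
  rw [pathRep_path (by omega) (by omega),
    arrowOp_up_down_eq_zero (by omega) (by omega) hx hw]
  refine LinearMap.ext fun v => ?_
  rw [PathAlgebra.elementary_apply, LinearMap.zero_apply, Pi.single_zero, LinearMap.zero_apply]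

theorem pathRep_up_down_one {x y z : W m} {a : ℝ} (hx1 : x.length = 1) (hz1 : z.length = 1)
    (hy2 : y.length = 2) (hx : downOp y z (Finsupp.single x 1) = a • Finsupp.single .e 1) :
    pathRep m (path x y z) = pathRep m (a • path x .e z) := by
  have he : (W.e : W m).length = 0 := rfl
  -- There is only one vertex of length zero, so the second term duplicates the first with
  -- coefficient 0. The condition on shorter weights concerns e alone and reads 0 = 0.
  have := pathRep_up_down (x := x) (y := y) (z := z) (y₁ := .e) (y₂ := .e) (a₁ := a) (a₂ := 0)
    (by omega) (by omega) (by omega) (by omega) (by rw [hx, zero_smul, add_zero]) (fun w hw => by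
      obtain rfl : w = .e := by
        cases w with
        | e => rfl
        | mid c i =>
          have hw : (i : ℕ) + 1 < x.length := hw
          omega
        | w₀ =>
          have hw : m < x.length := hw
          have := x.length_le
          omega
      rw [downOp_e, downOp_e, smul_zero, smul_zero, add_zero])
  rw [this, zero_smul, add_zero]

theorem downOp_downOp (hm : 2 ≤ m) (c c' : Colour) {j : ℕ} (hj : j + 2 ≤ m) :
    ∀ v ∈ below m (j + 2),
      downOp (word m c (j + 1)) (word m c' j) (downOp (word m c (j + 2)) (word m c (j + 1)) v)
        = downOp (word m c.swap (j + 1)) (word m c' j)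
          (downOp (word m c (j + 2)) (word m c.swap (j + 1)) v) := by
  intro v hv
  -- For j = 0 each composite lowers the length by two on weights of length at most one, hence
  -- vanishes; this avoids the denominator [0].
  obtain _ | j := j
  · have h : ∀ x y x' y' : W m, downOp x y (downOp x' y' v) = 0 := fun x y x' y' => by
      have := downOp_mem_below x y (n := 0) (downOp_mem_below x' y' hv)
      rwa [below_zero, Submodule.mem_bot] at this
    rw [h, h]
  · have hq1 := qnum_ne_zero (m := m) (n := j + 1) (by omega) (by omega)
    have hq2 := qnum_ne_zero (m := m) (n := j + 1 + 1) (by omega) (by omega)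
    have hmul := qnum_mul hm (j + 1)
    have hadd := qnum_add hm (j + 1)
    rw [downOp_same c (by omega) (by omega), downOp_swap' hm c (by omega) (by omega)]
    rcases c'.eq_or_eq_swap c with rfl | rfl
    · rw [downOp_same c' (by omega) (by omega), downOp_swap hm c' (by omega) (by omega)]
      exact LinearMap.congr_fun
        (down_down_same (R := Module.End ℝ (Wt m)) hq1 hq2 (lower_comm hm c') (lower_sq hm c') hmul hadd) v
    · rw [downOp_swap' hm c (by omega) (by omega), downOp_same c.swap (by omega) (by omega)]
      exact LinearMap.congr_fun (down_down_swap (R := Module.End ℝ (Wt m)) hq1 hq2 (lower_sq hm c) hadd) v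

/-- The relations `r1` to `r9` are checked on the diagonal weight and on shorter weights separately.
Ascending squares commute because ascents are the identity on weights, descending ones by
`downOp_downOp`. -/
theorem pathRep_rel (hm : 3 ≤ m) {a b : PathAlgebra ℝ (W m)} (h : Rel m a b) :
    pathRep m a = pathRep m b := by
  have hm2 : 2 ≤ m := by omega
  have len : ∀ (c : Colour) {i : ℕ}, i ≤ m → (word m c i).length = i := fun c _ hi =>
    length_word c hi
  have he : (W.e : W m).length = 0 := rfl
  cases h with
  | r1 c =>
    rw [map_zero]
    refine pathRep_up_down_eq_zero (len c (by omega)) rfl (downOp_e _ _) fun w hw => ?_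
    exact absurd hw (Nat.not_lt_zero _)
  | r2 c =>
    rw [map_zero, pathRep_up_down_one (a := 0) (len c (by omega)) (len c (by omega))
      (len c (by omega)), zero_smul, map_zero]
    rw [downOp_same c le_rfl (by omega), LinearMap.smul_apply, lower_same c (by omega),
      qnum_zero, zero_smul, smul_zero, zero_smul]
  | r4 c =>
    refine pathRep_up_down_one (len _ (by omega)) (len _ (by omega)) (len _ (by omega)) ?_
    rw [downOp_swap hm2 c le_rfl (by omega), LinearMap.sub_apply, LinearMap.smul_apply,
      lower_same c (by omega), lower_swap_one hm2, qnum_zero, zero_smul, zero_sub, qnum_one hm2,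
      div_one, neg_smul]
  | r6 c =>
    rw [← one_smul ℝ (path (word m c 1) .e (word m c.swap 1))]
    refine pathRep_up_down_one (len _ (by omega)) (len _ (by omega)) (len _ (by omega)) ?_
    rw [downOp_swap' hm2 c le_rfl (by omega), LinearMap.sub_apply, LinearMap.smul_apply,
      lower_same c (by omega), lower_swap_one hm2, qnum_zero, zero_smul, smul_zero, sub_zero,
      one_smul]
  | r7 c =>
    rw [← one_smul ℝ (path (word m c 1) .e (word m c.swap 1))]
    refine pathRep_up_down_one (len _ (by omega)) (len _ (by omega)) (len _ (by omega)) ?_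
    rw [downOp_same c.swap le_rfl (by omega), LinearMap.smul_apply, lower_swap_one hm2,
      qnum_one hm2, div_one]
  | r3 c i hi hi' =>
    obtain ⟨j, rfl⟩ : ∃ j, i = j + 1 := ⟨i - 1, by omega⟩
    rw [Nat.add_sub_cancel]
    have hq1 := qnum_ne_zero (m := m) (n := j) (by omega) (by omega)
    have hq2 := qnum_ne_zero (m := m) (n := j + 1) (by omega) (by omega)
    have := pathRep_up_down (x := word m c (j + 1)) (y := word m c (j + 1 + 1))
      (z := word m c (j + 1)) (y₁ := word m c j) (y₂ := word m c j)
      (a₁ := qnum m j / qnum m (j + 1)) (a₂ := 0)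
      (by rw [len _ (by omega), len _ (by omega)]) (by rw [len _ (by omega), len _ (by omega)])
      (by rw [len _ (by omega), len _ (by omega)]) (by rw [len _ (by omega)])
      (by
        rw [downOp_same c (by omega) (by omega), LinearMap.smul_apply, lower_same c (by omega),
          zero_smul, add_zero, smul_smul]
        congr 1
        ring)
      (fun w _ => by
        rw [downOp_same c (by omega) (by omega), downOp_same c (by omega) (by omega),
          zero_smul, add_zero, LinearMap.smul_apply, LinearMap.smul_apply, smul_smul]
        congr 1
        field_simp)
    rw [this, zero_smul, add_zero]
  | r5 c i hi hi' =>
    obtain ⟨j, rfl⟩ : ∃ j, i = j + 1 := ⟨i - 1, by omega⟩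
    rw [Nat.add_sub_cancel, sub_eq_add_neg, ← neg_smul]
    have hq1 := qnum_ne_zero (m := m) (n := j) (by omega) (by omega)
    have hq2 := qnum_ne_zero (m := m) (n := j + 1) (by omega) (by omega)
    refine pathRep_up_down
      (by rw [len _ (by omega), len _ (by omega)]) (by rw [len _ (by omega), len _ (by omega)])
      (by rw [len _ (by omega), len _ (by omega)]) (by rw [len _ (by omega)])
      ?_ (fun w _ => ?_)
    · rw [downOp_swap hm2 c (by omega) (by omega), LinearMap.sub_apply, LinearMap.smul_apply,
        lower_same c (by omega), lower_swap c (by omega) (by omega)]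
      match_scalars
      · field_simp
      · ring
    · rw [downOp_swap hm2 c (by omega) (by omega), downOp_same c (by omega) (by omega),
        downOp_swap' hm2 c (by omega) (by omega)]
      simp only [LinearMap.sub_apply, LinearMap.smul_apply]
      match_scalars <;> field_simp
      ring
  | r8 c i hi hi' =>
    obtain ⟨j, rfl⟩ : ∃ j, i = j + 1 := ⟨i - 1, by omega⟩
    rw [Nat.add_sub_cancel, ← one_smul ℝ (path (word m c (j + 1)) (word m c.swap j) _)]
    have hq1 := qnum_ne_zero (m := m) (n := j) (by omega) (by omega)
    have hq2 := qnum_ne_zero (m := m) (n := j + 1) (by omega) (by omega)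
    have hmul := qnum_mul hm2 j
    refine pathRep_up_down
      (by rw [len _ (by omega), len _ (by omega)]) (by rw [len _ (by omega), len _ (by omega)])
      (by rw [len _ (by omega), len _ (by omega)]) (by rw [len _ (by omega), len _ (by omega)])
      ?_ (fun w _ => ?_)
    · rw [downOp_swap' hm2 c (by omega) (by omega), LinearMap.sub_apply, LinearMap.smul_apply,
        lower_same c (by omega), lower_swap c (by omega) (by omega)]
      match_scalars
      · field_simp
        linear_combination -hmul
      · ring
    · rw [downOp_swap' hm2 c (by omega) (by omega), downOp_same c (by omega) (by omega),
        downOp_swap' hm2 c (by omega) (by omega)]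
      simp only [LinearMap.sub_apply, LinearMap.smul_apply]
      match_scalars
      · ring
      · field_simp
        linear_combination -hmul
  | r9 c i hi hi' =>
    obtain ⟨j, rfl⟩ : ∃ j, i = j + 1 := ⟨i - 1, by omega⟩
    rw [Nat.add_sub_cancel, ← one_smul ℝ (path (word m c (j + 1)) (word m c j) _)]
    have hq1 := qnum_ne_zero (m := m) (n := j) (by omega) (by omega)
    have hq2 := qnum_ne_zero (m := m) (n := j + 1) (by omega) (by omega)
    refine pathRep_up_down
      (by rw [len _ (by omega), len _ (by omega)]) (by rw [len _ (by omega), len _ (by omega)])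
      (by rw [len _ (by omega), len _ (by omega)]) (by rw [len _ (by omega), len _ (by omega)])
      ?_ (fun w _ => ?_)
    · rw [downOp_same c.swap (by omega) (by omega), LinearMap.smul_apply,
        lower_swap c (by omega) (by omega)]
      match_scalars <;> field_simp
    · rw [downOp_same c.swap (by omega) (by omega), downOp_same c (by omega) (by omega),
        downOp_swap' hm2 c (by omega) (by omega)]
      simp only [LinearMap.sub_apply, LinearMap.smul_apply]
      match_scalars
      · field_simp
      · field_simp
        ring
  | r10 c j hj =>
    have h0 := len c (i := j) (by omega)
    have h1 := len c (i := j + 1) (by omega)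
    have h1' := len c.swap (i := j + 1) (by omega)
    have h2 := len c (i := j + 2) (by omega)
    rw [pathRep_path (by omega) (by omega), pathRep_path (by omega) (by omega),
      arrowOp_up_up (y := word m c (j + 1)) (y' := word m c.swap (j + 1)) (by omega) (by omega) (by omega) (by omega)]
  | r11 c j hj =>
    have h0 := len c (i := j) (by omega)
    have h1 := len c (i := j + 1) (by omega)
    have h1' := len c.swap (i := j + 1) (by omega)
    have h2 := len c.swap (i := j + 2) (by omega)
    rw [pathRep_path (by omega) (by omega), pathRep_path (by omega) (by omega),
      arrowOp_up_up (y := word m c (j + 1)) (y' := word m c.swap (j + 1)) (by omega) (by omega) (by omega) (by omega)]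
  | r12 c j hj =>
    have h0 := len c (i := j) (by omega)
    have h1 := len c (i := j + 1) (by omega)
    have h1' := len c.swap (i := j + 1) (by omega)
    have h2 := len c (i := j + 2) (by omega)
    rw [pathRep_path (by omega) (by omega), pathRep_path (by omega) (by omega),
      arrowOp_down_down h2 h1 h1' h0 (downOp_downOp hm2 c c (by omega))]
  | r13 c j hj =>
    have h0 := len c.swap (i := j) (by omega)
    have h1 := len c (i := j + 1) (by omega)
    have h1' := len c.swap (i := j + 1) (by omega)
    have h2 := len c (i := j + 2) (by omega)
    rw [pathRep_path (by omega) (by omega), pathRep_path (by omega) (by omega),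
      arrowOp_down_down h2 h1 h1' h0 (downOp_downOp hm2 c c.swap (by omega))]

/-! ## Generators of the algebra -/

/-- The idempotent of a vertex. -/
noncomputable def idem (x : W m) : P m :=
  RingQuot.mkAlgHom ℝ (Rel m) (PathAlgebra.of ℝ ⟨x, x, .nil⟩)

/-- The arrow from `x` to `y`, or zero if there is none. -/
noncomputable def arr (x y : W m) : P m :=
  if h : x.length = y.length + 1 ∨ y.length = x.length + 1 then
    RingQuot.mkAlgHom ℝ (Rel m) (PathAlgebra.of ℝ ⟨x, y, Quiver.Path.nil.cons (⟨h⟩ : x ⟶ y)⟩)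
  else 0

theorem arr_of_hom {x y : W m} (a : x ⟶ y) :
    RingQuot.mkAlgHom ℝ (Rel m) (PathAlgebra.of ℝ ⟨x, y, Quiver.Path.nil.cons a⟩) = arr x y := by
  obtain ⟨h⟩ := a
  rw [arr, dif_pos h]

theorem arr_eq_zero {x y : W m} (h : ¬ (x.length = y.length + 1 ∨ y.length = x.length + 1)) :
    arr x y = 0 := dif_neg h

theorem idem_mul_self (x : W m) : idem x * idem x = idem x := by
  rw [idem, ← map_mul, PathAlgebra.of_mul_of_comp]
  rfl

theorem idem_mul_of_ne {x y : W m} (h : x ≠ y) : idem x * idem y = 0 := by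
  rw [idem, idem, ← map_mul, PathAlgebra.of_mul_of_ne ℝ (by exact h.symm), map_zero]

theorem sum_idem : ∑ x : W m, idem x = 1 := by
  rw [← map_one (RingQuot.mkAlgHom ℝ (Rel m)), PathAlgebra.one_def, map_sum]
  rfl

theorem idem_mul_arr (x y : W m) : idem y * arr x y = arr x y := by
  rw [arr]
  split_ifs
  · rw [idem, ← map_mul, PathAlgebra.of_mul_of_comp]
    rfl
  · exact mul_zero _

theorem arr_mul_idem (x y : W m) : arr x y * idem x = arr x y := by
  rw [arr]
  split_ifs
  · rw [idem, ← map_mul, PathAlgebra.of_mul_of_comp]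
    rfl
  · exact zero_mul _

theorem arr_mul_idem_of_ne {x x' : W m} (h : x ≠ x') (y : W m) : arr x y * idem x' = 0 := by
  rw [← arr_mul_idem, mul_assoc, idem_mul_of_ne h, mul_zero]

theorem arr_mul_of_ne {y y' : W m} (h : y ≠ y') (z : W m) {a : P m} (ha : idem y * a = a) :
    arr y' z * a = 0 := by
  rw [← ha, ← mul_assoc, arr_mul_idem_of_ne h.symm, zero_mul]

theorem mk_path (x y z : W m) :
    RingQuot.mkAlgHom ℝ (Rel m) (path x y z) = arr y z * arr x y := by
  by_cases h : (x.length = y.length + 1 ∨ y.length = x.length + 1) ∧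
      (y.length = z.length + 1 ∨ z.length = y.length + 1)
  · rw [path_eq_mul h.1 h.2, map_mul, arr_of_hom, arr_of_hom]
  · rw [path, dif_neg h, map_zero]
    by_cases h1 : x.length = y.length + 1 ∨ y.length = x.length + 1
    · rw [arr_eq_zero (x := y) (fun h2 => h ⟨h1, h2⟩), zero_mul]
    · rw [arr_eq_zero (x := x) h1, mul_zero]

/-- Every element of A is a linear combination of products of arrows and idempotents. The spanning
statements below, and stability under A, follow by checking these generators only. -/
theorem mul_mem_of_generators (S : Submodule ℝ (P m)) (he : ∀ x, ∀ s ∈ S, idem x * s ∈ S)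
    (ha : ∀ x y, ∀ s ∈ S, arr x y * s ∈ S) (a : P m) {s : P m} (hs : s ∈ S) : a * s ∈ S := by
  obtain ⟨b, rfl⟩ := RingQuot.mkAlgHom_surjective ℝ (Rel m) a
  induction b using PathAlgebra.induction with
  | zero =>
    rw [map_zero, zero_mul]
    exact S.zero_mem
  | add b b' hb hb' =>
    rw [map_add, add_mul]
    exact S.add_mem hb hb'
  | smul c p =>
    rw [map_smul, smul_mul_assoc]
    refine S.smul_mem c ?_
    obtain ⟨x, y, p⟩ := p
    induction p with
    | nil => exact he x s hs
    | @cons y z p a ih =>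
      have : (PathAlgebra.of ℝ ⟨x, z, p.cons a⟩ : PathAlgebra ℝ (W m))
          = PathAlgebra.of ℝ ⟨y, z, Quiver.Path.nil.cons a⟩ * PathAlgebra.of ℝ ⟨x, y, p⟩ := by
        rw [PathAlgebra.of_mul_of_comp]
        rfl
      rw [this, map_mul, mul_assoc, arr_of_hom]
      exact ha _ _ _ ih

theorem idem_mem (x : W m) : idem x ∈ P.grading m 0 :=
  ⟨_, PathAlgebra.of_mem ℝ ⟨x, x, .nil⟩, rfl⟩

theorem arr_mem (x y : W m) : arr x y ∈ P.grading m 1 := by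
  rw [arr]
  split_ifs with h
  · exact ⟨_, PathAlgebra.of_mem ℝ ⟨x, y, Quiver.Path.nil.cons (⟨h⟩ : x ⟶ y)⟩, rfl⟩
  · exact Submodule.zero_mem _

/-! ### Left ideals generated by arrows -/

/-- The left ideal generated by the descending arrows that start at `x`. -/
noncomputable def lowerIdeal (x : W m) : Ideal (P m) :=
  Ideal.span {a | ∃ y : W m, y.length < x.length ∧ a = arr x y}

/-- The left ideal generated by all arrows that start at `x`. -/
noncomputable def radIdeal (x : W m) : Ideal (P m) := Ideal.span {a | ∃ y : W m, a = arr x y}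

theorem arr_mem_lowerIdeal {x y : W m} (h : y.length < x.length) : arr x y ∈ lowerIdeal x :=
  Ideal.subset_span ⟨y, h, rfl⟩

theorem arr_mem_radIdeal (x y : W m) : arr x y ∈ radIdeal x := Ideal.subset_span ⟨y, rfl⟩

theorem smul_mem_ideal (I : Ideal (P m)) (c : ℝ) {a : P m} (ha : a ∈ I) : c • a ∈ I := by
  rw [← smul_one_mul]
  exact I.mul_mem_left _ ha

/-- A left ideal as a real subspace. -/
noncomputable def idealSpace (I : Ideal (P m)) : Submodule ℝ (P m) where
  carrier := I
  add_mem' := I.add_mem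
  zero_mem' := I.zero_mem
  smul_mem' c _ ha := smul_mem_ideal I c ha

variable (m) in
/-- The left ideal generated by all arrows. -/
noncomputable def arrowIdeal : Ideal (P m) := ⨆ x : W m, radIdeal x

theorem radIdeal_le (x : W m) : radIdeal x ≤ arrowIdeal m := le_iSup radIdeal x

/-- Together with the vanishing of degree zero on `arrowIdeal`, this identifies A₀ with the span of
the idempotents and the ideal of positive degree with `arrowIdeal`. -/
theorem mem_span_idem_sup (a : P m) :
    ∃ s ∈ Submodule.span ℝ (Set.range (idem : W m → P m)), ∃ l ∈ arrowIdeal m, s + l = a := by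
  let S : Submodule ℝ (P m) :=
    Submodule.span ℝ (Set.range (idem : W m → P m)) ⊔ idealSpace (arrowIdeal m)
  suffices h : a ∈ S by
    obtain ⟨s, hs, l, hl, h⟩ := Submodule.mem_sup.1 h
    exact ⟨s, hs, l, hl, h⟩
  have h1 : (1 : P m) ∈ S := by
    rw [← sum_idem]
    exact Submodule.mem_sup_left (Submodule.sum_mem _ fun x _ => Submodule.subset_span ⟨x, rfl⟩)
  have key : ∀ b : P m, (∀ x, b * idem x ∈ S) → ∀ s ∈ S, b * s ∈ S := by
    intro b hb s hs
    obtain ⟨t, ht, l, hl, rfl⟩ := Submodule.mem_sup.1 hs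
    rw [mul_add]
    refine S.add_mem ?_ (Submodule.mem_sup_right ((arrowIdeal m).mul_mem_left b hl))
    clear hs
    induction ht using Submodule.span_induction with
    | mem _ h =>
      obtain ⟨x, rfl⟩ := h
      exact hb x
    | zero =>
      rw [mul_zero]
      exact S.zero_mem
    | add _ _ _ _ h h' =>
      rw [mul_add]
      exact S.add_mem h h'
    | smul c _ _ h =>
      rw [mul_smul_comm]
      exact S.smul_mem c h
  have := mul_mem_of_generators S
    (fun x => key _ fun y => by
      by_cases h : x = y
      · subst h
        rw [idem_mul_self]
        exact Submodule.mem_sup_left (Submodule.subset_span ⟨x, rfl⟩)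
      · rw [idem_mul_of_ne h]
        exact S.zero_mem)
    (fun x y => key _ fun z => by
      by_cases h : x = z
      · subst h
        rw [arr_mul_idem]
        exact Submodule.mem_sup_right (radIdeal_le _ (arr_mem_radIdeal _ _))
      · rw [arr_mul_idem_of_ne h]
        exact S.zero_mem) a h1
  rwa [mul_one] at this

theorem decompose_zero_of_mem_arrowIdeal {a : P m} (ha : a ∈ arrowIdeal m) :
    (DirectSum.decompose (P.grading m) a 0 : P m) = 0 := by
  let K : AddSubgroup (P m) := (GradedRing.proj (P.grading m) 0).ker
  have key : ∀ x, ∀ b ∈ radIdeal x, b ∈ K := by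
    intro x b hb
    induction hb using Submodule.span_induction with
    | mem b h =>
      obtain ⟨y, rfl⟩ := h
      exact DirectSum.decompose_of_mem_ne (P.grading m) (arr_mem x y) one_ne_zero
    | zero => exact K.zero_mem
    | add _ _ _ _ h h' => exact K.add_mem h h'
    | smul c b _ h =>
      have := map_mul (GradedRing.projZeroRingHom (P.grading m)) c b
      refine this.trans ?_
      rw [show GradedRing.projZeroRingHom (P.grading m) b = 0 from h, mul_zero]
  change a ∈ K
  rw [arrowIdeal] at ha
  induction ha using Submodule.iSup_induction' with
  | mem x b hb => exact key x b hb
  | zero => exact K.zero_mem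
  | add _ _ _ _ h h' => exact K.add_mem h h'

theorem span_idem_le :
    Submodule.span ℝ (Set.range (idem : W m → P m)) ≤ P.grading m 0 := by
  rw [Submodule.span_le]
  rintro _ ⟨x, rfl⟩
  exact idem_mem x

theorem decompose_zero_add {s l : P m} (hs : s ∈ Submodule.span ℝ (Set.range (idem : W m → P m)))
    (hl : l ∈ arrowIdeal m) : (DirectSum.decompose (P.grading m) (s + l) 0 : P m) = s := by
  rw [DirectSum.decompose_add, DirectSum.add_apply, Submodule.coe_add,
    decompose_zero_of_mem_arrowIdeal hl, add_zero,
    DirectSum.decompose_of_mem_same _ (span_idem_le hs)]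

theorem mem_arrowIdeal_iff (a : P m) :
    a ∈ arrowIdeal m ↔ (DirectSum.decompose (P.grading m) a 0 : P m) = 0 := by
  refine ⟨decompose_zero_of_mem_arrowIdeal, fun h => ?_⟩
  obtain ⟨s, hs, l, hl, rfl⟩ := mem_span_idem_sup a
  rw [decompose_zero_add hs hl] at h
  rwa [h, zero_add]

/-- The orthogonal idempotents span A₀, so it is an image of the semisimple ring ℝ^W; their linear
independence is not required. -/
theorem isSemisimpleRing_gradingZero : IsSemisimpleRing (P.grading m 0) := by
  let f : (W m → ℝ) →+* P.grading m 0 :=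
    { toFun := fun c => ⟨∑ x, c x • idem x,
        Submodule.sum_mem _ fun x _ => Submodule.smul_mem _ _ (idem_mem x)⟩
      map_one' := Subtype.ext (by
        simp only [Pi.one_apply, one_smul, sum_idem]
        rfl)
      map_mul' := fun c d => Subtype.ext (by
        change ∑ x, (c * d) x • idem x = (∑ x, c x • idem x) * ∑ x, d x • idem x
        rw [Finset.sum_mul_sum]
        refine Finset.sum_congr rfl fun x _ => ?_
        rw [Finset.sum_eq_single x]
        · rw [smul_mul_smul_comm, idem_mul_self]
          rfl
        · intro y _ hy
          rw [smul_mul_smul_comm, idem_mul_of_ne hy.symm, smul_zero]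
        · exact fun h => absurd (Finset.mem_univ x) h)
      map_zero' := Subtype.ext (by
        simp only [Pi.zero_apply, zero_smul, Finset.sum_const_zero]
        rfl)
      map_add' := fun c d => Subtype.ext (by
        simp only [Pi.add_apply, add_smul, Finset.sum_add_distrib]
        rfl) }
  refine f.isSemisimpleRing_of_surjective ?_
  rintro ⟨a, ha⟩
  obtain ⟨s, hs, l, hl, rfl⟩ := mem_span_idem_sup a
  have h := decompose_zero_add hs hl
  rw [DirectSum.decompose_of_mem_same _ ha] at h
  obtain ⟨c, hc⟩ := (Submodule.mem_span_range_iff_exists_fun ℝ).1 hs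
  exact ⟨c, Subtype.ext (hc.trans h.symm)⟩

/-! ### The relations -/

theorem mk_rel {a b : PathAlgebra ℝ (W m)} (h : Rel m a b) :
    RingQuot.mkAlgHom ℝ (Rel m) a = RingQuot.mkAlgHom ℝ (Rel m) b := RingQuot.mkAlgHom_rel ℝ h

theorem eq_e_of_length {x : W m} (hm : 2 ≤ m) (h : x.length = 0) : x = .e := by
  rcases x.eq_word hm h .s with h | h <;> exact h

/-- Each of the relations `r1` to `r9` has a left side that ascends first and a right side that
descends first or is zero. Through them ascents can be moved after descents. -/
theorem up_down_mem (hm : 3 ≤ m) {x y z : W m} (hxy : x.length < y.length)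
    (hyz : z.length < y.length) : arr y z * arr x y ∈ lowerIdeal x := by
  by_cases h₁ : y.length = x.length + 1
  swap
  · rw [arr_eq_zero (x := x) (by omega), mul_zero]
    exact Ideal.zero_mem _
  by_cases h₂ : y.length = z.length + 1
  swap
  · rw [arr_eq_zero (x := y) (by omega), zero_mul]
    exact Ideal.zero_mem _
  have hm2 : 2 ≤ m := by omega
  have hym := y.length_le
  have mem : ∀ {y' : W m}, y'.length < x.length → ∀ z, arr y' z * arr x y' ∈ lowerIdeal x :=
    fun h z => Ideal.mul_mem_left _ _ (arr_mem_lowerIdeal h)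
  obtain ⟨i, hi⟩ : ∃ i, i = x.length := ⟨_, rfl⟩
  obtain ⟨c, hx⟩ := x.exists_word hm2
  rw [← hi] at hx
  have hy := y.eq_word hm2 (n := i + 1) (by omega) c
  have hz := z.eq_word hm2 (n := i) (by omega) c
  have len : ∀ c : Colour, (word m c (i - 1)).length = i - 1 := fun c => length_word c (by omega)
  rw [← mk_path]
  obtain _ | _ | i := i
  · obtain rfl : x = .e := hx
    obtain rfl : z = .e := eq_e_of_length hm2 (by omega)
    have : ∀ c, RingQuot.mkAlgHom ℝ (Rel m) (path .e (word m c 1) .e) ∈ lowerIdeal .e := fun c => by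
      rw [mk_rel (Rel.r1 c), map_zero]
      exact Ideal.zero_mem _
    rcases hy with rfl | rfl
    · exact this c
    · exact this c.swap
  · have h0 : (W.e : W m).length < x.length := by rw [← hi]; exact Nat.zero_lt_one
    rw [hx] at mem ⊢
    rcases hy with hy | hy <;> rcases hz with hz | hz <;> rw [hy, hz]
    · rw [mk_rel (Rel.r2 c), map_zero]
      exact Ideal.zero_mem _
    · rw [mk_rel (Rel.r6 c), mk_path]
      exact mem (hx ▸ h0) _
    · rw [mk_rel (Rel.r4 c), map_smul, mk_path]
      exact smul_mem_ideal _ _ (mem (hx ▸ h0) _)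
    · rw [mk_rel (Rel.r7 c), mk_path]
      exact mem (hx ▸ h0) _
  · have h0 : ∀ c, (word m c (i + 1 + 1 - 1)).length < x.length := fun c => by
      rw [len]
      omega
    have hlx : (word m c (i + 1 + 1)).length = x.length := by rw [← hx]
    rw [← hlx] at h0
    rw [hx] at mem ⊢
    have hle : i + 1 + 1 ≤ m - 1 := by omega
    rcases hy with hy | hy <;> rcases hz with hz | hz <;> rw [hy, hz]
    · rw [mk_rel (Rel.r3 c _ (by omega) hle), map_smul, mk_path]
      exact smul_mem_ideal _ _ (mem (h0 _) _)
    · rw [mk_rel (Rel.r8 c _ (by omega) hle), map_add, map_smul, mk_path, mk_path]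
      exact Ideal.add_mem _ (smul_mem_ideal _ _ (mem (h0 _) _)) (mem (h0 _) _)
    · rw [mk_rel (Rel.r5 c _ (by omega) hle), map_sub, map_smul, map_smul, mk_path, mk_path]
      exact Ideal.sub_mem _ (smul_mem_ideal _ _ (mem (h0 _) _)) (smul_mem_ideal _ _ (mem (h0 _) _))
    · rw [mk_rel (Rel.r9 c _ (by omega) hle), map_add, map_smul, mk_path, mk_path]
      exact Ideal.add_mem _ (mem (h0 _) _) (smul_mem_ideal _ _ (mem (h0 _) _))

theorem up_up (hm : 3 ≤ m) {x y y' z : W m} (hy : y.length = x.length + 1)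
    (hy' : y'.length = x.length + 1) (hz : z.length = x.length + 2) :
    arr y z * arr x y = arr y' z * arr x y' := by
  have hm2 : 2 ≤ m := by omega
  have hzm := z.length_le
  obtain ⟨c, hx⟩ := x.exists_word hm2
  generalize hj : x.length = j at *
  have key : arr (word m c (j + 1)) z * arr x (word m c (j + 1))
      = arr (word m c.swap (j + 1)) z * arr x (word m c.swap (j + 1)) := by
    rw [← mk_path, ← mk_path, hx]
    rcases z.eq_word hm2 hz c with rfl | rfl
    · exact mk_rel (Rel.r10 c j (by omega))
    · exact mk_rel (Rel.r11 c j (by omega))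
  rcases y.eq_word hm2 hy c with rfl | rfl <;> rcases y'.eq_word hm2 hy' c with rfl | rfl
  · rfl
  · exact key
  · exact key.symm
  · rfl

theorem down_down (hm : 3 ≤ m) {x y y' z : W m} (hy : y.length = z.length + 1)
    (hy' : y'.length = z.length + 1) (hx : x.length = z.length + 2) :
    arr y z * arr x y = arr y' z * arr x y' := by
  have hm2 : 2 ≤ m := by omega
  have hxm := x.length_le
  obtain ⟨c, hxc⟩ := x.exists_word hm2
  rw [hx] at hxc
  have hzc := z.eq_word hm2 rfl c
  generalize z.length = j at *
  have key : arr (word m c (j + 1)) z * arr x (word m c (j + 1))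
      = arr (word m c.swap (j + 1)) z * arr x (word m c.swap (j + 1)) := by
    rw [← mk_path, ← mk_path, hxc]
    rcases hzc with rfl | rfl
    · exact mk_rel (Rel.r12 c j (by omega))
    · exact mk_rel (Rel.r13 c j (by omega))
  rcases y.eq_word hm2 hy c with rfl | rfl <;> rcases y'.eq_word hm2 hy' c with rfl | rfl
  · rfl
  · exact key
  · exact key.symm
  · rfl

/-! ### The action on the big projective -/

/-- The action of the algebra on `BigProj`. -/
noncomputable def bigRep (hm : 3 ≤ m) : P m →ₐ[ℝ] Module.End ℝ (BigProj m) :=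
  RingQuot.liftAlgHom ℝ ⟨pathRep m, fun {_ _} h => pathRep_rel hm h⟩

theorem bigRep_idem (hm : 3 ≤ m) (x : W m) :
    bigRep hm (idem x) = PathAlgebra.elementary x x LinearMap.id := by
  rw [bigRep, idem, RingQuot.liftAlgHom_mkAlgHom_apply]
  exact PathAlgebra.rep_nil _ _

theorem bigRep_arr (hm : 3 ≤ m) {x y : W m}
    (h : x.length = y.length + 1 ∨ y.length = x.length + 1) :
    bigRep hm (arr x y) = PathAlgebra.elementary x y (arrowOp x y) := by
  rw [bigRep, arr, dif_pos h, RingQuot.liftAlgHom_mkAlgHom_apply]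
  exact PathAlgebra.rep_arrow _ _

/-! ## Ascending paths -/

/-- `IsUp y z a` says that `a` is the class of an ascending path from `y` to `z`. -/
inductive IsUp (y : W m) : W m → P m → Prop
  | nil : IsUp y y (idem y)
  | cons {z z' : W m} {a : P m} (h : IsUp y z a) (hz : z'.length = z.length + 1) :
      IsUp y z' (arr z z' * a)

namespace IsUp

variable {x y z : W m} {a b : P m}

theorem eq_or_lt (h : IsUp y z a) : y = z ∨ y.length < z.length := by
  induction h with
  | nil => exact Or.inl rfl
  | cons _ hz ih =>
    right
    rcases ih with rfl | ih <;> omega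

theorem idem_mul (h : IsUp y z a) : idem z * a = a := by
  cases h with
  | nil => exact idem_mul_self y
  | cons => rw [← mul_assoc, idem_mul_arr]

/-- Two ascending paths with the same ends differ by commuting squares at the last two steps, by
induction on the length of the endpoint. -/
theorem unique (hm : 3 ≤ m) (ha : IsUp y z a) (hb : IsUp y z b) : a = b := by
  obtain ⟨n, hn⟩ : ∃ n, z.length = n := ⟨_, rfl⟩
  induction n generalizing z a b with
  | zero =>
    cases ha with
    | nil =>
      cases hb with
      | nil => rfl
      | cons _ hz => omega
    | cons _ hz => omega
  | succ n ih =>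
    cases ha with
    | nil =>
      cases hb with
      | nil => rfl
      | cons h hz => rcases h.eq_or_lt with rfl | h <;> omega
    | @cons z₁ _ a h₁ hz₁ =>
      cases hb with
      | nil => rcases h₁.eq_or_lt with rfl | h <;> omega
      | @cons z₂ _ b h₂ hz₂ =>
        by_cases h12 : z₁ = z₂
        · subst h12
          rw [ih h₁ h₂ (by omega)]
        have hlt : y.length < z₁.length := by
          rcases h₁.eq_or_lt with rfl | h
          · rcases h₂.eq_or_lt with h' | h'
            · exact absurd h' h12
            · omega
          · exact h
        -- A predecessor of z₁ is also one of z₂, since Q_m joins any two vertices of adjacent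
        -- lengths; both paths can then be rerouted through z₀.
        obtain ⟨z₀, c, hc, hz₀⟩ : ∃ z₀ c, IsUp y z₀ c ∧ z₁.length = z₀.length + 1 := by
          cases h₁ with
          | nil => exact absurd hlt (lt_irrefl _)
          | cons h0 hz0 => exact ⟨_, _, h0, hz0⟩
        rw [ih h₁ (.cons hc hz₀) (by omega), ih h₂ (.cons hc (by omega)) (by omega), ← mul_assoc,
          ← mul_assoc, up_up hm (y' := z₂) hz₀ (by omega) (by omega)]

theorem mul_mem (I : Ideal (P m)) (h : ∀ z', z'.length < z.length → arr z z' * a ∈ I)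
    (hb : b ∈ lowerIdeal z) : b * a ∈ I := by
  induction hb using Submodule.span_induction with
  | mem _ hy =>
    obtain ⟨y, hy, rfl⟩ := hy
    exact h y hy
  | zero =>
    rw [zero_mul]
    exact I.zero_mem
  | add _ _ _ _ h₁ h₂ =>
    rw [add_mul]
    exact I.add_mem h₁ h₂
  | smul c _ _ h₁ =>
    rw [smul_eq_mul, mul_assoc]
    exact I.mul_mem_left _ h₁

/-- A descending arrow after an ascending path is pushed to the front of the path, one square at a
time, by `up_down_mem`. -/
theorem arr_mul_mem (hm : 3 ≤ m) (h : IsUp y z a) :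
    ∀ z', z'.length < z.length → arr z z' * a ∈ lowerIdeal y := by
  induction h with
  | nil =>
    intro z' hz'
    rw [arr_mul_idem]
    exact arr_mem_lowerIdeal hz'
  | @cons z₀ z a h hz ih =>
    intro z' hz'
    rw [← mul_assoc]
    exact mul_mem _ ih (up_down_mem hm (by omega) hz')

end IsUp

/-- The ascending path from `y` to `z`, if there is one. -/
noncomputable def upElt (y z : W m) : P m :=
  open Classical in if h : ∃ a, IsUp y z a then h.choose else 0

theorem IsUp.eq_upElt (hm : 3 ≤ m) {y z : W m} {a : P m} (h : IsUp y z a) : a = upElt y z := by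
  rw [upElt, dif_pos ⟨a, h⟩]
  exact h.unique hm (Exists.choose_spec (⟨a, h⟩ : ∃ a, IsUp y z a))

theorem upElt_spec (y z : W m) : IsUp y z (upElt y z) ∨ upElt y z = 0 := by
  by_cases h : ∃ a, IsUp y z a
  · rw [upElt, dif_pos h]
    exact Or.inl h.choose_spec
  · exact Or.inr (dif_neg h)

theorem idem_mul_upElt (y z : W m) : idem z * upElt y z = upElt y z := by
  rcases upElt_spec y z with h | h
  · exact h.idem_mul
  · rw [h, mul_zero]

/-- Modulo the paths that start with a descending arrow, every element is a combination of
ascending paths. -/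
theorem exists_sum_upElt (hm : 3 ≤ m) {x : W m} {a : P m} (ha : a * idem x = a) :
    ∃ c : W m → ℝ, ∃ b ∈ lowerIdeal x, ∑ z, c z • upElt x z + b = a := by
  let S : Submodule ℝ (P m) := Submodule.span ℝ (Set.range (upElt x)) ⊔ idealSpace (lowerIdeal x)
  have h1 : idem x ∈ S := Submodule.mem_sup_left (Submodule.subset_span
    ⟨x, (IsUp.nil.eq_upElt hm).symm⟩)
  have key : ∀ b : P m, (∀ z, b * upElt x z ∈ S) → ∀ s ∈ S, b * s ∈ S := by
    intro b hb s hs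
    obtain ⟨t, ht, l, hl, rfl⟩ := Submodule.mem_sup.1 hs
    rw [mul_add]
    refine S.add_mem ?_ (Submodule.mem_sup_right ((lowerIdeal x).mul_mem_left b hl))
    clear hs
    induction ht using Submodule.span_induction with
    | mem _ h =>
      obtain ⟨z, rfl⟩ := h
      exact hb z
    | zero =>
      rw [mul_zero]
      exact S.zero_mem
    | add _ _ _ _ h h' =>
      rw [mul_add]
      exact S.add_mem h h'
    | smul c _ _ h =>
      rw [mul_smul_comm]
      exact S.smul_mem c h
  have hS := mul_mem_of_generators S
    (fun w => key _ fun z => by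
      by_cases h : w = z
      · subst h
        rw [idem_mul_upElt]
        exact Submodule.mem_sup_left (Submodule.subset_span ⟨w, rfl⟩)
      · rw [← idem_mul_upElt, ← mul_assoc, idem_mul_of_ne h, zero_mul]
        exact S.zero_mem)
    (fun w w' => key _ fun z => by
      by_cases h : z = w
      · subst h
        rcases upElt_spec x z with hu | hu
        · rcases lt_or_ge w'.length z.length with hl | hl
          · exact Submodule.mem_sup_right (hu.arr_mul_mem hm w' hl)
          · by_cases h2 : w'.length = z.length + 1
            · exact Submodule.mem_sup_left (Submodule.subset_span
                ⟨w', ((hu.cons h2).eq_upElt hm).symm⟩)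
            · rw [arr_eq_zero (by omega), zero_mul]
              exact S.zero_mem
        · rw [hu, mul_zero]
          exact S.zero_mem
      · rw [arr_mul_of_ne h _ (idem_mul_upElt x z)]
        exact S.zero_mem) a h1
  rw [ha] at hS
  obtain ⟨t, ht, l, hl, h⟩ := Submodule.mem_sup.1 hS
  obtain ⟨c, hc⟩ := (Submodule.mem_span_range_iff_exists_fun ℝ).1 ht
  exact ⟨c, l, hl, by rw [hc, h]⟩

/-- Modulo the radical, every element is a multiple of the idempotent. -/
theorem exists_smul_idem {x : W m} {a : P m} (ha : a * idem x = a) :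
    ∃ c : ℝ, ∃ b ∈ radIdeal x, c • idem x + b = a := by
  let S : Submodule ℝ (P m) := Submodule.span ℝ {idem x} ⊔ idealSpace (radIdeal x)
  have key : ∀ b : P m, b * idem x ∈ S → ∀ s ∈ S, b * s ∈ S := by
    intro b hb s hs
    obtain ⟨t, ht, l, hl, rfl⟩ := Submodule.mem_sup.1 hs
    obtain ⟨c, rfl⟩ := Submodule.mem_span_singleton.1 ht
    rw [mul_add, mul_smul_comm]
    exact S.add_mem (S.smul_mem c hb) (Submodule.mem_sup_right ((radIdeal x).mul_mem_left b hl))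
  have hS := mul_mem_of_generators S
    (fun w => key _ (by
      by_cases h : w = x
      · subst h
        rw [idem_mul_self]
        exact Submodule.mem_sup_left (Submodule.mem_span_singleton_self _)
      · rw [idem_mul_of_ne h]
        exact S.zero_mem))
    (fun w w' => key _ (by
      by_cases h : w = x
      · subst h
        rw [arr_mul_idem]
        exact Submodule.mem_sup_right (arr_mem_radIdeal w w')
      · rw [arr_mul_idem_of_ne h]
        exact S.zero_mem)) a (Submodule.mem_sup_left (Submodule.mem_span_singleton_self _))
  rw [ha] at hS
  obtain ⟨t, ht, l, hl, h⟩ := Submodule.mem_sup.1 hS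
  obtain ⟨c, hc⟩ := Submodule.mem_span_singleton.1 ht
  exact ⟨c, l, hl, by rw [hc, h]⟩

/-! ## Coordinates in the big projective -/

/-- The basis vector of the path that descends to `y` and ascends to `z`. -/
noncomputable def bigVec (y z : W m) : BigProj m := Pi.single z (Finsupp.single y 1)

theorem bigVec_apply (y z x : W m) :
    bigVec y z z x = if y = x then 1 else 0 := by
  rw [bigVec, Pi.single_eq_same, Finsupp.single_apply]

theorem bigVec_apply_of_ne {y z z' : W m} (h : z' ≠ z) : bigVec y z z' = 0 :=
  Pi.single_eq_of_ne h _

theorem bigRep_arr_bigVec (hm : 3 ≤ m) {w x y : W m}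
    (h : x.length = y.length + 1 ∨ y.length = x.length + 1) :
    bigRep hm (arr x y) (bigVec w x) = Pi.single y (arrowOp x y (Finsupp.single w 1)) := by
  rw [bigRep_arr hm h, PathAlgebra.elementary_apply, bigVec, Pi.single_eq_same]

theorem bigRep_arr_up (hm : 3 ≤ m) {w x y : W m} (h : y.length = x.length + 1)
    (hw : w = x ∨ w.length < x.length) : bigRep hm (arr x y) (bigVec w x) = bigVec w y := by
  rw [bigRep_arr_bigVec hm (Or.inr h), arrowOp_up (by omega) hw, bigVec]

theorem bigRep_arr_down (hm : 3 ≤ m) {x y : W m} (h : x.length = y.length + 1) :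
    bigRep hm (arr x y) (bigVec x x) = bigVec y y := by
  rw [bigRep_arr_bigVec hm (Or.inl h), arrowOp_self (by omega), bigVec]

theorem IsUp.bigRep_bigVec (hm : 3 ≤ m) {w y z : W m} {a : P m} (h : IsUp y z a)
    (hw : w = y ∨ w.length < y.length) : bigRep hm a (bigVec w y) = bigVec w z := by
  induction h with
  | nil =>
    rw [bigRep_idem, PathAlgebra.elementary_apply, bigVec, Pi.single_eq_same]
    rfl
  | @cons z z' a h hz ih =>
    rw [map_mul, Module.End.mul_apply, ih, bigRep_arr_up hm hz]
    rcases hw with rfl | hw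
    · exact h.eq_or_lt
    · rcases h.eq_or_lt with rfl | h'
      · exact Or.inr hw
      · exact Or.inr (hw.trans h')

/-- A combination of ascending paths from `y` is determined by its action on `BigProj`. -/
theorem sum_upElt_eq_zero (hm : 3 ≤ m) {w y : W m} (hw : w = y ∨ w.length < y.length)
    (c : W m → ℝ) (h : ∀ z, bigRep hm (∑ z, c z • upElt y z) (bigVec w y) z w = 0) :
    ∑ z, c z • upElt y z = 0 := by
  refine Finset.sum_eq_zero fun z _ => ?_
  rcases upElt_spec y z with hz | hz
  · suffices hc : c z = 0 by rw [hc, zero_smul]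
    -- The coordinate (w, z) is hit only by the ascending path to z, with coefficient c z.
    rw [← h z, map_sum, LinearMap.sum_apply, Finset.sum_apply, Finsupp.finsetSum_apply,
      Finset.sum_eq_single z]
    · rw [map_smul, LinearMap.smul_apply, hz.bigRep_bigVec hm hw, Pi.smul_apply, Finsupp.smul_apply,
        bigVec_apply, if_pos rfl, smul_eq_mul, mul_one]
    · intro z' _ hne
      rw [map_smul, LinearMap.smul_apply]
      rcases upElt_spec y z' with hz' | hz'
      · rw [hz'.bigRep_bigVec hm hw, Pi.smul_apply, bigVec_apply_of_ne hne.symm, smul_zero]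
        rfl
      · rw [hz', map_zero, LinearMap.zero_apply, smul_zero]
        rfl
    · exact fun h' => absurd (Finset.mem_univ z) h'
  · rw [hz, smul_zero]

/-! ### Subrepresentations spanned by basis vectors, and their use as coordinates -/

/-- The vectors supported on a set of pairs. -/
def supportSpace (B : W m → W m → Prop) : Submodule ℝ (BigProj m) where
  carrier := {v | ∀ z, v z ∈ Finsupp.supported ℝ ℝ {y | B y z}}
  add_mem' hv hw z := Submodule.add_mem _ (hv z) (hw z)
  zero_mem' _ := Submodule.zero_mem _
  smul_mem' c _ hv z := Submodule.smul_mem _ c (hv z)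

theorem apply_eq_zero_of_mem_supportSpace {B : W m → W m → Prop} {v : BigProj m}
    (hv : v ∈ supportSpace B) {y z : W m} (h : ¬ B y z) : v z y = 0 := by
  by_contra h0
  exact h ((Finsupp.mem_supported ℝ _).1 (hv z) (Finsupp.mem_support_iff.2 h0))

theorem bigVec_mem_supportSpace {B : W m → W m → Prop} {y z : W m} (h : B y z) :
    bigVec y z ∈ supportSpace B := by
  intro z'
  by_cases hz : z' = z
  · subst hz
    rw [bigVec, Pi.single_eq_same]
    exact Finsupp.single_mem_supported ℝ 1 h
  · rw [bigVec_apply_of_ne hz]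
    exact Submodule.zero_mem _

/-- The sets of pairs that span subrepresentations. -/
structure IsStable (B : W m → W m → Prop) : Prop where
  up : ∀ y z z', B y z → z.length < z'.length → B y z'
  diag : ∀ z z', B z z → z'.length < z.length → B z' z'
  down : ∀ y z y' z', B y z → y.length < z.length → z'.length < z.length →
    y'.length < y.length → B y' z'

theorem IsStable.arrowOp_mem {B : W m → W m → Prop} (hB : IsStable B) {x y : W m}
    (h : x.length = y.length + 1 ∨ y.length = x.length + 1) {v : Wt m}
    (hv : v ∈ Finsupp.supported ℝ ℝ {w | B w x}) :
    arrowOp x y v ∈ Finsupp.supported ℝ ℝ {w | B w y} := by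
  have : Finsupp.supported ℝ ℝ {w | B w x}
      ≤ (Finsupp.supported ℝ ℝ {w | B w y}).comap (arrowOp x y) := by
    rw [Finsupp.supported_eq_span_single, Submodule.span_le]
    rintro _ ⟨w, hw, rfl⟩
    change arrowOp x y (Finsupp.single w 1) ∈ Finsupp.supported ℝ ℝ {w | B w y}
    have hw : B w x := hw
    by_cases hwx : w = x ∨ w.length < x.length
    · by_cases hxy : x.length < y.length
      · rw [arrowOp_up hxy hwx]
        exact Finsupp.single_mem_supported ℝ 1 (hB.up _ _ _ hw hxy)
      · rcases hwx with rfl | hwx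
        · rw [arrowOp_self hxy]
          exact Finsupp.single_mem_supported ℝ 1 (hB.diag _ _ hw (by omega))
        · rw [arrowOp_down hxy hwx]
          refine Finsupp.supported_mono ?_ (downOp_mem_below x y (n := w.length)
            (single_mem_below (Nat.lt_succ_self _)))
          intro w' hw'
          exact hB.down _ _ _ _ hw hwx (by omega) hw'
    · rw [arrowOp_of_not hwx]
      exact Submodule.zero_mem _
  exact this hv

theorem IsStable.bigRep_mem (hm : 3 ≤ m) {B : W m → W m → Prop} (hB : IsStable B) (a : P m)
    {v : BigProj m} (hv : v ∈ supportSpace B) : bigRep hm a v ∈ supportSpace B := by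
  let S : Submodule ℝ (P m) :=
    { carrier := {a | ∀ v ∈ supportSpace B, bigRep hm a v ∈ supportSpace B}
      add_mem' := fun ha hb v hv => by
        rw [map_add]
        exact Submodule.add_mem _ (ha v hv) (hb v hv)
      zero_mem' := fun v _ => by
        rw [map_zero]
        exact Submodule.zero_mem _
      smul_mem' := fun c a ha v hv => by
        rw [map_smul]
        exact Submodule.smul_mem _ c (ha v hv) }
  have h1 : (1 : P m) ∈ S := fun v hv => by
    rw [map_one]
    exact hv
  have hel : ∀ (x y : W m) (f : Module.End ℝ (Wt m)),
      (∀ v ∈ Finsupp.supported ℝ ℝ {w | B w x}, f v ∈ Finsupp.supported ℝ ℝ {w | B w y}) →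
      ∀ v ∈ supportSpace B, PathAlgebra.elementary x y f v ∈ supportSpace B := by
    intro x y f hf v hv z
    rw [PathAlgebra.elementary_apply]
    by_cases hz : z = y
    · subst hz
      rw [Pi.single_eq_same]
      exact hf _ (hv x)
    · rw [Pi.single_eq_of_ne hz]
      exact Submodule.zero_mem _
  have := mul_mem_of_generators S
    (fun x s hs v hv => by
      rw [map_mul, Module.End.mul_apply, bigRep_idem]
      exact hel _ _ _ (fun _ h => h) _ (hs v hv))
    (fun x y s hs v hv => by
      rw [map_mul, Module.End.mul_apply]
      by_cases h : x.length = y.length + 1 ∨ y.length = x.length + 1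
      · rw [bigRep_arr hm h]
        exact hel _ _ _ (fun _ h' => hB.arrowOp_mem h h') _ (hs v hv)
      · rw [arr_eq_zero h, map_zero]
        exact Submodule.zero_mem _) a h1
  rw [mul_one] at this
  exact this v hv

theorem isStable_lt (n : ℕ) : IsStable fun y _ : W m => y.length < n where
  up _ _ _ h _ := h
  diag _ _ h h' := h'.trans h
  down _ _ _ _ h _ _ h' := h'.trans h

/-- This contains everything generated by the pair (x, x), but no pair whose first entry is another
element of the same length; it separates the two descending arrows with common source. -/
theorem isStable_le (x : W m) : IsStable fun y _ : W m => y = x ∨ y.length < x.length where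
  up _ _ _ h _ := h
  diag _ _ h h' := by
    rcases h with rfl | h
    · exact Or.inr h'
    · exact Or.inr (h'.trans h)
  down _ _ _ _ h _ _ h' := by
    rcases h with rfl | h
    · exact Or.inr h'
    · exact Or.inr (h'.trans h)

/-- This contains the images of (x, x) under L_x and under the left ideal of the arrow x → y, but
not (x, y') for y' ≠ y of the same length as y; it separates the two ascending arrows. -/
theorem isStable_up {x y : W m} (hxy : x.length < y.length) :
    IsStable fun w z : W m => w.length < x.length ∨ (w = x ∧ (z = y ∨ y.length < z.length)) where
  up w z z' h h' := by
    rcases h with h | ⟨rfl, rfl | h⟩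
    · exact Or.inl h
    · exact Or.inr ⟨rfl, Or.inr h'⟩
    · exact Or.inr ⟨rfl, Or.inr (h.trans h')⟩
  diag z z' h h' := by
    rcases h with h | ⟨rfl, rfl | h⟩
    · exact Or.inl (h'.trans h)
    · exact absurd hxy (lt_irrefl _)
    · exact absurd hxy (lt_asymm h)
  down w z w' z' h _ _ h' := by
    rcases h with h | ⟨rfl, -⟩
    · exact Or.inl (h'.trans h)
    · exact Or.inl h'

/-- A first descending arrow shortens the first entry of (x, x), and no element of A lengthens it
again. -/
theorem bigRep_lowerIdeal (hm : 3 ≤ m) {x : W m} {b : P m} (hb : b ∈ lowerIdeal x) :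
    bigRep hm b (bigVec x x) ∈ supportSpace fun y _ : W m => y.length < x.length := by
  induction hb using Submodule.span_induction with
  | mem _ h =>
    obtain ⟨y, hy, rfl⟩ := h
    by_cases h : x.length = y.length + 1
    · rw [bigRep_arr_down hm h]
      exact bigVec_mem_supportSpace hy
    · rw [arr_eq_zero (by omega), map_zero]
      exact Submodule.zero_mem _
  | zero =>
    rw [map_zero]
    exact Submodule.zero_mem _
  | add _ _ _ _ h h' =>
    rw [map_add]
    exact Submodule.add_mem _ h h'
  | smul c _ _ h =>
    rw [smul_eq_mul, map_mul]
    exact (isStable_lt _).bigRep_mem hm c h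

/-- A criterion for membership in `lowerIdeal`. -/
theorem mem_lowerIdeal_of_bigRep (hm : 3 ≤ m) {y : W m} {b : P m} (hb : b * idem y = b)
    (h : ∀ z, bigRep hm b (bigVec y y) z y = 0) : b ∈ lowerIdeal y := by
  obtain ⟨c, d, hd, rfl⟩ := exists_sum_upElt hm hb
  rw [sum_upElt_eq_zero hm (Or.inl rfl) c fun z => ?_, zero_add]
  · exact hd
  · have h1 := h z
    rw [map_add, LinearMap.add_apply, Pi.add_apply, Finsupp.add_apply,
      apply_eq_zero_of_mem_supportSpace (bigRep_lowerIdeal hm hd) (lt_irrefl _), add_zero] at h1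
    exact h1

/-! ## The colon ideals -/

theorem mul_idem_of_mem_radIdeal {x : W m} {b : P m} (hb : b ∈ radIdeal x) : b * idem x = b := by
  induction hb using Submodule.span_induction with
  | mem _ h =>
    obtain ⟨y, rfl⟩ := h
    exact arr_mul_idem x y
  | zero => exact zero_mul _
  | add _ _ _ _ h h' => rw [add_mul, h, h']
  | smul c _ _ h => rw [smul_eq_mul, mul_assoc, h]

theorem lowerIdeal_le_radIdeal (x : W m) : lowerIdeal x ≤ radIdeal x :=
  Ideal.span_mono fun _ ⟨y, _, h⟩ => ⟨y, h⟩

theorem mul_idem_of_mem_lowerIdeal {x : W m} {b : P m} (hb : b ∈ lowerIdeal x) :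
    b * idem x = b := mul_idem_of_mem_radIdeal (lowerIdeal_le_radIdeal x hb)

/-- Modulo L_y, b is a combination of ascending paths. On (x, x) the product b · (x → y) then gives
the pairs (x, z) with the same coefficients, while L_x never reaches first entry x. -/
theorem mul_arr_mem_lowerIdeal (hm : 3 ≤ m) {x y : W m} (hxy : y.length = x.length + 1) {b : P m}
    (hb : b * idem y = b) : b * arr x y ∈ lowerIdeal x ↔ b ∈ lowerIdeal y := by
  have hl : ∀ {b}, b ∈ lowerIdeal y → b * arr x y ∈ lowerIdeal x := fun hb =>
    IsUp.mul_mem _ (fun z hz => up_down_mem hm (by omega) hz) hb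
  refine ⟨fun h => ?_, hl⟩
  obtain ⟨c, d, hd, rfl⟩ := exists_sum_upElt hm hb
  rw [add_mul, Ideal.add_mem_iff_left _ (hl hd)] at h
  -- The coefficients are read off from the pair (x, y) instead of (y, y): this is the vector to
  -- which the arrow x → y sends (x, x).
  rw [sum_upElt_eq_zero hm (w := x) (Or.inr (by omega)) c fun z => ?_, zero_add]
  · exact hd
  · have h1 := bigRep_lowerIdeal hm h
    rw [map_mul, Module.End.mul_apply, bigRep_arr_up hm hxy (Or.inl rfl)] at h1
    exact apply_eq_zero_of_mem_supportSpace h1 (lt_irrefl _)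

/-- Any arrow out of y₂ is absorbed: descending ones by L_x, ascending ones by the commuting square
through y₁. So only the coefficient of the idempotent can survive, and `isStable_up` excludes it. -/
theorem mul_arr_mem_sup (hm : 3 ≤ m) {x y₁ y₂ : W m} (h₁ : y₁.length = x.length + 1)
    (h₂ : y₂.length = x.length + 1) (hne : y₁ ≠ y₂) {b : P m} (hb : b * idem y₂ = b) :
    b * arr x y₂ ∈ lowerIdeal x ⊔ Ideal.span {arr x y₁} ↔ b ∈ radIdeal y₂ := by
  have hl : ∀ {b}, b ∈ radIdeal y₂ → b * arr x y₂ ∈ lowerIdeal x ⊔ Ideal.span {arr x y₁} := by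
    intro b hb
    induction hb using Submodule.span_induction with
    | mem _ h =>
      obtain ⟨z, rfl⟩ := h
      rcases lt_or_ge z.length y₂.length with hz | hz
      · exact Ideal.mem_sup_left (up_down_mem hm (by omega) hz)
      · by_cases hz' : z.length = y₂.length + 1
        · rw [up_up hm h₂ h₁ (by omega)]
          exact Ideal.mem_sup_right (Ideal.mul_mem_left _ _ (Ideal.mem_span_singleton_self _))
        · rw [arr_eq_zero (x := y₂) (y := z) (by omega), zero_mul]
          exact Ideal.zero_mem _
    | zero =>
      rw [zero_mul]
      exact Ideal.zero_mem _
    | add _ _ _ _ h h' =>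
      rw [add_mul]
      exact Ideal.add_mem _ h h'
    | smul c _ _ h =>
      rw [smul_eq_mul, mul_assoc]
      exact Ideal.mul_mem_left _ _ h
  refine ⟨fun h => ?_, hl⟩
  obtain ⟨c, d, hd, rfl⟩ := exists_smul_idem hb
  rw [add_mul, Ideal.add_mem_iff_left _ (hl hd), smul_mul_assoc, idem_mul_arr] at h
  suffices hc : c = 0 by
    rw [hc, zero_smul, zero_add]
    exact hd
  have hB := isStable_up (x := x) (y := y₁) (by omega)
  obtain ⟨p, hp, q, hq, hpq⟩ := Submodule.mem_sup.1 h
  obtain ⟨r, rfl⟩ := Ideal.mem_span_singleton'.1 hq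
  have hmem : bigRep hm (c • arr x y₂) (bigVec x x) ∈ supportSpace fun w z : W m =>
      w.length < x.length ∨ (w = x ∧ (z = y₁ ∨ y₁.length < z.length)) := by
    rw [← hpq, map_add, LinearMap.add_apply, map_mul, Module.End.mul_apply,
      bigRep_arr_up hm h₁ (Or.inl rfl)]
    refine Submodule.add_mem _ ?_
      (hB.bigRep_mem hm r (bigVec_mem_supportSpace (Or.inr ⟨rfl, Or.inl rfl⟩)))
    exact fun z => Finsupp.supported_mono (fun _ => Or.inl) (bigRep_lowerIdeal hm hp z)
  rw [map_smul, LinearMap.smul_apply, bigRep_arr_up hm h₂ (Or.inl rfl)] at hmem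
  have h0 := apply_eq_zero_of_mem_supportSpace (y := x) (z := y₂) hmem (by
    rintro (h | ⟨-, h | h⟩)
    · exact lt_irrefl _ h
    · exact hne h.symm
    · omega)
  rw [Pi.smul_apply, Finsupp.smul_apply, bigVec_apply, if_pos rfl, smul_eq_mul, mul_one] at h0
  exact h0

/-- If b · (x → y₂) = r · (x → y₁), then on (x, x) the vectors b(y₂, y₂) and r(y₁, y₁) agree. The
latter has no entry y₂, so b lies in L_{y₂}. Conversely a descent from y₂ passes through the
commuting square to y₁. -/
theorem mul_arr_mem_span (hm : 3 ≤ m) {x y₁ y₂ : W m} (h₁ : x.length = y₁.length + 1)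
    (h₂ : x.length = y₂.length + 1) (hne : y₁ ≠ y₂) {b : P m} (hb : b * idem y₂ = b) :
    b * arr x y₂ ∈ Ideal.span {arr x y₁} ↔ b ∈ lowerIdeal y₂ := by
  constructor
  · intro h
    obtain ⟨r, hr⟩ := Ideal.mem_span_singleton'.1 h
    refine mem_lowerIdeal_of_bigRep hm hb fun z => ?_
    have h1 : bigRep hm b (bigVec y₂ y₂) = bigRep hm r (bigVec y₁ y₁) := by
      rw [← bigRep_arr_down hm h₁, ← bigRep_arr_down hm h₂, ← Module.End.mul_apply,
        ← Module.End.mul_apply, ← map_mul, ← map_mul, hr]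
    rw [h1]
    refine apply_eq_zero_of_mem_supportSpace ((isStable_le y₁).bigRep_mem hm r
      (bigVec_mem_supportSpace (Or.inl rfl))) ?_
    rintro (h | h)
    · exact hne h.symm
    · omega
  · refine IsUp.mul_mem _ fun z hz => ?_
    by_cases h : y₂.length = z.length + 1
    · rw [down_down hm (y' := y₁) h (by omega) (by omega)]
      exact Ideal.mul_mem_left _ _ (Ideal.mem_span_singleton_self _)
    · rw [arr_eq_zero (x := y₂) (y := z) (by omega), zero_mul]
      exact Ideal.zero_mem _

theorem lowerIdeal_eq_bot {x : W m} (hx : x.length = 0) : lowerIdeal x = ⊥ := by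
  rw [lowerIdeal, Ideal.span_eq_bot]
  rintro _ ⟨y, hy, rfl⟩
  omega

theorem lowerIdeal_eq_sup (hm : 3 ≤ m) {x : W m} {n : ℕ} (hx : x.length = n + 1) :
    lowerIdeal x = Ideal.span {arr x (word m .s n)} ⊔ Ideal.span {arr x (word m .t n)} := by
  have hl : ∀ c, (word m c n).length = n := fun c => length_word c (by
    have := x.length_le
    omega)
  refine le_antisymm (Ideal.span_le.2 ?_) (sup_le (Ideal.span_le.2 ?_) (Ideal.span_le.2 ?_))
  · rintro _ ⟨y, hy, rfl⟩
    by_cases h : y.length = n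
    · rcases y.eq_word (by omega) h .s with rfl | rfl
      · exact Ideal.mem_sup_left (Ideal.mem_span_singleton_self _)
      · exact Ideal.mem_sup_right (Ideal.mem_span_singleton_self _)
    · rw [arr_eq_zero (x := x) (y := y) (by omega)]
      exact Ideal.zero_mem _
  · rintro _ rfl
    exact arr_mem_lowerIdeal (by rw [hl]; omega)
  · rintro _ rfl
    exact arr_mem_lowerIdeal (by rw [hl]; omega)

theorem radIdeal_eq_lowerIdeal {x : W m} (hx : x.length = m) : radIdeal x = lowerIdeal x := by
  refine le_antisymm (Ideal.span_le.2 ?_) (lowerIdeal_le_radIdeal x)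
  rintro _ ⟨y, rfl⟩
  have := y.length_le
  by_cases h : y.length < x.length
  · exact arr_mem_lowerIdeal h
  · rw [arr_eq_zero (x := x) (y := y) (by omega)]
    exact Ideal.zero_mem _

theorem radIdeal_eq_sup (hm : 3 ≤ m) (x : W m) :
    radIdeal x = lowerIdeal x ⊔ Ideal.span {arr x (word m .s (x.length + 1))}
      ⊔ Ideal.span {arr x (word m .t (x.length + 1))} := by
  refine le_antisymm (Ideal.span_le.2 ?_) (sup_le (sup_le (lowerIdeal_le_radIdeal x)
    (Ideal.span_le.2 ?_)) (Ideal.span_le.2 ?_))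
  · rintro _ ⟨y, rfl⟩
    by_cases h : y.length = x.length + 1
    · rcases y.eq_word (by omega) h .s with hy | hy <;> rw [hy]
      · exact Ideal.mem_sup_left (Ideal.mem_sup_right (Ideal.mem_span_singleton_self _))
      · exact Ideal.mem_sup_right (Ideal.mem_span_singleton_self _)
    · by_cases h' : y.length < x.length
      · exact Ideal.mem_sup_left (Ideal.mem_sup_left (arr_mem_lowerIdeal h'))
      · rw [arr_eq_zero (x := x) (y := y) (by omega)]
        exact Ideal.zero_mem _
  · rintro _ rfl
    exact arr_mem_radIdeal _ _
  · rintro _ rfl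
    exact arr_mem_radIdeal _ _

/-- The projective `A e_y` acts faithfully on the vector of the path that descends to `y`. -/
theorem eq_zero_of_bigRep (hm : 3 ≤ m) : ∀ (n : ℕ) {y : W m} {b : P m}, y.length = n →
    b * idem y = b → bigRep hm b (bigVec y y) = 0 → b = 0 := by
  intro n
  induction n with
  | zero =>
    intro y b hy hb h
    have := mem_lowerIdeal_of_bigRep hm hb (fun z => by rw [h]; rfl)
    rwa [lowerIdeal_eq_bot hy, Ideal.mem_bot] at this
  | succ n ih =>
    intro y b hy hb h
    have hl : ∀ c, (word m c n).length = n := fun c => length_word c (by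
      have := y.length_le
      omega)
    have hbl := mem_lowerIdeal_of_bigRep hm hb (fun z => by rw [h]; rfl)
    rw [lowerIdeal_eq_sup hm hy] at hbl
    -- The two generators of L_y are compared on the coordinate of the second target. Its
    -- coefficient must lie in L of that target, and the descending square moves that contribution
    -- to the first generator.
    have key : b ∈ Ideal.span {arr y (word m .s n)} := by
      obtain ⟨p, hp, q, hq, rfl⟩ := Submodule.mem_sup.1 hbl
      obtain ⟨r, rfl⟩ := Ideal.mem_span_singleton'.1 hp
      obtain ⟨r', rfl⟩ := Ideal.mem_span_singleton'.1 hq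
      refine Ideal.add_mem _ hp ?_
      by_cases hne : word m .s n = word m .t n
      · rw [← hne]
        exact Ideal.mul_mem_left _ _ (Ideal.mem_span_singleton_self _)
      · have hr : r' * idem (word m .t n) * idem (word m .t n) = r' * idem (word m .t n) := by
          rw [mul_assoc, idem_mul_self]
        have hrt : r' * arr y (word m .t n) = r' * idem (word m .t n) * arr y (word m .t n) := by
          rw [mul_assoc, idem_mul_arr]
        rw [hrt, mul_arr_mem_span hm (by rw [hl, hy]) (by rw [hl, hy]) hne hr]
        refine mem_lowerIdeal_of_bigRep hm hr fun z => ?_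
        have h1 : bigRep hm (r' * idem (word m .t n)) (bigVec (word m .t n) (word m .t n))
            = bigRep hm (-r) (bigVec (word m .s n) (word m .s n)) := by
          rw [← bigRep_arr_down hm (x := y) (y := word m .s n) (by rw [hl, hy]),
            ← bigRep_arr_down hm (x := y) (y := word m .t n) (by rw [hl, hy]),
            ← Module.End.mul_apply, ← Module.End.mul_apply, ← map_mul, ← map_mul, mul_assoc,
            idem_mul_arr, neg_mul, map_neg, LinearMap.neg_apply, eq_neg_iff_add_eq_zero,
            ← LinearMap.add_apply, ← map_add, add_comm, h]
        rw [h1]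
        refine apply_eq_zero_of_mem_supportSpace ((isStable_le _).bigRep_mem hm _
          (bigVec_mem_supportSpace (Or.inl rfl))) ?_
        rintro (h | h)
        · exact hne h.symm
        · rw [hl, hl] at h
          exact lt_irrefl _ h
    obtain ⟨r, rfl⟩ := Ideal.mem_span_singleton'.1 key
    -- Now b = r · (y → y'), and b applied to (y, y) is r applied to (y', y'): the induction
    -- hypothesis for the shorter vertex y' applies.
    have h0 : r * idem (word m .s n) = 0 := by
      refine ih (hl .s) (by rw [mul_assoc, idem_mul_self]) ?_
      rw [← bigRep_arr_down hm (x := y) (y := word m .s n) (by rw [hl, hy]),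
        ← Module.End.mul_apply, ← map_mul, mul_assoc, idem_mul_arr, h]
    rw [← idem_mul_arr, ← mul_assoc, h0, zero_mul]

/-- The arrow takes (x, x) to (y, y), where A e_y acts faithfully. Thus the left ideal of a
descending arrow is free over A e_y. -/
theorem mul_arr_eq_zero (hm : 3 ≤ m) {x y : W m} (h : x.length = y.length + 1) {b : P m}
    (hb : b * idem y = b) : b * arr x y = 0 ↔ b = 0 := by
  refine ⟨fun h0 => eq_zero_of_bigRep hm _ rfl hb ?_, fun h0 => by rw [h0, zero_mul]⟩
  rw [← bigRep_arr_down hm h, ← Module.End.mul_apply, ← map_mul, h0, map_zero, LinearMap.zero_apply]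

/-! ## The linear resolutions -/

theorem isLinear_lowerIdeal (hm : 3 ≤ m) : ∀ (n : ℕ) {x : W m}, x.length = n →
    (lowerIdeal x).IsLinear (P.grading m) := by
  intro n
  induction n with
  | zero =>
    intro x hx
    rw [lowerIdeal_eq_bot hx]
    exact Ideal.IsLinear.bot
  | succ n ih =>
    intro x hx
    have hl : ∀ c, (word m c n).length = n := fun c => length_word c (by
      have := x.length_le
      omega)
    have h₁ : (Ideal.span {arr x (word m .s n)}).IsLinear (P.grading m) :=
      Ideal.IsLinear.bot.step Ideal.IsLinear.bot (idem_mul_self _) (idem_mem _) (arr_mem _ _)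
        (idem_mul_arr _ _) (by rw [bot_sup_eq])
        (fun c hc => by rw [Ideal.mem_bot.1 hc, zero_mul])
        (fun b hb => by
          rw [Ideal.mem_bot, Ideal.mem_bot]
          exact mul_arr_eq_zero hm (y := word m .s n) (by rw [hl, hx]) hb)
    rw [lowerIdeal_eq_sup hm hx]
    -- The words coincide when n = 0, both being e; then there is a single generator.
    by_cases hne : word m .s n = word m .t n
    · rwa [← hne, sup_idem]
    · exact h₁.step (ih (hl .t)) (idem_mul_self _) (idem_mem _) (arr_mem _ _)
        (idem_mul_arr _ _) rfl (fun c hc => mul_idem_of_mem_lowerIdeal hc)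
        (fun b hb => mul_arr_mem_span hm (by rw [hl, hx]) (by rw [hl, hx]) hne hb)

/-- The second colon ideal is R of a longer vertex, so the induction runs down from w₀, where R and
L coincide. -/
theorem isLinear_radIdeal (hm : 3 ≤ m) : ∀ (n : ℕ) {x : W m}, x.length + n = m →
    (radIdeal x).IsLinear (P.grading m) := by
  intro n
  induction n with
  | zero =>
    intro x hx
    rw [radIdeal_eq_lowerIdeal hx]
    exact isLinear_lowerIdeal hm _ rfl
  | succ n ih =>
    intro x hx
    have hl : ∀ c, (word m c (x.length + 1)).length = x.length + 1 := fun c =>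
      length_word c (by omega)
    have h₁ : (lowerIdeal x ⊔ Ideal.span {arr x (word m .s (x.length + 1))}).IsLinear
        (P.grading m) :=
      (isLinear_lowerIdeal hm _ rfl).step (isLinear_lowerIdeal hm _ (hl .s)) (idem_mul_self _)
        (idem_mem _) (arr_mem _ _) (idem_mul_arr _ _) rfl
        (fun c hc => mul_idem_of_mem_lowerIdeal hc)
        (fun b hb => mul_arr_mem_lowerIdeal hm (hl .s) hb)
    rw [radIdeal_eq_sup hm]
    -- Directly below w₀ the two ascending arrows coincide, and one generator suffices.
    by_cases hne : word m .s (x.length + 1) = word m .t (x.length + 1)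
    · rwa [← hne, sup_assoc, sup_idem]
    · exact h₁.step (ih (x := word m .t (x.length + 1)) (by rw [hl]; omega)) (idem_mul_self _)
        (idem_mem _) (arr_mem _ _) (idem_mul_arr _ _) rfl
        (fun c hc => mul_idem_of_mem_radIdeal hc)
        (fun b hb => mul_arr_mem_sup hm (hl .s) (hl .t) hne hb)

/-- Right multiplication by the idempotent at x fixes R_x and kills R_y for y ≠ x, so the sum over
vertices is direct and the resolutions can be added up. -/
theorem isLinear_arrowIdeal (hm : 3 ≤ m) : (arrowIdeal m).IsLinear (P.grading m) := by
  have key : ∀ s : Finset (W m), (s.sup radIdeal).IsLinear (P.grading m) := by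
    intro s
    induction s using Finset.induction_on with
    | empty => exact Ideal.IsLinear.bot
    | insert x s hx ih =>
      rw [Finset.sup_insert, sup_comm]
      refine ih.sup_of_idempotent (isLinear_radIdeal hm (m - x.length) (by
        have := x.length_le
        omega)) (idem_mem x) ?_ (fun b hb => mul_idem_of_mem_radIdeal hb)
      have hle : s.sup radIdeal ≤ LinearMap.ker (LinearMap.toSpanSingleton (P m) (P m) (idem x)) := by
        refine Finset.sup_le fun y hy b hb => ?_
        have hne : y ≠ x := by
          rintro rfl
          exact hx hy
        rw [LinearMap.mem_ker, LinearMap.toSpanSingleton_apply, smul_eq_mul,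
          ← mul_idem_of_mem_radIdeal hb, mul_assoc, idem_mul_of_ne hne, mul_zero]
      exact fun b hb => hle hb
  rw [arrowIdeal, ← Finset.sup_univ_eq_iSup]
  exact key _

end Dihedral

theorem mainTheorem4 (m : ℕ) (hm : 3 ≤ m) : IsKoszul (Dihedral.P.grading m) :=
  ⟨Dihedral.isSemisimpleRing_gradingZero,
    nonempty_linearResolution (Dihedral.isLinear_arrowIdeal hm) Dihedral.mem_arrowIdeal_iff⟩
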